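/- Let $(M,g)$ be a smooth $n$-dimensional Riemannian manifold (Hausdorff, second countable, without boundary) with Levi-Civita connection, associated covariant derivative $\frac{D}{dt}$ along curves, and Riemannian distance $d$. Let $W\in C^\infty(M)$, let $f_1,\dots,f_m$ be smooth vector fields on $M$, let $\Omega\subset\mathbb{R}^m$ be closed and convex, let $K\subset TM$ be compact, $(q_0,v_0)\in TM$ and $T>0$. Consider the controlled robot dynamics $$\dot q=v,\qquad \frac{Dv}{dt}=-\operatorname{grad}W(q)+\sum_{j=1}^m u_j f_j(q)\ \text{ a.e.},\qquad (q(0),v(0))=(q_0,v_0),\qquad (1)$$ with $v$ absolutely continuous. Let $U_T$ be the set of controls $u\in L^2([0,T],\Omega)$ whose trajectory $(q_u,v_u)$ solving (1) is defined on $[0,T]$ and stays in $K$; assume $U_T\neq\emptyset$. Let $q_{ref}:[0,T]\to M$ be a $C^1$ reference curve with velocity $v_{ref}=\dot q_{ref}$. For $p,q\in M$ put $U(p,q)=\frac12 d(p,q)^2$, and let $P(q,p):T_pM\to T_qM$ be the parallel transport along the minimizing geodesic from $p$ to $q$ when this geodesic is unique. Assume that, for every $u\in U_T$ and $t\in[0,T]$,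 the points $p=q_{ref}(t)$ and $q=q_u(t)$ are close in the following sense: there is exactly one minimizing geodesic $[0,1]\to M$ from $p$ to $q$, and $\exp_p$ is defined on $\{w\in T_pM: |w|\le d(p,q)\}$. (Both hold if $d(p,q)$ is less than the injectivity radius at $p$; the second one also holds if $M$ is complete.) Then, for every $u\in U_T$, the integrand of $$J(u)=\int_0^T\Big(\|u\|^2+\tfrac12\big|v_u-P(q_u,q_{ref})v_{ref}\big|^2+U(q_{ref},q_u)\Big)\,dt$$ is integrable on $[0,T]$, and there exists an optimal control, that is, a $u^*\in U_T$ with $J(u^*)\le J(u)$ for all $u\in U_T$. -/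

import Mathlib

open Set MeasureTheory Manifold Bundle
open scoped ContDiff ENNReal

noncomputable section

namespace Robot

/-- Euclidean `n`-space. -/
abbrev Euc (n : ℕ) : Type := EuclideanSpace ℝ (Fin n)

variable {n m : ℕ} {M : Type*} [TopologicalSpace M] [ChartedSpace (Euc n) M]
  [IsManifold (𝓡 n) ∞ M]

section Coordinates

/-- Coordinates `φ_c(q)` of a point `q` in the chart `φ_c` of `M` around `c`. -/
def posCoord (c q : M) : Euc n := extChartAt (𝓡 n) c q

/-- Components `dφ_c(v)` of a tangent vector `(q, v)` in the chart `φ_c` around `c`. -/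
def velCoord (c : M) (p : TangentBundle (𝓡 n) M) : Euc n :=
  (trivializationAt (Euc n) (TangentSpace (𝓡 n)) c p).2

/-- The coordinate vector `∂/∂xᵢ` of the chart around `c`, at the point with coordinates `y`. -/
def coordFrame (c : M) (y : Euc n) (i : Fin n) :
    TangentSpace (𝓡 n) ((extChartAt (𝓡 n) c).symm y) :=
  (trivializationAt (Euc n) (TangentSpace (𝓡 n)) c).symmL ℝ ((extChartAt (𝓡 n) c).symm y)
    (EuclideanSpace.single i 1)

end Coordinates

variable [RiemannianBundle (fun x : M => TangentSpace (𝓡 n) x)]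

section LeviCivita

/-- The matrix `g_{ij}(y) = ⟨∂/∂xᵢ, ∂/∂xⱼ⟩` of the metric in the chart around `c`. -/
def gram (c : M) (y : Euc n) : Matrix (Fin n) (Fin n) ℝ :=
  Matrix.of fun i j => inner ℝ (coordFrame c y i) (coordFrame c y j)

/-- The partial derivative `∂ₖ g_{ij}(y)`. -/
def gramDeriv (c : M) (y : Euc n) (k i j : Fin n) : ℝ :=
  fderiv ℝ (fun y' => gram c y' i j) y (EuclideanSpace.single k 1)

/-- The Christoffel symbol
`Γᵏ_{ij} = ½ ∑ₗ g^{kl} (∂ᵢ g_{jl} + ∂ⱼ g_{il} - ∂ₗ g_{ij})` of the Levi-Civita connection. -/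
def christoffel (c : M) (y : Euc n) (k i j : Fin n) : ℝ :=
  (1 / 2) * ∑ l, (gram c y)⁻¹ k l *
    (gramDeriv c y i j l + gramDeriv c y j i l - gramDeriv c y l i j)

/-- The vector with components `∑_{i,j} Γᵏ_{ij}(y) aⁱ bʲ`. -/
def christoffelVec (c : M) (y a b : Euc n) : Euc n :=
  WithLp.toLp 2 fun k => ∑ i, ∑ j, christoffel c y k i j * a i * b j

/-- The base curve of `z : ℝ → TM` has velocity `z` on `s`, that is, `z = (γ, γ̇)` on `s`. -/
def HasVelocityOn (z : ℝ → TangentBundle (𝓡 n) M) (s : Set ℝ) : Prop :=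
  ∀ t ∈ s, HasMFDerivWithinAt 𝓘(ℝ, ℝ) (𝓡 n) (fun τ => (z τ).proj) s t
    (ContinuousLinearMap.toSpanSingleton ℝ (z t).snd)

/-- `Y` is parallel on `s` along the curve `γ` with `z = (γ, γ̇)`: in every chart,
`Ẏᵏ + ∑ Γᵏ_{ij}(γ) γ̇ⁱ Yʲ = 0`. -/
def IsParallelOn (z Y : ℝ → TangentBundle (𝓡 n) M) (s : Set ℝ) : Prop :=
  ∀ t ∈ s, (Y t).proj = (z t).proj ∧
    ∀ c : M, (z t).proj ∈ (chartAt (Euc n) c).source →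
      HasDerivWithinAt (fun τ => velCoord c (Y τ))
        (-christoffelVec c (posCoord c (z t).proj) (velCoord c (z t)) (velCoord c (Y t))) s t

/-- `z = (γ, γ̇)` on `[0, 1]` for a geodesic `γ`, that is, `D γ̇ / dt = 0`. -/
def IsGeodesic (z : ℝ → TangentBundle (𝓡 n) M) : Prop :=
  HasVelocityOn z (Icc 0 1) ∧ IsParallelOn z z (Icc 0 1)

/-- `z = (γ, γ̇)` for a minimizing geodesic `γ : [0, 1] → M` from `p` to `q`: its constant
speed, which is its length, is the Riemannian distance from `p` to `q`. -/
def IsMinGeodesic (p q : M) (z : ℝ → TangentBundle (𝓡 n) M) : Prop :=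
  IsGeodesic z ∧ (z 0).proj = p ∧ (z 1).proj = q ∧
    ∀ t ∈ Icc (0 : ℝ) 1, ‖(z t).snd‖ₑ = riemannianEDist (𝓡 n) p q

/-- `w' ∈ T_q M` is the parallel translate of `w ∈ T_p M` along a minimizing geodesic. -/
def IsTransport (p q : M) (w : TangentSpace (𝓡 n) p) (w' : TangentSpace (𝓡 n) q) : Prop :=
  ∃ z Y : ℝ → TangentBundle (𝓡 n) M, IsMinGeodesic p q z ∧ IsParallelOn z Y (Icc 0 1) ∧
    Y 0 = ⟨p, w⟩ ∧ Y 1 = ⟨q, w'⟩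

open scoped Classical in
/-- `P(q, p) w`, the parallel transport of `w ∈ T_p M` to `T_q M` along the minimizing geodesic
from `p` to `q` (meaningful when that geodesic is unique). -/
def transport (q p : M) (w : TangentSpace (𝓡 n) p) : TangentSpace (𝓡 n) q :=
  if h : ∃ w' : TangentSpace (𝓡 n) q, IsTransport p q w w' then h.choose else 0

variable (n) in
/-- `q` is close to `p` in the following sense: there is exactly one minimizing geodesic from
`p` to `q`, and `exp_p` is defined on the closed ball of radius `d(p, q)` in `T_p M`.
Both hold when `d(p, q)` is less than the injectivity radius at `p`; the second one also holds
whenever `M` is complete. -/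
def IsClose (p q : M) : Prop :=
  (∃ z : ℝ → TangentBundle (𝓡 n) M, IsMinGeodesic p q z ∧
    ∀ z' : ℝ → TangentBundle (𝓡 n) M, IsMinGeodesic p q z' → EqOn z' z (Icc 0 1)) ∧
  ∀ w : TangentSpace (𝓡 n) p, ‖w‖ₑ ≤ riemannianEDist (𝓡 n) p q →
    ∃ z : ℝ → TangentBundle (𝓡 n) M, IsGeodesic z ∧ z 0 = ⟨p, w⟩

variable (n) in
/-- The function `U(p, q) = ½ d(p, q)²`. -/
def halfSqDist (p q : M) : ℝ := (1 / 2) * (riemannianEDist (𝓡 n) p q).toReal ^ 2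

/-- The Riemannian gradient: `⟨grad W (q), v⟩ = dW_q(v)`. -/
def grad (W : M → ℝ) (q : M) : TangentSpace (𝓡 n) q :=
  haveI : FiniteDimensional ℝ (TangentSpace (𝓡 n) q) :=
    inferInstanceAs (FiniteDimensional ℝ (Euc n))
  haveI : CompleteSpace (TangentSpace (𝓡 n) q) := FiniteDimensional.complete ℝ _
  (InnerProductSpace.toDual ℝ (TangentSpace (𝓡 n) q)).symm
    (mfderiv (𝓡 n) 𝓘(ℝ, ℝ) W q : TangentSpace (𝓡 n) q →L[ℝ] ℝ)

end LeviCivita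

section Control

/-- The total force `-grad W (q) + ∑ⱼ aⱼ fⱼ(q)` as a point of the tangent bundle. -/
def force (W : M → ℝ) (f : Fin m → ∀ q : M, TangentSpace (𝓡 n) q) (a : Euc m) (q : M) :
    TangentBundle (𝓡 n) M :=
  ⟨q, -grad W q + ∑ j, a j • f j q⟩

/-- `z = (q, v)` solves `q̇ = v`, `Dv/dt = -grad W (q) + ∑ⱼ uⱼ fⱼ(q)` a.e. on `[0, T]` with `v`
absolutely continuous: in every chart, `vᵏ` is an indefinite integral of
`(-grad W (q) + ∑ⱼ uⱼ fⱼ(q))ᵏ - ∑ Γᵏ_{ij}(q) vⁱ vʲ` on each time interval that `q` spends there. -/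
def IsTrajectory (W : M → ℝ) (f : Fin m → ∀ q : M, TangentSpace (𝓡 n) q) (T : ℝ)
    (u : ℝ → Euc m) (z : ℝ → TangentBundle (𝓡 n) M) : Prop :=
  HasVelocityOn z (Icc 0 T) ∧
  ∀ (c : M) (a b : ℝ), 0 ≤ a → a ≤ b → b ≤ T →
    (∀ t ∈ Icc a b, (z t).proj ∈ (chartAt (Euc n) c).source) →
    IntervalIntegrable (fun t => velCoord c (force W f (u t) (z t).proj) -
      christoffelVec c (posCoord c (z t).proj) (velCoord c (z t)) (velCoord c (z t))) volume a b ∧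
    velCoord c (z b) = velCoord c (z a) +
      ∫ t in a..b, (velCoord c (force W f (u t) (z t).proj) -
        christoffelVec c (posCoord c (z t).proj) (velCoord c (z t)) (velCoord c (z t)))

/-- `u ∈ U_T`, with trajectory `z`: the control `u` belongs to `L²([0, T], Ω)`, and the trajectory
`z` of `u` starting at `z₀` is defined on `[0, T]` and stays in `K`. -/
def IsAdmissible (W : M → ℝ) (f : Fin m → ∀ q : M, TangentSpace (𝓡 n) q) (Ω : Set (Euc m))
    (K : Set (TangentBundle (𝓡 n) M)) (z₀ : TangentBundle (𝓡 n) M) (T : ℝ)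
    (u : ℝ → Euc m) (z : ℝ → TangentBundle (𝓡 n) M) : Prop :=
  MemLp u 2 (volume.restrict (Icc 0 T)) ∧
  (∀ᵐ t ∂(volume.restrict (Icc 0 T)), u t ∈ Ω) ∧
  IsTrajectory W f T u z ∧ z 0 = z₀ ∧ ∀ t ∈ Icc 0 T, z t ∈ K

/-- The running cost `‖u‖² + ½ |v - P(q, q_ref) v_ref|² + U(q_ref, q)` at time `t`, where
`v_ref` is the velocity of `q_ref`. -/
def trackingLagrangian (T : ℝ) (qref : ℝ → M) (u : ℝ → Euc m)
    (z : ℝ → TangentBundle (𝓡 n) M) (t : ℝ) : ℝ :=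
  ‖u t‖ ^ 2 +
    (1 / 2) * ‖(z t).snd - transport (z t).proj (qref t)
      (mfderivWithin 𝓘(ℝ, ℝ) (𝓡 n) qref (Icc 0 T) t (1 : ℝ))‖ ^ 2 +
    halfSqDist n (qref t) (z t).proj

/-- The tracking cost `J`. -/
def trackingCost (T : ℝ) (qref : ℝ → M) (u : ℝ → Euc m)
    (z : ℝ → TangentBundle (𝓡 n) M) : ℝ :=
  ∫ t in (0 : ℝ)..T, trackingLagrangian T qref u z t

end Control

end Robot

end

/-! This is the direct method of the calculus of variations, run over pairs of a control and a
trajectory, so that uniqueness of trajectories is never needed. Along a minimizing sequence the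
energies ∫‖u‖² are bounded, because the tracking error (the rest of the running cost) is
nonnegative. Bounded sequences in L² have weakly convergent subsequences
(`exists_subseq_weaklyTendsto`). The trajectories stay in the compact `K` and are equicontinuous
(`exists_local_equicontinuity`), so Arzelà–Ascoli gives a limit curve (`exists_subseq_convergesOn`).

The acceleration is affine in the control, with coefficients that are continuous in the state. The
integrated equation contains the control only through a product of strongly convergent coefficients
with a weakly convergent control, and such products pass to the limit
(`WeaklyTendsto.tendsto_integral_clm`). Hence the limit curve is a trajectory of the weak limit
(`isTrajectory_of_convergesOn`). The closed convex constraint survives (`WeaklyTendsto.ae_mem`), the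
energy is weakly lower semicontinuous (`WeaklyTendsto.integral_norm_sq_le`), and Fatou's lemma
handles the tracking error.

Fatou needs pointwise convergence of the tracking error, hence continuity of parallel transport on
pairs of close points (`tendsto_transport`). Geodesics and parallel fields solve ordinary
differential equations in charts, so they depend continuously on initial values
(`tendsto_geodesic_parallel`); passing between charts rests on the transformation law
`christoffelMap_transition`. When close pairs converge to a close pair, the initial velocities of
the minimizing geodesics have length equal to the distance, so they subconverge. Since exp_p is
defined on the closed ball of radius d(p, q), the limit velocity starts a geodesic on [0, 1]. It is
again minimizing, so it is the unique one. The same continuity along a single trajectory makes the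
integrand integrable. -/

noncomputable section

namespace Robot

open Filter Topology

/-! ### Operator norms on spaces of linear and bilinear maps -/

section Instances

variable {n : ℕ}

instance : NormedAddCommGroup (Euc n →L[ℝ] ℝ) := ContinuousLinearMap.toNormedAddCommGroup
instance : NormedSpace ℝ (Euc n →L[ℝ] ℝ) := ContinuousLinearMap.toNormedSpace
instance : NormedAddCommGroup (Euc n →L[ℝ] Euc n) := ContinuousLinearMap.toNormedAddCommGroup
instance : NormedSpace ℝ (Euc n →L[ℝ] Euc n) := ContinuousLinearMap.toNormedSpace
instance : NormedAddCommGroup (Euc n →L[ℝ] Euc n →L[ℝ] ℝ) :=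
  ContinuousLinearMap.toNormedAddCommGroup
instance : NormedSpace ℝ (Euc n →L[ℝ] Euc n →L[ℝ] ℝ) := ContinuousLinearMap.toNormedSpace
instance : NormedAddCommGroup (Euc n →L[ℝ] Euc n →L[ℝ] Euc n) :=
  ContinuousLinearMap.toNormedAddCommGroup
instance : NormedSpace ℝ (Euc n →L[ℝ] Euc n →L[ℝ] Euc n) := ContinuousLinearMap.toNormedSpace

end Instances

variable {n m : ℕ} {M : Type*} [TopologicalSpace M] [ChartedSpace (Euc n) M]
  [IsManifold (𝓡 n) ∞ M]

/-! ### Charts of the tangent bundle and its topology -/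

section Charts

/-- The chart of `TM` induced by the chart of `M` around `c`. -/
def bchart (c : M) : OpenPartialHomeomorph (TangentBundle (𝓡 n) M) (Euc n × Euc n) :=
  chartAt (ModelProd (Euc n) (Euc n)) (⟨c, 0⟩ : TangentBundle (𝓡 n) M)

lemma bchart_apply (c : M) (p : TangentBundle (𝓡 n) M) :
    bchart c p = (posCoord c p.proj, velCoord c p) := by
  rfl

lemma bchart_source (c : M) : (bchart (n := n) c).source =
    {p | p.proj ∈ (chartAt (Euc n) c).source} := by
  ext p
  simp [bchart, TangentBundle.mem_chart_source_iff]

lemma velCoord_eq (c : M) (q : M) (hq : q ∈ (chartAt (Euc n) c).source) (w : TangentSpace (𝓡 n) q) :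
    velCoord c (⟨q, w⟩ : TangentBundle (𝓡 n) M) =
      (trivializationAt (Euc n) (TangentSpace (𝓡 n)) c).continuousLinearMapAt ℝ q w := by
  rw [Trivialization.continuousLinearMapAt_apply, Trivialization.linearMapAt_apply]
  simp [hq, velCoord]

lemma velCoord_symmL (c : M) (q : M) (hq : q ∈ (chartAt (Euc n) c).source) (y : Euc n) :
    velCoord c (⟨q, (trivializationAt (Euc n) (TangentSpace (𝓡 n)) c).symmL ℝ q y⟩ :
      TangentBundle (𝓡 n) M) = y := by
  rw [velCoord_eq c q hq, Trivialization.continuousLinearMapAt_symmL]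
  simpa using hq

lemma symmL_velCoord (c : M) (q : M) (hq : q ∈ (chartAt (Euc n) c).source)
    (w : TangentSpace (𝓡 n) q) :
    (trivializationAt (Euc n) (TangentSpace (𝓡 n)) c).symmL ℝ q
      (velCoord c (⟨q, w⟩ : TangentBundle (𝓡 n) M)) = w := by
  rw [velCoord_eq c q hq, Trivialization.symmL_continuousLinearMapAt]
  simpa using hq

lemma velCoord_change (c c' : M) (q : M) (hq : q ∈ (chartAt (Euc n) c).source)
    (hq' : q ∈ (chartAt (Euc n) c').source) (w : TangentSpace (𝓡 n) q) :
    velCoord c' (⟨q, w⟩ : TangentBundle (𝓡 n) M) =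
      fderiv ℝ (posCoord c' ∘ (extChartAt (𝓡 n) c).symm) (posCoord c q)
       (velCoord c (⟨q, w⟩ : TangentBundle (𝓡 n) M)) := by
  -- The fibre over `q` is identified with the model space through the chart at `q` itself, so both
  -- components are coordinate changes out of that chart and the cocycle identity applies.
  have h1 := tangentCoordChange_comp (I := 𝓡 n) (w := q) (x := c) (y := c') (z := q) (v := w)
    (by simp [hq, hq'])
  have h2 : ∀ c'' : M, velCoord c'' (⟨q, w⟩ : TangentBundle (𝓡 n) M) =
      tangentCoordChange (𝓡 n) q c'' q w := by
    intro c''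
    rw [velCoord, TangentBundle.trivializationAt_apply]
    rfl
  rw [h2, h2, ← h1, tangentCoordChange_def (x := c), ModelWithCorners.range_eq_univ,
    fderivWithin_univ]
  rfl

lemma posCoord_hasDerivWithinAt {z : ℝ → TangentBundle (𝓡 n) M} {s : Set ℝ} {t : ℝ}
   (h : HasMFDerivWithinAt 𝓘(ℝ, ℝ) (𝓡 n) (fun τ => (z τ).proj) s t
    (ContinuousLinearMap.toSpanSingleton ℝ (z t).snd)) (c : M)
    (hc : (z t).proj ∈ (chartAt (Euc n) c).source) :
    HasDerivWithinAt (fun τ => posCoord c (z τ).proj) (velCoord c (z t)) s t := by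
  have h1 : HasMFDerivAt (𝓡 n) 𝓘(ℝ, Euc n) (extChartAt (𝓡 n) c) (z t).proj
     ((trivializationAt (Euc n) (TangentSpace (𝓡 n)) c).continuousLinearMapAt ℝ (z t).proj) := by
    rw [TangentBundle.continuousLinearMapAt_trivializationAt hc]
    exact (mdifferentiableAt_extChartAt hc).hasMFDerivAt
  have h2 : HasFDerivWithinAt (fun τ => posCoord c (z τ).proj)
      (ContinuousLinearMap.toSpanSingleton ℝ (velCoord c (z t))) s t := by
    have h3 := (h1.comp_hasMFDerivWithinAt t h).hasFDerivWithinAt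
    refine HasFDerivWithinAt.congr_fderiv (E := ℝ) (F := Euc n) h3 ?_
    refine ContinuousLinearMap.ext (M₁ := ℝ) (M₂ := Euc n) fun r => ?_
    have e1 : velCoord c (z t) =
        (trivializationAt (Euc n) (TangentSpace (𝓡 n)) c).continuousLinearMapAt ℝ
          (z t).proj (z t).snd := velCoord_eq c (z t).proj hc (z t).snd
    have e2 : ContinuousLinearMap.toSpanSingleton ℝ (velCoord c (z t)) r =
        r • (trivializationAt (Euc n) (TangentSpace (𝓡 n)) c).continuousLinearMapAt ℝ
          (z t).proj (z t).snd := by rw [← e1]; rfl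
    refine Eq.trans ?_ e2.symm
    have e3 : ∀ A : TangentSpace (𝓡 n) (z t).proj →L[ℝ] Euc n,
        A (r • (z t).snd) = r • A (z t).snd :=
      fun A => map_smul A r _
    exact e3 ((trivializationAt (Euc n) (TangentSpace (𝓡 n)) c).continuousLinearMapAt ℝ (z t).proj)
  simpa using h2.hasDerivWithinAt

/-- One chart suffices: in the chart centred at the base point, the components of a vector are the
vector itself. This recovers the velocity condition for limit curves. -/
lemma hasMFDerivWithinAt_of_posCoord {z : ℝ → TangentBundle (𝓡 n) M} {s : Set ℝ} {t : ℝ}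
    (hcont : ContinuousWithinAt (fun τ => (z τ).proj) s t)
    (h : HasDerivWithinAt (fun τ => posCoord (z t).proj (z τ).proj) (velCoord (z t).proj (z t))
      s t) :
    HasMFDerivWithinAt 𝓘(ℝ, ℝ) (𝓡 n) (fun τ => (z τ).proj) s t
    (ContinuousLinearMap.toSpanSingleton ℝ (z t).snd) := by
  refine ⟨hcont, ?_⟩
  have := h.hasFDerivWithinAt
  have h2 : velCoord (z t).proj (z t) = (z t).snd := by
    rw [velCoord, TangentBundle.trivializationAt_apply]
    exact tangentCoordChange_self (I := 𝓡 n) (by simp)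
  rw [h2] at this
  rw [writtenInExtChartAt, extChartAt_model_space_eq_id]
  have hs : (PartialEquiv.refl ℝ).symm ⁻¹' s ∩ range 𝓘(ℝ, ℝ) = s := by simp
  rw [hs]
  exact this

lemma continuous_bundleProj : Continuous (fun p : TangentBundle (𝓡 n) M => p.proj) :=
  FiberBundle.continuous_proj (Euc n) (TangentSpace (𝓡 n))

instance [T2Space M] : T2Space (TangentBundle (𝓡 n) M) := by
  refine ⟨fun p q hpq => ?_⟩
  by_cases h : p.proj = q.proj
  · have hp : p ∈ (bchart p.proj).source := by simp [bchart_source]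
    have hq : q ∈ (bchart p.proj).source := by simp [bchart_source, h]
    have hne : bchart p.proj p ≠ bchart p.proj q := fun h' => hpq ((bchart p.proj).injOn hp hq h')
    obtain ⟨u, v, hu, hv, hpu, hqv, huv⟩ := t2_separation hne
    refine ⟨_, _, (bchart p.proj).isOpen_inter_preimage hu,
      (bchart p.proj).isOpen_inter_preimage hv,
      ⟨hp, hpu⟩, ⟨hq, hqv⟩, ?_⟩
    exact (huv.preimage _).mono inter_subset_right inter_subset_right
  · obtain ⟨u, v, hu, hv, hpu, hqv, huv⟩ := t2_separation h
    exact ⟨_, _, hu.preimage continuous_bundleProj, hv.preimage continuous_bundleProj, hpu, hqv,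
      huv.preimage _⟩

instance [SecondCountableTopology M] : SecondCountableTopology (TangentBundle (𝓡 n) M) := by
  obtain ⟨s, hs, hcov⟩ := TopologicalSpace.isOpen_iUnion_countable
    (fun c : M => (chartAt (Euc n) c).source) (fun c => (chartAt (Euc n) c).open_source)
  have : SecondCountableTopology (ModelProd (Euc n) (Euc n)) :=
    inferInstanceAs (SecondCountableTopology (Euc n × Euc n))
  refine ChartedSpace.secondCountable_of_countable_cover (ModelProd (Euc n) (Euc n))
    (s := (fun c => (⟨c, 0⟩ : TangentBundle (𝓡 n) M)) '' s) ?_ (hs.image _)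
  rw [eq_univ_iff_forall]
  intro p
  have : p.proj ∈ ⋃ c : M, (chartAt (Euc n) c).source := mem_iUnion.2 ⟨p.proj, by simp⟩
  rw [← hcov] at this
  simpa using this

instance : LocallyCompactSpace (TangentBundle (𝓡 n) M) :=
  haveI : LocallyCompactSpace (ModelProd (Euc n) (Euc n)) :=
    inferInstanceAs (LocallyCompactSpace (Euc n × Euc n))
  ChartedSpace.locallyCompactSpace (ModelProd (Euc n) (Euc n)) _

instance [T2Space M] [SecondCountableTopology M] :
  TopologicalSpace.MetrizableSpace (TangentBundle (𝓡 n) M) := inferInstance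

end Charts

/-! ### The metric and the Christoffel symbols in a chart -/

section Metric

lemma frame_contMDiffOn (c : M) (a : Euc n) :
    ContMDiffOn 𝓘(ℝ, Euc n) (𝓡 n).tangent ∞
      (fun y => (⟨(extChartAt (𝓡 n) c).symm y,
        (trivializationAt (Euc n) (TangentSpace (𝓡 n)) c).symmL ℝ ((extChartAt (𝓡 n) c).symm y) a⟩ :
          TangentBundle (𝓡 n) M)) (extChartAt (𝓡 n) c).target := by
  have hmem : MapsTo (extChartAt (𝓡 n) c).symm (extChartAt (𝓡 n) c).target
      (chartAt (Euc n) c).source := by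
    intro y hy
    simpa using (extChartAt (𝓡 n) c).map_target hy
  refine (Trivialization.contMDiffOn_iff
    (e := trivializationAt (Euc n) (TangentSpace (𝓡 n) (M := M)) c) (IB := 𝓡 n) ?_).2 ⟨?_, ?_⟩
  · intro y hy
    exact hmem hy
  · exact contMDiffOn_extChartAt_symm c
  · refine (contMDiffOn_const (c := a)).congr fun y hy => ?_
    exact velCoord_symmL c _ (hmem hy) a

variable [RiemannianBundle (fun x : M => TangentSpace (𝓡 n) x)]

/-- The metric as a bilinear form on `ℝⁿ` in the chart around `c`. -/
def metricForm (c : M) (y : Euc n) : Euc n →L[ℝ] Euc n →L[ℝ] ℝ :=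
  ∑ i, ∑ j, gram c y i j •
    (EuclideanSpace.proj i : Euc n →L[ℝ] ℝ).smulRight (EuclideanSpace.proj j : Euc n →L[ℝ] ℝ)

/-- The Christoffel symbols as a bilinear map on `ℝⁿ`. -/
def christoffelMap (c : M) (y : Euc n) : Euc n →L[ℝ] Euc n →L[ℝ] Euc n :=
  ∑ k, ∑ i, ∑ j, christoffel c y k i j •
    (EuclideanSpace.proj i : Euc n →L[ℝ] ℝ).smulRight
      ((EuclideanSpace.proj j : Euc n →L[ℝ] ℝ).smulRight
        (EuclideanSpace.single k (1 : ℝ)))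

lemma metricForm_apply (c : M) (y a b : Euc n) :
    metricForm c y a b = ∑ i, ∑ j, gram c y i j * a i * b j := by
  simp [metricForm, sum_apply, mul_assoc]

lemma christoffelMap_apply (c : M) (y a b : Euc n) :
    christoffelMap c y a b = christoffelVec c y a b := by
  ext k
  simp [christoffelMap, christoffelVec, sum_apply, mul_assoc, Finset.sum_apply,
    Pi.single_apply]

lemma metricForm_eq_inner (c : M) (y a b : Euc n) :
    metricForm c y a b = inner ℝ
      ((trivializationAt (Euc n) (TangentSpace (𝓡 n)) c).symmL ℝ ((extChartAt (𝓡 n) c).symm y) a)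
      ((trivializationAt (Euc n) (TangentSpace (𝓡 n)) c).symmL ℝ ((extChartAt (𝓡 n) c).symm y) b)
      := by
  have h : ∀ a : Euc n, a = ∑ i, a i • EuclideanSpace.single i (1 : ℝ) := by
    intro a
    ext k
    simp [Finset.sum_apply, Pi.single_apply]
  conv_rhs => rw [h a, h b]
  rw [metricForm_apply]
  simp only [map_sum, map_smul, sum_inner]
  refine Finset.sum_congr rfl fun i _ => ?_
  rw [inner_sum]
  refine Finset.sum_congr rfl fun j _ => ?_
  rw [real_inner_smul_left, real_inner_smul_right]
  simp [gram, coordFrame]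
  ring

lemma gram_symm (c : M) (y : Euc n) (i j : Fin n) : gram c y i j = gram c y j i := by
  simp only [gram, Matrix.of_apply]
  exact real_inner_comm _ _

lemma metricForm_definite (c : M) {y : Euc n} (hy : y ∈ (extChartAt (𝓡 n) c).target) {a : Euc n}
    (ha : metricForm c y a a = 0) : a = 0 := by
  rw [metricForm_eq_inner, inner_self_eq_zero] at ha
  have hq : (extChartAt (𝓡 n) c).symm y ∈ (chartAt (Euc n) c).source := by
    simpa using (extChartAt (𝓡 n) c).map_target hy
  rw [← velCoord_symmL c _ hq a, ha, velCoord_eq c _ hq, map_zero]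

/-- A vector in the kernel of the Gram matrix would have length zero. -/
lemma gram_det_ne_zero (c : M) {y : Euc n} (hy : y ∈ (extChartAt (𝓡 n) c).target) :
    (gram c y).det ≠ 0 := by
  intro h
  obtain ⟨v, hv, hv'⟩ := Matrix.exists_mulVec_eq_zero_iff.2 h
  apply hv
  have : metricForm c y (WithLp.toLp 2 v) (WithLp.toLp 2 v) = 0 := by
    rw [metricForm_apply]
    refine Finset.sum_eq_zero fun i _ => ?_
    have h1 := congrFun hv' i
    simp only [Matrix.mulVec, dotProduct, Pi.zero_apply] at h1
    calc _ = v i * ∑ j, gram c y i j * v j := by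
          rw [Finset.mul_sum]; exact Finset.sum_congr rfl fun j _ => by ring
      _ = 0 := by rw [h1, mul_zero]
  have h2 := metricForm_definite c hy this
  ext i
  simpa using congrArg (fun w : Euc n => w i) h2

variable [IsContMDiffRiemannianBundle (𝓡 n) ∞ (Euc n) (fun x : M => TangentSpace (𝓡 n) x)]

lemma gram_contDiffOn (c : M) (i j : Fin n) :
    ContDiffOn ℝ ∞ (fun y => gram c y i j) (extChartAt (𝓡 n) c).target := by
  have h := ContMDiffOn.inner_bundle (IB := 𝓡 n) (F := Euc n)
    (E := fun x : M => TangentSpace (𝓡 n) x) (frame_contMDiffOn c (EuclideanSpace.single i 1))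
    (frame_contMDiffOn c (EuclideanSpace.single j 1))
  exact h.contDiffOn

lemma gramDeriv_contDiffOn (c : M) (k i j : Fin n) :
    ContDiffOn ℝ ∞ (fun y => gramDeriv c y k i j) (extChartAt (𝓡 n) c).target := by
  have h := (gram_contDiffOn c i j).fderiv_of_isOpen (isOpen_extChartAt_target c) (m := ∞) (by simp)
  exact h.clm_apply contDiffOn_const

lemma contDiffOn_det {A : Euc n → Matrix (Fin n) (Fin n) ℝ} {s : Set (Euc n)}
    (hA : ∀ i j, ContDiffOn ℝ ∞ (fun y => A y i j) s) :
    ContDiffOn ℝ ∞ (fun y => (A y).det) s := by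
  simp only [Matrix.det_apply]
  exact ContDiffOn.sum fun σ _ => (contDiffOn_prod fun i _ => hA _ _).const_smul _

/-- By Cramer's rule the entries are polynomials in the metric coefficients divided by a
nonvanishing determinant. -/
lemma gram_inv_contDiffOn (c : M) (i j : Fin n) :
    ContDiffOn ℝ ∞ (fun y => (gram c y)⁻¹ i j) (extChartAt (𝓡 n) c).target := by
  simp only [Matrix.inv_def, Ring.inverse_eq_inv', Matrix.smul_apply, smul_eq_mul,
    Matrix.adjugate_apply]
  refine ((contDiffOn_det (gram_contDiffOn c)).inv fun y hy => gram_det_ne_zero c hy).mul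
    (contDiffOn_det fun k l => ?_)
  by_cases hk : k = j
  · subst hk
    simpa using contDiffOn_const
  · simpa [Matrix.updateRow_ne hk] using gram_contDiffOn c k l

lemma christoffel_contDiffOn (c : M) (k i j : Fin n) :
    ContDiffOn ℝ ∞ (fun y => christoffel c y k i j) (extChartAt (𝓡 n) c).target := by
  unfold christoffel
  refine contDiffOn_const.mul (ContDiffOn.sum fun l _ => (gram_inv_contDiffOn c k l).mul ?_)
  exact ((gramDeriv_contDiffOn c i j l).add (gramDeriv_contDiffOn c j i l)).sub
    (gramDeriv_contDiffOn c l i j)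

lemma christoffelMap_contDiffOn (c : M) :
    ContDiffOn ℝ ∞ (christoffelMap c) (extChartAt (𝓡 n) c).target := by
  unfold christoffelMap
  exact ContDiffOn.sum fun k _ => ContDiffOn.sum fun i _ => ContDiffOn.sum fun j _ =>
    (christoffel_contDiffOn c k i j).smul contDiffOn_const

lemma metricForm_contDiffOn (c : M) :
    ContDiffOn ℝ ∞ (metricForm c) (extChartAt (𝓡 n) c).target := by
  unfold metricForm
  exact ContDiffOn.sum fun i _ => ContDiffOn.sum fun j _ =>
    (gram_contDiffOn c i j).smul contDiffOn_const

lemma fderiv_metricForm_apply (c : M) {y : Euc n} (hy : y ∈ (extChartAt (𝓡 n) c).target)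
    (a b d : Euc n) :
    fderiv ℝ (metricForm c) y a b d = ∑ k, ∑ i, ∑ j, gramDeriv c y k i j * a k * b i * d j := by
  have hd : ∀ i j, DifferentiableAt ℝ (fun y => gram c y i j) y := fun i j =>
    ((gram_contDiffOn c i j).contDiffAt ((isOpen_extChartAt_target c).mem_nhds hy)).differentiableAt
      (by simp)
  have h1 : HasFDerivAt (metricForm c) (∑ i, ∑ j, (fderiv ℝ (fun y => gram c y i j) y).smulRight
    ((EuclideanSpace.proj i : Euc n →L[ℝ] ℝ).smulRight
      (EuclideanSpace.proj j : Euc n →L[ℝ] ℝ))) y := by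
    unfold metricForm
    exact HasFDerivAt.fun_sum fun i _ => HasFDerivAt.fun_sum fun j _ =>
      (hd i j).hasFDerivAt.smul_const _
  have h2 : ∀ i j, fderiv ℝ (fun y => gram c y i j) y a = ∑ k, gramDeriv c y k i j * a k := by
    intro i j
    have : a = ∑ i, a i • EuclideanSpace.single i (1 : ℝ) := by
      ext k
      simp [Finset.sum_apply, Pi.single_apply]
    conv_lhs => rw [this]
    simp only [map_sum, map_smul, smul_eq_mul, gramDeriv]
    exact Finset.sum_congr rfl fun k _ => mul_comm _ _
  rw [h1.fderiv]
  simp only [sum_apply, ContinuousLinearMap.smulRight_apply, h2,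
    smul_apply, smul_eq_mul, PiLp.proj_apply, Finset.sum_mul]
  calc _ = ∑ i, ∑ k, ∑ j, gramDeriv c y k i j * a k * b i * d j := by
        refine Finset.sum_congr rfl fun i _ => ?_
        rw [Finset.sum_comm]
        refine Finset.sum_congr rfl fun k _ => Finset.sum_congr rfl fun j _ => by ring
    _ = _ := Finset.sum_comm

/-- The first-kind Christoffel identity in a chart. -/
lemma metricForm_christoffelMap (c : M) {y : Euc n} (hy : y ∈ (extChartAt (𝓡 n) c).target)
    (a b d : Euc n) :
    metricForm c y (christoffelMap c y a b) d = (1 / 2) * (fderiv ℝ (metricForm c) y a b d +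
      fderiv ℝ (metricForm c) y b a d - fderiv ℝ (metricForm c) y d a b) := by
  -- Lowering the upper index of Γ cancels the inverse metric in its definition; the remaining steps
  -- only reorder finite sums.
  have key : ∀ i j l, ∑ k, gram c y k l * christoffel c y k i j =
      (1 / 2) * (gramDeriv c y i j l + gramDeriv c y j i l - gramDeriv c y l i j) := by
    intro i j l
    set X : Fin n → ℝ := fun l => gramDeriv c y i j l + gramDeriv c y j i l - gramDeriv c y l i j
      with hX
    have h1 : (gram c y).mulVec ((gram c y)⁻¹.mulVec X) = X := by
      rw [Matrix.mulVec_mulVec, Matrix.mul_nonsing_inv _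
        (isUnit_iff_ne_zero.2 (gram_det_ne_zero c hy)), Matrix.one_mulVec]
    have h2 := congrFun h1 l
    rw [show (1 / 2) * (gramDeriv c y i j l + gramDeriv c y j i l - gramDeriv c y l i j) =
      (1 / 2) * X l from rfl, ← h2, Matrix.mulVec, dotProduct, Finset.mul_sum]
    refine Finset.sum_congr rfl fun k _ => ?_
    rw [gram_symm c y k l, christoffel, Matrix.mulVec, dotProduct]
    ring
  rw [metricForm_apply, fderiv_metricForm_apply c hy, fderiv_metricForm_apply c hy,
    fderiv_metricForm_apply c hy]
  have e1 : ∀ k, christoffelMap c y a b k = ∑ i, ∑ j, christoffel c y k i j * a i * b j := by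
    intro k; rw [christoffelMap_apply]; rfl
  have l1 : ∑ k, ∑ l, gram c y k l * christoffelMap c y a b k * d l =
      ∑ i, ∑ j, ∑ l, (∑ k, gram c y k l * christoffel c y k i j) * a i * b j * d l := by
    simp only [e1, Finset.mul_sum, Finset.sum_mul]
    calc _ = ∑ l, ∑ k, ∑ i, ∑ j, gram c y k l * (christoffel c y k i j * a i * b j) * d l :=
          Finset.sum_comm
      _ = ∑ l, ∑ i, ∑ k, ∑ j, gram c y k l * (christoffel c y k i j * a i * b j) * d l :=
          Finset.sum_congr rfl fun l _ => Finset.sum_comm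
      _ = ∑ i, ∑ l, ∑ k, ∑ j, gram c y k l * (christoffel c y k i j * a i * b j) * d l :=
          Finset.sum_comm
      _ = ∑ i, ∑ l, ∑ j, ∑ k, gram c y k l * (christoffel c y k i j * a i * b j) * d l :=
          Finset.sum_congr rfl fun l _ => Finset.sum_congr rfl fun l _ => Finset.sum_comm
      _ = ∑ i, ∑ j, ∑ l, ∑ k, gram c y k l * (christoffel c y k i j * a i * b j) * d l :=
          Finset.sum_congr rfl fun l _ => Finset.sum_comm
      _ = _ := by
          refine Finset.sum_congr rfl fun i _ => Finset.sum_congr rfl fun j _ =>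
            Finset.sum_congr rfl fun l _ => Finset.sum_congr rfl fun k _ => by ring
  have r2 : ∑ k, ∑ i, ∑ j, gramDeriv c y k i j * b k * a i * d j =
      ∑ i, ∑ j, ∑ l, gramDeriv c y j i l * a i * b j * d l := by
    rw [Finset.sum_comm]
    refine Finset.sum_congr rfl fun i _ => Finset.sum_congr rfl fun j _ =>
            Finset.sum_congr rfl fun l _ => by ring
  have r3 : ∑ k, ∑ i, ∑ j, gramDeriv c y k i j * d k * a i * b j =
      ∑ i, ∑ j, ∑ l, gramDeriv c y l i j * a i * b j * d l := by
    rw [Finset.sum_comm]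
    refine Finset.sum_congr rfl fun i _ => ?_
    rw [Finset.sum_comm]
    refine Finset.sum_congr rfl fun j _ => Finset.sum_congr rfl fun l _ => by ring
  rw [l1, r2, r3]
  simp only [key, ← Finset.sum_add_distrib, ← Finset.sum_sub_distrib, Finset.mul_sum]
  refine Finset.sum_congr rfl fun i _ => Finset.sum_congr rfl fun j _ =>
            Finset.sum_congr rfl fun l _ => by ring

end Metric

/-! ### Change of charts: metric, Christoffel symbols, parallel equation -/

section ChartChange

lemma extChartAt_symm_mem_source {c : M} {y : Euc n} (hy : y ∈ (extChartAt (𝓡 n) c).target) :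
    (extChartAt (𝓡 n) c).symm y ∈ (chartAt (Euc n) c).source := by
  simpa using (extChartAt (𝓡 n) c).map_target hy

variable (n) in
/-- The transition map from the chart around `c` to the chart around `c'`. -/
def transition (c c' : M) : Euc n → Euc n := posCoord c' ∘ (extChartAt (𝓡 n) c).symm

variable (n) in
/-- The domain of the transition map from the chart around `c` to the chart around `c'`. -/
def transitionSource (c c' : M) : Set (Euc n) :=
  (extChartAt (𝓡 n) c).target ∩ (extChartAt (𝓡 n) c).symm ⁻¹' (chartAt (Euc n) c').source

lemma isOpen_transitionSource (c c' : M) : IsOpen (transitionSource n c c') :=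
  (continuousOn_extChartAt_symm c).isOpen_inter_preimage (isOpen_extChartAt_target c)
    (chartAt (Euc n) c').open_source

lemma posCoord_mem_transitionSource {c c' q : M} (hq : q ∈ (chartAt (Euc n) c).source)
    (hq' : q ∈ (chartAt (Euc n) c').source) : posCoord c q ∈ transitionSource n c c' := by
  refine ⟨(extChartAt (𝓡 n) c).map_source (by simpa using hq), ?_⟩
  have : (extChartAt (𝓡 n) c).symm (posCoord c q) = q :=
    (extChartAt (𝓡 n) c).left_inv (by simpa using hq)
  simpa only [mem_preimage, this] using hq'

lemma transition_contDiffOn (c c' : M) :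
    ContDiffOn ℝ ∞ (transition n c c') (transitionSource n c c') := by
  have h : ContMDiffOn 𝓘(ℝ, Euc n) 𝓘(ℝ, Euc n) ∞ (extChartAt (𝓡 n) c' ∘ (extChartAt (𝓡 n) c).symm)
      (transitionSource n c c') :=
    (contMDiffOn_extChartAt (I := 𝓡 n) (n := ∞) (x := c')).comp
      ((contMDiffOn_extChartAt_symm (I := 𝓡 n) (n := ∞) c).mono inter_subset_left)
      (fun y hy => hy.2)
  exact h.contDiffOn

lemma velCoord_transition {c c' q : M} (hq : q ∈ (chartAt (Euc n) c).source)
    (hq' : q ∈ (chartAt (Euc n) c').source) (w : TangentSpace (𝓡 n) q) :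
    velCoord c' (⟨q, w⟩ : TangentBundle (𝓡 n) M) =
      fderiv ℝ (transition n c c') (posCoord c q) (velCoord c (⟨q, w⟩ : TangentBundle (𝓡 n) M)) :=
  velCoord_change c c' q hq hq' w

lemma transition_posCoord {c c' q : M} (hq : q ∈ (chartAt (Euc n) c).source) :
    transition n c c' (posCoord c q) = posCoord c' q := by
  have : (extChartAt (𝓡 n) c).symm (posCoord c q) = q :=
    (extChartAt (𝓡 n) c).left_inv (by simpa using hq)
  rw [transition, Function.comp_apply, this]

variable [RiemannianBundle (fun x : M => TangentSpace (𝓡 n) x)]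

lemma metricForm_velCoord {c q : M} (hq : q ∈ (chartAt (Euc n) c).source)
    (v w : TangentSpace (𝓡 n) q) :
    metricForm c (posCoord c q) (velCoord c (⟨q, v⟩ : TangentBundle (𝓡 n) M))
      (velCoord c (⟨q, w⟩ : TangentBundle (𝓡 n) M)) = inner ℝ v w := by
  have : (extChartAt (𝓡 n) c).symm (posCoord c q) = q :=
    (extChartAt (𝓡 n) c).left_inv (by simpa using hq)
  rw [metricForm_eq_inner, this, symmL_velCoord c q hq, symmL_velCoord c q hq]

/-- Both sides are the inner product of the same two tangent vectors. The identity holds on an open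
set, so it can be differentiated in the proof of `christoffelMap_transition`. -/
lemma metricForm_transition {c c' : M} {y : Euc n} (hy : y ∈ transitionSource n c c')
    (a b : Euc n) :
    metricForm c' (transition n c c' y) (fderiv ℝ (transition n c c') y a)
      (fderiv ℝ (transition n c c') y b) = metricForm c y a b := by
  obtain ⟨hy1, hy2⟩ := hy
  set q := (extChartAt (𝓡 n) c).symm y with hqdef
  have hq : q ∈ (chartAt (Euc n) c).source := extChartAt_symm_mem_source hy1
  have hyq : posCoord c q = y := (extChartAt (𝓡 n) c).right_inv hy1
  have hv : ∀ a : Euc n, ∃ v : TangentSpace (𝓡 n) q,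
      velCoord c (⟨q, v⟩ : TangentBundle (𝓡 n) M) = a := fun a => ⟨_, velCoord_symmL c q hq a⟩
  obtain ⟨v, rfl⟩ := hv a
  obtain ⟨w, rfl⟩ := hv b
  rw [← hyq, ← velCoord_transition hq hy2, ← velCoord_transition hq hy2, transition_posCoord hq,
    metricForm_velCoord hq, metricForm_velCoord hy2]

variable [IsContMDiffRiemannianBundle (𝓡 n) ∞ (Euc n) (fun x : M => TangentSpace (𝓡 n) x)]

/-- The transformation law of the Christoffel symbols. -/
lemma christoffelMap_transition {c c' : M} {y : Euc n} (hy : y ∈ transitionSource n c c')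
    (a b : Euc n) :
    fderiv ℝ (transition n c c') y (christoffelMap c y a b) =
      christoffelMap c' (transition n c c' y) (fderiv ℝ (transition n c c') y a)
        (fderiv ℝ (transition n c c') y b) +
      fderiv ℝ (fderiv ℝ (transition n c c')) y a b := by
  set φ := transition n c c' with hφ
  set q := (extChartAt (𝓡 n) c).symm y with hqdef
  have hopen := isOpen_transitionSource (n := n) c c'
  have hq : q ∈ (chartAt (Euc n) c).source := extChartAt_symm_mem_source hy.1
  have hyq : posCoord c q = y := (extChartAt (𝓡 n) c).right_inv hy.1
  have hφy : φ y ∈ (extChartAt (𝓡 n) c').target := by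
    rw [← hyq, hφ, transition_posCoord hq]
    exact (extChartAt (𝓡 n) c').map_source (by rw [extChartAt_source]; exact hy.2)
  have hsurj : ∀ X : Euc n, ∃ d, fderiv ℝ φ y d = X := by
    intro X
    refine ⟨velCoord c (⟨q, (trivializationAt (Euc n) (TangentSpace (𝓡 n)) c').symmL ℝ q X⟩ :
      TangentBundle (𝓡 n) M), ?_⟩
    rw [← hyq, ← velCoord_transition hq hy.2, velCoord_symmL c' q hy.2]
  have hφ2 : ContDiffAt ℝ ∞ φ y := (transition_contDiffOn c c').contDiffAt (hopen.mem_nhds hy)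
  have hφd : HasFDerivAt φ (fderiv ℝ φ y) y := (hφ2.differentiableAt (by simp)).hasFDerivAt
  have hDφ : HasFDerivAt (fderiv ℝ φ) (fderiv ℝ (fderiv ℝ φ) y) y :=
    ((hφ2.fderiv_right (m := 1) (by norm_cast)).differentiableAt (by simp)).hasFDerivAt
  have hH : HasFDerivAt (metricForm c') (fderiv ℝ (metricForm c') (φ y)) (φ y) :=
    (((metricForm_contDiffOn c').contDiffAt
      ((isOpen_extChartAt_target c').mem_nhds hφy)).differentiableAt (by simp)).hasFDerivAt
  have hG : HasFDerivAt (metricForm c) (fderiv ℝ (metricForm c) y) y :=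
    (((metricForm_contDiffOn c).contDiffAt
      ((isOpen_extChartAt_target c).mem_nhds hy.1)).differentiableAt (by simp)).hasFDerivAt
  have hsymm : ∀ u v, fderiv ℝ (fderiv ℝ φ) y u v = fderiv ℝ (fderiv ℝ φ) y v u := by
    intro u v
    exact ((hφ2.of_le (m := 2) (by norm_cast)).isSymmSndFDerivAt (by simp)) u v
  have hHsymm : ∀ u v, metricForm c' (φ y) u v = metricForm c' (φ y) v u := by
    intro u v
    rw [metricForm_eq_inner, metricForm_eq_inner, real_inner_comm]
  -- Derivative of the pullback identity `metricForm_transition` by the product rule, with `v` and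
  -- `w` held constant.
  have hD : ∀ u v w, fderiv ℝ (metricForm c) y u v w =
      fderiv ℝ (metricForm c') (φ y) (fderiv ℝ φ y u) (fderiv ℝ φ y v) (fderiv ℝ φ y w) +
      metricForm c' (φ y) (fderiv ℝ (fderiv ℝ φ) y u v) (fderiv ℝ φ y w) +
      metricForm c' (φ y) (fderiv ℝ φ y v) (fderiv ℝ (fderiv ℝ φ) y u w) := by
    intro u v w
    have h1 := ((hH.comp y hφd).clm_apply (hDφ.clm_apply (hasFDerivAt_const v y))).clm_apply
      (hDφ.clm_apply (hasFDerivAt_const w y))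
    have h2 := (hG.clm_apply (hasFDerivAt_const v y)).clm_apply (hasFDerivAt_const w y)
    have h3 := h2.congr_of_eventuallyEq (f₁ := fun y => metricForm c' (φ y) (fderiv ℝ φ y v)
      (fderiv ℝ φ y w)) (by
        filter_upwards [hopen.mem_nhds hy] with y' hy'
        exact metricForm_transition hy' v w)
    have h4 := congrArg (fun A : Euc n →L[ℝ] ℝ => A u) (h3.unique h1)
    simp at h4
    rw [h4]
    ring
  -- In the combination of derivatives that defines Γ, symmetry of D²φ and of the metric cancels
  -- every second-order term except twice the pairing of D²φ(a, b) with Dφ(d).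
  have key : ∀ d, metricForm c' (φ y) (fderiv ℝ φ y (christoffelMap c y a b) -
      (christoffelMap c' (φ y) (fderiv ℝ φ y a) (fderiv ℝ φ y b) +
        fderiv ℝ (fderiv ℝ φ) y a b)) (fderiv ℝ φ y d) = 0 := by
    intro d
    rw [map_sub, map_add, sub_apply, add_apply, metricForm_transition hy,
      metricForm_christoffelMap c hy.1, metricForm_christoffelMap c' hφy, hD, hD, hD,
      hsymm b a, hsymm d a, hsymm d b, hHsymm (fderiv ℝ φ y a) (fderiv ℝ (fderiv ℝ φ) y b d),
      hHsymm (fderiv ℝ φ y b) (fderiv ℝ (fderiv ℝ φ) y a d)]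
    ring
  -- Choosing `d` with Dφ(d) equal to the defect itself shows that the defect has length zero.
  obtain ⟨d, hd⟩ := hsurj (fderiv ℝ φ y (christoffelMap c y a b) -
      (christoffelMap c' (φ y) (fderiv ℝ φ y a) (fderiv ℝ φ y b) +
        fderiv ℝ (fderiv ℝ φ) y a b))
  have h0 := key d
  rw [hd] at h0
  exact sub_eq_zero.1 (metricForm_definite c' hφy h0)

/-- The equation of parallel transport does not depend on the chart. -/
lemma parallelEquation_chart_change {z Y : ℝ → TangentBundle (𝓡 n) M} {s : Set ℝ} {t : ℝ}
    (hts : t ∈ s)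
    (hz : HasMFDerivWithinAt 𝓘(ℝ, ℝ) (𝓡 n) (fun τ => (z τ).proj) s t
      (ContinuousLinearMap.toSpanSingleton ℝ (z t).snd))
    (hY : ∀ τ ∈ s, (Y τ).proj = (z τ).proj) {c c' : M}
    (hc : (z t).proj ∈ (chartAt (Euc n) c).source)
    (hc' : (z t).proj ∈ (chartAt (Euc n) c').source)
    (h : HasDerivWithinAt (fun τ => velCoord c (Y τ))
        (-christoffelVec c (posCoord c (z t).proj) (velCoord c (z t)) (velCoord c (Y t))) s t) :
    HasDerivWithinAt (fun τ => velCoord c' (Y τ))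
        (-christoffelVec c' (posCoord c' (z t).proj) (velCoord c' (z t)) (velCoord c' (Y t)))
        s t := by
  set φ := transition n c c' with hφ
  have hmem := posCoord_mem_transitionSource hc hc'
  have hφ2 : ContDiffAt ℝ ∞ φ (posCoord c (z t).proj) :=
    (transition_contDiffOn c c').contDiffAt ((isOpen_transitionSource c c').mem_nhds hmem)
  have hDφ : HasFDerivAt (fderiv ℝ φ) (fderiv ℝ (fderiv ℝ φ) (posCoord c (z t).proj))
      (posCoord c (z t).proj) :=
    ((hφ2.fderiv_right (m := 1) (by norm_cast)).differentiableAt (by simp)).hasFDerivAt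
  have hx := posCoord_hasDerivWithinAt hz c hc
  have h1 := (hDφ.comp_hasDerivWithinAt t hx).clm_apply h
  have hev : ∀ᶠ τ in 𝓝[s] t, velCoord c' (Y τ) =
      fderiv ℝ φ (posCoord c (z τ).proj) (velCoord c (Y τ)) := by
    have e1 := hz.continuousWithinAt.preimage_mem_nhdsWithin
      ((chartAt (Euc n) c).open_source.mem_nhds hc)
    have e2 := hz.continuousWithinAt.preimage_mem_nhdsWithin
      ((chartAt (Euc n) c').open_source.mem_nhds hc')
    filter_upwards [e1, e2, self_mem_nhdsWithin] with τ h1 h2 h3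
    simp only [mem_preimage] at h1 h2
    rw [← hY τ h3] at h1 h2 ⊢
    exact velCoord_transition h1 h2 (Y τ).snd
  have h2 := h1.congr_of_eventuallyEq hev (hev.self_of_nhdsWithin hts)
  refine h2.congr_deriv ?_
  have eY : velCoord c' (Y t) = fderiv ℝ φ (posCoord c (z t).proj) (velCoord c (Y t)) :=
    hev.self_of_nhdsWithin hts
  have ez : velCoord c' (z t) = fderiv ℝ φ (posCoord c (z t).proj) (velCoord c (z t)) :=
    velCoord_transition hc hc' (z t).snd
  -- The product rule applied to Dφ(x(t))·Y(t) gives an extra term D²φ(ẋ, Y), which is exactly the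
  -- inhomogeneous term in the transformation law of Γ.
  rw [eY, ez, ← christoffelMap_apply, ← christoffelMap_apply, Function.comp_apply, map_neg,
    christoffelMap_transition hmem, ← transition_posCoord (c' := c') hc]
  abel

end ChartChange

/-! ### Induction on intervals and linear differential equations -/

section Interval

/-- Induction along a compact interval. -/
lemma Icc_induction {a b : ℝ} (P : ℝ → Prop) (h0 : P a)
    (hloc : ∀ t ∈ Icc a b, ∃ δ > 0, ∀ s ∈ Icc a b, ∀ s' ∈ Icc a b, |s - t| < δ → |s' - t| < δ →
      s ≤ s' → P s → P s') :
    ∀ t ∈ Icc a b, P t := by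
  intro t ht
  have hab : a ≤ b := ht.1.trans ht.2
  choose δ hδ hP using fun t : Icc a b => hloc t t.2
  -- A monotone, eventually constant subdivision, each of whose cells lies in one of the local
  -- neighbourhoods.
  obtain ⟨u, hu0, hum, ⟨N, hN⟩, hu⟩ := exists_monotone_Icc_subset_open_cover_Icc (a := a) (b := b)
    hab (c := fun t : Icc a b => {s | |(s : ℝ) - t| < δ t})
    (fun t => isOpen_lt (by fun_prop) continuous_const)
    (fun s _ => mem_iUnion.2 ⟨s, by simpa using hδ s⟩)
  have hstep : ∀ k, P (u k) → ∀ s ∈ Icc (u k) (u (k + 1)), P s := by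
    intro k hk s hs
    obtain ⟨i, hi⟩ := hu k
    exact hP i _ (u k).2 s s.2 (hi ⟨le_rfl, hum (Nat.le_succ k)⟩) (hi hs) hs.1 hk
  have hall : ∀ k, P (u k) := by
    intro k
    induction k with
    | zero => rw [hu0]; exact h0
    | succ k ih => exact hstep k ih _ ⟨hum (Nat.le_succ k), le_rfl⟩
  have hcov : ∀ k, t ≤ u k → P t := by
    intro k
    induction k with
    | zero =>
      intro h
      rw [hu0] at h
      rwa [le_antisymm h ht.1]
    | succ k ih =>
      intro h
      rcases le_total t (u k) with h' | h'
      · exact ih h'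
      · exact hstep k (hall k) ⟨t, ht⟩ ⟨h', h⟩
  refine hcov N ?_
  rw [hN N le_rfl]
  exact ht.2

variable {E : Type*} [NormedAddCommGroup E] [NormedSpace ℝ E]

lemma hasDerivWithinAt_Icc_glue {f : ℝ → E} {d : E} {a s b t : ℝ} (has : a ≤ s) (hsb : s ≤ b)
    (h1 : t ∈ Icc a s → HasDerivWithinAt f d (Icc a s) t)
    (h2 : t ∈ Icc s b → HasDerivWithinAt f d (Icc s b) t) :
    HasDerivWithinAt f d (Icc a b) t := by
  rw [← Icc_union_Icc_eq_Icc has hsb]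
  refine HasDerivWithinAt.union ?_ ?_
  · by_cases h : t ∈ Icc a s
    · exact h1 h
    · exact HasFDerivWithinAt.of_notMem_closure (by rwa [isClosed_Icc.closure_eq])
  · by_cases h : t ∈ Icc s b
    · exact h2 h
    · exact HasFDerivWithinAt.of_notMem_closure (by rwa [isClosed_Icc.closure_eq])

/-- Linear ordinary differential equations have solutions on short intervals of uniform length. -/
lemma exists_linear_ode_solution [CompleteSpace E] {B : ℝ → E →L[ℝ] E} {a b C : ℝ} (hab : a ≤ b)
    (hB : ContinuousOn B (Icc a b)) (hC0 : 0 ≤ C) (hC : ∀ t ∈ Icc a b, ‖B t‖ ≤ C)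
    (hab' : 2 * C * (b - a) ≤ 1) (y₀ : E) :
    ∃ y : ℝ → E, y a = y₀ ∧ ∀ t ∈ Icc a b, HasDerivWithinAt y (B t (y t)) (Icc a b) t := by
  -- On the ball of radius ‖y₀‖ around y₀ the field is at most 2C‖y₀‖, so a solution cannot leave it
  -- in time b - a if 2C(b - a) ≤ 1. By linearity this time does not depend on y₀.
  have hpl : IsPicardLindelof (fun t => B t) (⟨a, left_mem_Icc.2 hab⟩ : Icc a b) y₀ ‖y₀‖₊ 0
      (C.toNNReal * (2 * ‖y₀‖₊)) C.toNNReal := by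
    constructor
    · intro t ht
      exact ((B t).lipschitz.weaken (by
        rw [← NNReal.coe_le_coe, Real.coe_toNNReal C hC0]
        exact hC t ht)).lipschitzOnWith
    · intro x _
      exact hB.clm_apply continuousOn_const
    · intro t ht x hx
      have hx' : ‖x‖ ≤ 2 * ‖y₀‖ := by
        have := norm_le_norm_add_norm_sub' x y₀
        rw [mem_closedBall_iff_norm] at hx
        have h3 : (‖y₀‖₊ : ℝ) = ‖y₀‖ := rfl
        linarith
      calc ‖B t x‖ ≤ ‖B t‖ * ‖x‖ := (B t).le_opNorm x
        _ ≤ C * (2 * ‖y₀‖) := by gcongr; exact hC t ht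
        _ = _ := by simp [hC0]
    · simp only [NNReal.coe_mul, Real.coe_toNNReal C hC0, sub_self, NNReal.coe_zero, sub_zero,
        coe_nnnorm,
        NNReal.coe_ofNat]
      rw [max_eq_left (by linarith)]
      nlinarith [norm_nonneg y₀]
  obtain ⟨y, hy0, hy⟩ := hpl.exists_eq_forall_mem_Icc_hasDerivWithinAt₀
  exact ⟨y, hy0, hy⟩

end Interval

/-! ### Existence of parallel transport -/

section ParallelExistence

lemma velCoord_continuousAt {c : M} {p : TangentBundle (𝓡 n) M}
    (hp : p.proj ∈ (chartAt (Euc n) c).source) : ContinuousAt (velCoord c) p := by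
  have h1 : p ∈ (bchart (n := n) c).source := by rw [bchart_source]; exact hp
  have h2 := ((bchart c).continuousAt h1).snd
  exact h2

lemma posCoord_continuousAt {c q : M} (hq : q ∈ (chartAt (Euc n) c).source) :
    ContinuousAt (posCoord (n := n) c) q :=
  continuousAt_extChartAt' (by simpa using hq)

/-- Continuity of a curve in `TM` in terms of its base curve and its components. -/
lemma continuousWithinAt_of_velCoord {z : ℝ → TangentBundle (𝓡 n) M} {s : Set ℝ} {t : ℝ} {c : M}
    (hc : (z t).proj ∈ (chartAt (Euc n) c).source)
    (h1 : ContinuousWithinAt (fun τ => (z τ).proj) s t)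
    (h2 : ContinuousWithinAt (fun τ => velCoord c (z τ)) s t) : ContinuousWithinAt z s t := by
  have hm : z t ∈ (bchart (n := n) c).source := by rw [bchart_source]; exact hc
  have h3 : ContinuousWithinAt (fun τ => bchart c (z τ)) s t :=
    (ContinuousAt.comp_continuousWithinAt (g := posCoord c) (f := fun τ => (z τ).proj)
      (posCoord_continuousAt hc) h1).prodMk h2
  have h4 : ContinuousWithinAt (fun τ => (bchart c).symm (bchart c (z τ))) s t :=
    ContinuousAt.comp_continuousWithinAt (g := (bchart c).symm) (f := fun τ => bchart c (z τ))
      ((bchart c).continuousAt_symm ((bchart c).map_source hm)) h3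
  refine h4.congr_of_eventuallyEq ?_ ((bchart c).left_inv hm).symm
  filter_upwards [h1.preimage_mem_nhdsWithin ((chartAt (Euc n) c).open_source.mem_nhds hc)]
    with τ hτ
  exact ((bchart c).left_inv (by rw [bchart_source]; exact hτ)).symm

variable [RiemannianBundle (fun x : M => TangentSpace (𝓡 n) x)]

lemma IsParallelOn.continuousOn {z Y : ℝ → TangentBundle (𝓡 n) M} {s : Set ℝ}
    (hz : HasVelocityOn z s) (hY : IsParallelOn z Y s) : ContinuousOn Y s := by
  intro t ht
  obtain ⟨h1, h2⟩ := hY t ht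
  have hc : (z t).proj ∈ (chartAt (Euc n) (z t).proj).source := mem_chart_source _ _
  refine continuousWithinAt_of_velCoord (c := (z t).proj) (h1 ▸ hc) ?_
    (h2 _ hc).continuousWithinAt
  refine ((hz t ht).continuousWithinAt).congr_of_eventuallyEq ?_ h1
  filter_upwards [self_mem_nhdsWithin] with τ hτ using (hY τ hτ).1

lemma IsGeodesic.continuousOn {z : ℝ → TangentBundle (𝓡 n) M} (hz : IsGeodesic z) :
    ContinuousOn z (Icc 0 1) := IsParallelOn.continuousOn hz.1 hz.2

variable [IsContMDiffRiemannianBundle (𝓡 n) ∞ (Euc n) (fun x : M => TangentSpace (𝓡 n) x)]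

lemma christoffelMap_continuousAt {c q : M} (hq : q ∈ (chartAt (Euc n) c).source) :
    ContinuousAt (christoffelMap (n := n) c) (posCoord c q) :=
  (christoffelMap_contDiffOn c).continuousOn.continuousAt
    ((isOpen_extChartAt_target c).mem_nhds
      ((extChartAt (𝓡 n) c).map_source (by rw [extChartAt_source]; exact hq)))

/-- The coefficients of the parallel transport equation are continuous. -/
lemma parallelCoeff_continuousWithinAt {z : ℝ → TangentBundle (𝓡 n) M} {s : Set ℝ} {t : ℝ}
    (hz : ContinuousWithinAt z s t) {c : M} (hc : (z t).proj ∈ (chartAt (Euc n) c).source) :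
    ContinuousWithinAt
      (fun τ => -christoffelMap c (posCoord c (z τ).proj) (velCoord c (z τ))) s t := by
  have h1 : ContinuousWithinAt (fun τ => (z τ).proj) s t :=
    continuous_bundleProj.continuousAt.comp_continuousWithinAt hz
  have h2 : ContinuousWithinAt (fun τ => velCoord c (z τ)) s t :=
    (velCoord_continuousAt hc).comp_continuousWithinAt hz
  have h3 : ContinuousWithinAt (fun τ => christoffelMap c (posCoord c (z τ).proj)) s t :=
    ContinuousAt.comp_continuousWithinAt (g := christoffelMap c) (christoffelMap_continuousAt hc)
      (ContinuousAt.comp_continuousWithinAt (g := posCoord c) (posCoord_continuousAt hc) h1)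
  exact (h3.clm_apply h2).neg

/-- The linear equation is solved in the single chart around `c`, and
`parallelEquation_chart_change` carries the solution to all other charts. The admissible length
depends on the coefficients only, so the step can be restarted from any vector. -/
lemma exists_parallel_local {z : ℝ → TangentBundle (𝓡 n) M} {a b C : ℝ} (hab : a ≤ b)
    (hz : HasVelocityOn z (Icc a b)) (hzc : ContinuousOn z (Icc a b)) {c : M}
    (hc : ∀ t ∈ Icc a b, (z t).proj ∈ (chartAt (Euc n) c).source) (hC0 : 0 ≤ C)
    (hC : ∀ t ∈ Icc a b, ‖-christoffelMap c (posCoord c (z t).proj) (velCoord c (z t))‖ ≤ C)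
    (hab' : 2 * C * (b - a) ≤ 1) (Y₀ : TangentBundle (𝓡 n) M) (hY₀ : Y₀.proj = (z a).proj) :
    ∃ Y, Y a = Y₀ ∧ IsParallelOn z Y (Icc a b) := by
  obtain ⟨y, hy0, hy⟩ := exists_linear_ode_solution hab
    (fun t ht => parallelCoeff_continuousWithinAt (hzc t ht) (hc t ht)) hC0 hC hab' (velCoord c Y₀)
  have ha : a ∈ Icc a b := left_mem_Icc.2 hab
  have hv : ∀ t ∈ Icc a b, velCoord c (⟨(z t).proj, (trivializationAt (Euc n)
      (TangentSpace (𝓡 n)) c).symmL ℝ (z t).proj (y t)⟩ : TangentBundle (𝓡 n) M) = y t :=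
    fun t ht => velCoord_symmL c _ (hc t ht) _
  refine ⟨fun t => ⟨(z t).proj, (trivializationAt (Euc n) (TangentSpace (𝓡 n)) c).symmL ℝ
    (z t).proj (y t)⟩, ?_, fun t ht => ⟨rfl, fun c' hc' => ?_⟩⟩
  · have h1 := hc a ha
    obtain ⟨q, w⟩ := Y₀
    simp only at hY₀
    subst hY₀
    simp only [hy0]
    rw [symmL_velCoord c _ h1]
  · refine parallelEquation_chart_change (Y := fun t => ⟨(z t).proj, (trivializationAt (Euc n)
      (TangentSpace (𝓡 n)) c).symmL ℝ (z t).proj (y t)⟩) ht (hz t ht) (fun _ _ => rfl) (hc t ht) hc' ?_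
    rw [hv t ht, ← christoffelMap_apply]
    refine ((hy t ht).congr hv (hv t ht)).congr_deriv ?_
    simp

lemma IsParallelOn.glue {z Y₁ Y₂ : ℝ → TangentBundle (𝓡 n) M} {a s b : ℝ} (has : a ≤ s)
    (hsb : s ≤ b) (h1 : IsParallelOn z Y₁ (Icc a s)) (h2 : IsParallelOn z Y₂ (Icc s b))
    (h : Y₁ s = Y₂ s) : IsParallelOn z (fun t => if t ≤ s then Y₁ t else Y₂ t) (Icc a b) := by
  have e1 : ∀ t ∈ Icc a s, (if t ≤ s then Y₁ t else Y₂ t) = Y₁ t := fun t ht => if_pos ht.2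
  have e2 : ∀ t ∈ Icc s b, (if t ≤ s then Y₁ t else Y₂ t) = Y₂ t := by
    intro t ht
    rcases ht.1.eq_or_lt with rfl | h'
    · rw [if_pos le_rfl, h]
    · exact if_neg h'.not_ge
  intro t ht
  refine ⟨?_, fun c hc => hasDerivWithinAt_Icc_glue has hsb (fun h1t => ?_) (fun h2t => ?_)⟩
  · rcases le_total t s with h' | h'
    · have := (h1 t ⟨ht.1, h'⟩).1
      simp only [e1 t ⟨ht.1, h'⟩, this]
    · have := (h2 t ⟨h', ht.2⟩).1
      simp only [e2 t ⟨h', ht.2⟩, this]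
  · simp only [e1 t h1t]
    exact ((h1 t h1t).2 c hc).congr (fun τ hτ => by rw [e1 τ hτ]) (by rw [e1 t h1t])
  · simp only [e2 t h2t]
    exact ((h2 t h2t).2 c hc).congr (fun τ hτ => by rw [e2 τ hτ]) (by rw [e2 t h2t])

/-- Parallel transport along a geodesic exists. -/
lemma IsGeodesic.exists_parallel {z : ℝ → TangentBundle (𝓡 n) M} (hz : IsGeodesic z)
    (Y₀ : TangentBundle (𝓡 n) M) (hY₀ : Y₀.proj = (z 0).proj) :
    ∃ Y, Y 0 = Y₀ ∧ IsParallelOn z Y (Icc 0 1) := by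
  have hzc := hz.continuousOn
  -- Interval induction on the existence of a parallel field over [0, t]; over the degenerate
  -- interval [0, 0] the derivative condition is void.
  have := Icc_induction (a := 0) (b := 1) (fun t => ∃ Y, Y 0 = Y₀ ∧ IsParallelOn z Y (Icc 0 t))
    ⟨fun _ => Y₀, rfl, ?_⟩ ?_ 1 (by simp)
  · exact this
  · intro t ht
    rw [Icc_self, mem_singleton_iff] at ht
    subst ht
    refine ⟨hY₀, fun c hc => ?_⟩
    rw [Icc_self]
    exact HasFDerivWithinAt.of_subsingleton subsingleton_singleton
  · intro t ht
    set c := (z t).proj with hcdef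
    have hct : (z t).proj ∈ (chartAt (Euc n) c).source := mem_chart_source _ _
    have hzt := hzc t ht
    have ev1 : ∀ᶠ τ in 𝓝[Icc 0 1] t, (z τ).proj ∈ (chartAt (Euc n) c).source :=
      (continuous_bundleProj.continuousAt.comp_continuousWithinAt hzt).preimage_mem_nhdsWithin
        ((chartAt (Euc n) c).open_source.mem_nhds hct)
    set C := ‖-christoffelMap c (posCoord c (z t).proj) (velCoord c (z t))‖ + 1 with hCdef
    have hC0 : 0 < C := by positivity
    have ev2 : ∀ᶠ τ in 𝓝[Icc 0 1] t,
        ‖-christoffelMap c (posCoord c (z τ).proj) (velCoord c (z τ))‖ < C :=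
      (parallelCoeff_continuousWithinAt hzt hct).norm.eventually_lt_const (lt_add_one _)
    obtain ⟨δ, hδ, hδ'⟩ := Metric.mem_nhdsWithin_iff.1 (ev1.and ev2)
    -- Two times within 1/(4C) of `t` are at most 1/(2C) apart, which is the length allowed by
    -- `exists_parallel_local`.
    refine ⟨min δ (1 / (4 * C)), by positivity, ?_⟩
    rintro s hs s' hs' hst hst' hss' ⟨Y, hY0, hY⟩
    have hsub : Icc s s' ⊆ Icc 0 1 := Icc_subset_Icc hs.1 hs'.2
    have hin : ∀ τ ∈ Icc s s', (z τ).proj ∈ (chartAt (Euc n) c).source ∧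
        ‖-christoffelMap c (posCoord c (z τ).proj) (velCoord c (z τ))‖ < C := by
      intro τ hτ
      refine hδ' ⟨?_, hsub hτ⟩
      rw [Metric.mem_ball, Real.dist_eq, abs_lt]
      have h1 := abs_lt.1 (hst.trans_le (min_le_left _ _))
      have h2 := abs_lt.1 (hst'.trans_le (min_le_left _ _))
      constructor <;> linarith [hτ.1, hτ.2]
    obtain ⟨Y', hY'0, hY'⟩ := exists_parallel_local (C := C) hss'
      (fun τ hτ => (hz.1 τ (hsub hτ)).mono hsub) (hzc.mono hsub)
      (fun τ hτ => (hin τ hτ).1) hC0.le (fun τ hτ => (hin τ hτ).2.le) (by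
        have h1 := (abs_lt.1 (hst.trans_le (min_le_right _ _))).1
        have h2 := (abs_lt.1 (hst'.trans_le (min_le_right _ _))).2
        have h3 : s' - s ≤ 2 * (1 / (4 * C)) := by linarith
        calc 2 * C * (s' - s) ≤ 2 * C * (2 * (1 / (4 * C))) := by gcongr
          _ = 1 := by field_simp; norm_num) (Y s) (hY s ⟨hs.1, le_rfl⟩).1
    exact ⟨_, by simp [hs.1, hY0], hY.glue hs.1 hss' hY' hY'0.symm⟩

end ParallelExistence

/-! ### Continuation arguments and Grönwall estimates -/

section Continuation

/-- A continuous curve that starts in `U` and is in `U` at each time before which it stayed in the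
closed set `C ⊇ U` stays in `U`. -/
lemma mapsTo_of_continuation {X : Type*} [TopologicalSpace X] {U C : Set X} (hU : IsOpen U)
    (hC : IsClosed C) (hUC : U ⊆ C) {z : ℝ → X} {a b : ℝ} (hz : ContinuousOn z (Icc a b))
    (ha : z a ∈ U) (hstep : ∀ t ∈ Icc a b, (∀ s ∈ Icc a t, z s ∈ C) → z t ∈ U) :
    ∀ t ∈ Icc a b, z t ∈ U := by
  by_contra! hcon
  obtain ⟨t₁, ht₁, hzt₁⟩ := hcon
  have hcl : IsClosed (Icc a b ∩ z ⁻¹' Uᶜ) := hz.preimage_isClosed_of_isClosed isClosed_Icc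
    hU.isClosed_compl
  -- The first time outside `U`. Before it the curve is in `U`, so at it the curve is still in the
  -- closed set `C`, and the hypothesis puts it back into `U`.
  obtain ⟨τ, ⟨hτ, hτU⟩, hmin⟩ := (isCompact_Icc.of_isClosed_subset hcl
    inter_subset_left).exists_isLeast
    ⟨t₁, ht₁, hzt₁⟩
  have hlt : ∀ s ∈ Ico a τ, z s ∈ U := by
    intro s hs
    by_contra hsU
    exact (hmin ⟨⟨hs.1, hs.2.le.trans hτ.2⟩, hsU⟩).not_gt hs.2
  have haτ : a < τ := by
    rcases hτ.1.eq_or_lt with h | h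
    · exact absurd (h ▸ ha) hτU
    · exact h
  have hcont : ContinuousWithinAt z (Ico a τ) τ :=
    (hz τ hτ).mono (fun s hs => ⟨hs.1, hs.2.le.trans hτ.2⟩)
  have hzτ : z τ ∈ C := hC.closure_subset (hcont.mem_closure
    (by rw [closure_Ico haτ.ne]; exact ⟨haτ.le, le_rfl⟩) (fun s hs => hUC (hlt s hs)))
  refine hτU (hstep τ hτ fun s hs => ?_)
  rcases hs.2.eq_or_lt with rfl | h
  · exact hzτ
  · exact hUC (hlt s ⟨hs.1, h⟩)

/-- The set is the image of a compact ball under the inverse chart, hence compact, hence closed in a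
Hausdorff space. Continuation needs closedness in the whole space, not just in the chart domain. -/
lemma isClosed_source_inter_preimage_closedBall {X E : Type*} [TopologicalSpace X] [T2Space X]
    [NormedAddCommGroup E] [ProperSpace E] (Ψ : OpenPartialHomeomorph X E) {y : E} {r : ℝ}
    (h : Metric.closedBall y r ⊆ Ψ.target) :
    IsClosed (Ψ.source ∩ Ψ ⁻¹' Metric.closedBall y r) := by
  rw [← Ψ.symm_image_eq_source_inter_preimage h]
  exact ((isCompact_closedBall y r).image_of_continuousOn (Ψ.continuousOn_symm.mono h)).isClosed

lemma hasDerivWithinAt_Ici_of_Icc {E : Type*} [NormedAddCommGroup E] [NormedSpace ℝ E] {f : ℝ → E}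
    {d : E} {a b t : ℝ} (h : HasDerivWithinAt f d (Icc a b) t) (ht : t ∈ Ico a b) :
    HasDerivWithinAt f d (Ici t) t :=
  h.mono_of_mem_nhdsWithin (mem_of_superset (Icc_mem_nhdsGE ht.2) (Icc_subset_Icc_left ht.1))

/-- The difference satisfies (f - g)' = A(f - g) + (A - B)g, so Grönwall applies. Only `g` enters
the error term, so no a priori bound on `f` is needed. -/
lemma linear_ode_norm_sub_le {E : Type*} [NormedAddCommGroup E] [NormedSpace ℝ E]
    {A B : ℝ → E →L[ℝ] E} {f g : ℝ → E} {a b C ε δ : ℝ}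
    (hf : ∀ t ∈ Icc a b, HasDerivWithinAt f (A t (f t)) (Icc a b) t)
    (hg : ∀ t ∈ Icc a b, HasDerivWithinAt g (B t (g t)) (Icc a b) t)
    (hA : ∀ t ∈ Icc a b, ‖A t‖ ≤ C) (hAB : ∀ t ∈ Icc a b, ‖A t - B t‖ * ‖g t‖ ≤ ε)
    (h0 : ‖f a - g a‖ ≤ δ) : ∀ t ∈ Icc a b, ‖f t - g t‖ ≤ gronwallBound δ C ε (t - a) := by
  refine norm_le_gronwallBound_of_norm_deriv_right_le
    (fun t ht => ((hf t ht).sub (hg t ht)).continuousWithinAt)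
    (fun t ht => hasDerivWithinAt_Ici_of_Icc ((hf t (Ico_subset_Icc_self ht)).sub
      (hg t (Ico_subset_Icc_self ht))) ht) h0 fun t ht => ?_
  have ht' := Ico_subset_Icc_self ht
  have e : A t (f t) - B t (g t) = A t (f t - g t) + (A t - B t) (g t) := by
    rw [map_sub, sub_apply]; abel
  rw [e]
  refine (norm_add_le _ _).trans (add_le_add ?_ ?_)
  · exact ((A t).le_opNorm _).trans (by gcongr; exact hA t ht')
  · exact ((A t - B t).le_opNorm _).trans (hAB t ht')

end Continuation

/-! ### Continuous dependence of geodesics and parallel fields -/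

section ContinuousDependence

lemma bchart_continuousAt {c : M} {p : TangentBundle (𝓡 n) M}
    (hp : p.proj ∈ (chartAt (Euc n) c).source) : ContinuousAt (bchart c) p :=
  (bchart c).continuousAt (by rw [bchart_source]; exact hp)

lemma tendsto_of_bchart {ι : Type*} {l : Filter ι} {c : M} {p : TangentBundle (𝓡 n) M}
    (hp : p.proj ∈ (chartAt (Euc n) c).source) {q : ι → TangentBundle (𝓡 n) M}
    (hq : ∀ᶠ k in l, (q k).proj ∈ (chartAt (Euc n) c).source)
    (h : Tendsto (fun k => bchart c (q k)) l (𝓝 (bchart c p))) : Tendsto q l (𝓝 p) := by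
  have hm : p ∈ (bchart (n := n) c).source := by rw [bchart_source]; exact hp
  have h1 := ((bchart c).continuousAt_symm ((bchart c).map_source hm)).tendsto.comp h
  rw [(bchart c).left_inv hm] at h1
  refine h1.congr' ?_
  filter_upwards [hq] with k hk
  exact (bchart c).left_inv (by rw [bchart_source]; exact hk)

variable [RiemannianBundle (fun x : M => TangentSpace (𝓡 n) x)]

/-- The coefficients of parallel transport as a function of position and velocity. -/
def parallelCoeff (c : M) (p : Euc n × Euc n) : Euc n →L[ℝ] Euc n := -christoffelMap c p.1 p.2

/-- The geodesic vector field in the bundle chart around `c`. -/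
def geodesicField (c : M) (p : Euc n × Euc n) : Euc n × Euc n := (p.2, parallelCoeff c p p.2)

lemma IsParallelOn.hasDerivWithinAt {z Y : ℝ → TangentBundle (𝓡 n) M} {s : Set ℝ}
    (h : IsParallelOn z Y s) {t : ℝ} (ht : t ∈ s) {c : M}
    (hc : (z t).proj ∈ (chartAt (Euc n) c).source) :
    HasDerivWithinAt (fun τ => velCoord c (Y τ))
      (parallelCoeff c (bchart c (z t)) (velCoord c (Y t))) s t := by
  refine ((h t ht).2 c hc).congr_deriv ?_
  rw [← christoffelMap_apply, parallelCoeff, bchart_apply]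
  simp

lemma IsGeodesic.hasDerivWithinAt {z : ℝ → TangentBundle (𝓡 n) M} (h : IsGeodesic z) {t : ℝ}
    (ht : t ∈ Icc (0 : ℝ) 1) {c : M} (hc : (z t).proj ∈ (chartAt (Euc n) c).source) :
    HasDerivWithinAt (fun τ => bchart c (z τ)) (geodesicField c (bchart c (z t))) (Icc 0 1) t :=
  (posCoord_hasDerivWithinAt (h.1 t ht) c hc).prodMk (h.2.hasDerivWithinAt ht hc)

/-- Gronwall estimate for two geodesics in a chart. -/
lemma IsGeodesic.dist_bchart_le [T2Space M] {c : M} {y₀ : Euc n × Euc n} {r : ℝ} {K : NNReal}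
    (hball : Metric.closedBall y₀ r ⊆ (bchart (n := n) c).target)
    (hK : LipschitzOnWith K (geodesicField c) (Metric.closedBall y₀ r))
    {z w : ℝ → TangentBundle (𝓡 n) M} (hz : IsGeodesic z) (hw : IsGeodesic w) {a b : ℝ}
    (ha : 0 ≤ a) (hab : a ≤ b) (hb : b ≤ 1)
    (hzs : ∀ t ∈ Icc a b, (z t).proj ∈ (chartAt (Euc n) c).source)
    (hzb : ∀ t ∈ Icc a b, bchart c (z t) ∈ Metric.closedBall y₀ (r / 2))
    (hws : (w a).proj ∈ (chartAt (Euc n) c).source)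
    (hwa : dist (bchart c (w a)) (bchart c (z a)) * Real.exp K < r / 2) :
    ∀ t ∈ Icc a b, ((w t).proj ∈ (chartAt (Euc n) c).source ∧
      bchart c (w t) ∈ Metric.closedBall y₀ r) ∧
      dist (bchart c (w t)) (bchart c (z t)) ≤
        dist (bchart c (w a)) (bchart c (z a)) * Real.exp K := by
  have hsub : Icc a b ⊆ Icc 0 1 := Icc_subset_Icc ha hb
  have hexp : 1 ≤ Real.exp K := Real.one_le_exp K.2
  set D := dist (bchart c (w a)) (bchart c (z a)) with hD
  have hD0 : 0 ≤ D := dist_nonneg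
  have hr : 0 < r := by nlinarith
  set C := (bchart (n := n) c).source ∩ bchart c ⁻¹' Metric.closedBall y₀ r with hCdef
  set U := (bchart (n := n) c).source ∩ bchart c ⁻¹' Metric.ball y₀ r with hUdef
  have hUC : U ⊆ C := inter_subset_inter_right _ (preimage_mono Metric.ball_subset_closedBall)
  have hzr : ∀ t ∈ Icc a b, bchart c (z t) ∈ Metric.closedBall y₀ r := fun t ht =>
    Metric.closedBall_subset_closedBall (by linarith) (hzb t ht)
  have hest : ∀ t ∈ Icc a b, (∀ s ∈ Icc a t, w s ∈ C) →
      dist (bchart c (w t)) (bchart c (z t)) ≤ D * Real.exp K := by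
    intro t ht hs
    have hsub' : Icc a t ⊆ Icc a b := Icc_subset_Icc_right ht.2
    have hsrc : ∀ s ∈ Icc a t, (w s).proj ∈ (chartAt (Euc n) c).source := by
      intro s h
      have := (hs s h).1
      rwa [bchart_source] at this
    have dw : ∀ s ∈ Icc a t, HasDerivWithinAt (fun τ => bchart c (w τ))
        (geodesicField c (bchart c (w s))) (Icc a t) s := fun s h =>
      (hw.hasDerivWithinAt (hsub (hsub' h)) (hsrc s h)).mono (hsub'.trans hsub)
    have dz : ∀ s ∈ Icc a t, HasDerivWithinAt (fun τ => bchart c (z τ))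
        (geodesicField c (bchart c (z s))) (Icc a t) s := fun s h =>
      (hz.hasDerivWithinAt (hsub (hsub' h)) (hzs s (hsub' h))).mono (hsub'.trans hsub)
    have := dist_le_of_trajectories_ODE_of_mem (v := fun _ => geodesicField c)
      (s := fun _ => Metric.closedBall y₀ r) (fun _ _ => hK)
      (fun s h => (dw s h).continuousWithinAt)
      (fun s h => hasDerivWithinAt_Ici_of_Icc (dw s (Ico_subset_Icc_self h)) h)
      (fun s h => (hs s (Ico_subset_Icc_self h)).2)
      (fun s h => (dz s h).continuousWithinAt)
      (fun s h => hasDerivWithinAt_Ici_of_Icc (dz s (Ico_subset_Icc_self h)) h)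
      (fun s h => hzr s (hsub' (Ico_subset_Icc_self h))) (le_refl D) t ⟨ht.1, le_rfl⟩
    refine this.trans ?_
    have h1 : (K : ℝ) * (t - a) ≤ K := by
      have : t - a ≤ 1 := by linarith [ht.2]
      nlinarith [K.2]
    gcongr
  have hmem : ∀ t ∈ Icc a b, w t ∈ (bchart (n := n) c).source →
      dist (bchart c (w t)) (bchart c (z t)) ≤ D * Real.exp K → w t ∈ U := by
    intro t ht h1 h2
    refine ⟨h1, ?_⟩
    have := Metric.mem_closedBall.1 (hzb t ht)
    exact lt_of_le_of_lt (dist_triangle _ (bchart c (z t)) _) (by linarith)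
  have hw' : ContinuousOn w (Icc a b) := hw.continuousOn.mono hsub
  -- As long as `w` stays in the closed ball, Grönwall keeps it within r/2 of `z`, strictly, and `z`
  -- is within r/2 of the centre; so `w` is in the open ball and cannot escape.
  have hU := mapsTo_of_continuation ((bchart (n := n) c).isOpen_inter_preimage Metric.isOpen_ball)
    (isClosed_source_inter_preimage_closedBall _ hball) hUC hw'
    (hmem a ⟨le_rfl, hab⟩ (by rw [bchart_source]; exact hws) (by nlinarith))
    (fun t ht hs => hmem t ht (hs t ⟨ht.1, le_rfl⟩).1 (hest t ht hs))
  intro t ht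
  refine ⟨?_, hest t ht fun s hs => hUC (hU s ⟨hs.1, hs.2.trans ht.2⟩)⟩
  have h1 := hUC (hU t ht)
  rw [hCdef, bchart_source] at h1
  exact h1

variable [IsContMDiffRiemannianBundle (𝓡 n) ∞ (Euc n) (fun x : M => TangentSpace (𝓡 n) x)]

lemma parallelCoeff_contDiffAt {c : M} {p : TangentBundle (𝓡 n) M}
    (hp : p.proj ∈ (chartAt (Euc n) c).source) : ContDiffAt ℝ ∞ (parallelCoeff c) (bchart c p) := by
  have h1 : ContDiffAt ℝ ∞ (christoffelMap c) (bchart c p).1 :=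
    (christoffelMap_contDiffOn c).contDiffAt ((isOpen_extChartAt_target c).mem_nhds
      ((extChartAt (𝓡 n) c).map_source (by rw [extChartAt_source]; exact hp)))
  exact ((h1.comp (bchart c p) contDiffAt_fst).clm_apply contDiffAt_snd).neg

lemma geodesicField_contDiffAt {c : M} {p : TangentBundle (𝓡 n) M}
    (hp : p.proj ∈ (chartAt (Euc n) c).source) : ContDiffAt ℝ ∞ (geodesicField c) (bchart c p) :=
  contDiffAt_snd.prodMk ((parallelCoeff_contDiffAt hp).clm_apply contDiffAt_snd)

/-- Geodesics and parallel vector fields along them depend continuously on the initial values. -/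
theorem tendsto_geodesic_parallel [T2Space M] {ι : Type*} {l : Filter ι}
    {z Y : ℝ → TangentBundle (𝓡 n) M} {zk Yk : ι → ℝ → TangentBundle (𝓡 n) M}
    (hz : IsGeodesic z) (hY : IsParallelOn z Y (Icc 0 1)) (hzk : ∀ k, IsGeodesic (zk k))
    (hYk : ∀ k, IsParallelOn (zk k) (Yk k) (Icc 0 1))
    (hz0 : Tendsto (fun k => zk k 0) l (𝓝 (z 0))) (hY0 : Tendsto (fun k => Yk k 0) l (𝓝 (Y 0))) :
    ∀ t ∈ Icc (0 : ℝ) 1, Tendsto (fun k => zk k t) l (𝓝 (z t)) ∧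
      Tendsto (fun k => Yk k t) l (𝓝 (Y t)) := by
  refine Icc_induction _ ⟨hz0, hY0⟩ fun t₀ ht₀ => ?_
  set c := (z t₀).proj with hc
  have hct : (z t₀).proj ∈ (chartAt (Euc n) c).source := mem_chart_source _ _
  obtain ⟨K, S, hS, hKS⟩ := ((geodesicField_contDiffAt hct).of_le (m := 1)
    (by norm_cast)).exists_lipschitzOnWith
  obtain ⟨L, S', hS', hLS⟩ := ((parallelCoeff_contDiffAt hct).of_le (m := 1)
    (by norm_cast)).exists_lipschitzOnWith
  set y₀ := bchart c (z t₀) with hy₀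
  -- The summand 1 gives a strict bound near y₀ and makes `C` nonzero, which the explicit form of
  -- the Grönwall bound below requires.
  set C := ‖parallelCoeff c y₀‖ + 1 with hCdef
  have hC0 : 0 < C := by positivity
  have hS'' : {p | ‖parallelCoeff c p‖ < C} ∈ 𝓝 y₀ :=
    (parallelCoeff_contDiffAt hct).continuousAt.norm.eventually_lt_const (lt_add_one _)
  have htar : (bchart (n := n) c).target ∈ 𝓝 y₀ := (bchart c).open_target.mem_nhds
    ((bchart c).map_source (by rw [bchart_source]; exact hct))
  obtain ⟨r, hr, hrS⟩ := Metric.nhds_basis_closedBall.mem_iff.1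
    (inter_mem (inter_mem hS hS') (inter_mem hS'' htar))
  have hzt := hz.continuousOn t₀ ht₀
  have ev1 : ∀ᶠ τ in 𝓝[Icc 0 1] t₀, (z τ).proj ∈ (chartAt (Euc n) c).source :=
    (continuous_bundleProj.continuousAt.comp_continuousWithinAt hzt).preimage_mem_nhdsWithin
      ((chartAt (Euc n) c).open_source.mem_nhds hct)
  have ev2 : ∀ᶠ τ in 𝓝[Icc 0 1] t₀, bchart c (z τ) ∈ Metric.closedBall y₀ (r / 2) :=
    (ContinuousAt.comp_continuousWithinAt (g := bchart c) (f := z) (bchart_continuousAt hct)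
      hzt).preimage_mem_nhdsWithin (Metric.closedBall_mem_nhds _ (by positivity))
  obtain ⟨δ, hδ, hδ'⟩ := Metric.mem_nhdsWithin_iff.1 (ev1.and ev2)
  refine ⟨δ, hδ, ?_⟩
  rintro s hs s' hs' hst hst' hss' ⟨hzs, hYs⟩
  have hsub : Icc s s' ⊆ Icc 0 1 := Icc_subset_Icc hs.1 hs'.2
  have hin : ∀ τ ∈ Icc s s', (z τ).proj ∈ (chartAt (Euc n) c).source ∧
      bchart c (z τ) ∈ Metric.closedBall y₀ (r / 2) := by
    intro τ hτ
    refine hδ' ⟨?_, hsub hτ⟩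
    rw [Metric.mem_ball, Real.dist_eq, abs_lt]
    have h1 := abs_lt.1 hst
    have h2 := abs_lt.1 hst'
    constructor <;> linarith [hτ.1, hτ.2]
  have hsm : s ∈ Icc s s' := ⟨le_rfl, hss'⟩
  have hsm' : s' ∈ Icc s s' := ⟨hss', le_rfl⟩
  set D : ι → ℝ := fun k => dist (bchart c (zk k s)) (bchart c (z s)) with hD
  have hDlim : Tendsto D l (𝓝 0) :=
    tendsto_iff_dist_tendsto_zero.1 ((bchart_continuousAt (hin s hsm).1).tendsto.comp hzs)
  have hDlim' : Tendsto (fun k => D k * Real.exp K) l (𝓝 0) := by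
    simpa using hDlim.mul_const (Real.exp K)
  have hsrc : ∀ᶠ k in l, (zk k s).proj ∈ (chartAt (Euc n) c).source :=
    (continuous_bundleProj.continuousAt.tendsto.comp hzs).eventually
      ((chartAt (Euc n) c).open_source.mem_nhds (hin s hsm).1)
  have hmain : ∀ᶠ k in l, ∀ t ∈ Icc s s', ((zk k t).proj ∈ (chartAt (Euc n) c).source ∧
      bchart c (zk k t) ∈ Metric.closedBall y₀ r) ∧
      dist (bchart c (zk k t)) (bchart c (z t)) ≤ D k * Real.exp K := by
    filter_upwards [hsrc, hDlim'.eventually_lt_const (half_pos hr)] with k h1 h2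
    exact IsGeodesic.dist_bchart_le (fun p hp => (hrS hp).2.2)
      (hKS.mono fun p hp => (hrS hp).1.1) hz (hzk k) hs.1 hss' hs'.2 (fun t ht => (hin t ht).1)
      (fun t ht => (hin t ht).2) h1 h2
  have hzlim : Tendsto (fun k => bchart c (zk k s')) l (𝓝 (bchart c (z s'))) := by
    rw [tendsto_iff_dist_tendsto_zero]
    refine squeeze_zero' (Eventually.of_forall fun _ => dist_nonneg) ?_ hDlim'
    filter_upwards [hmain] with k hk using (hk s' hsm').2
  have hsrc' : ∀ᶠ k in l, (zk k s').proj ∈ (chartAt (Euc n) c).source := by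
    filter_upwards [hmain] with k hk using (hk s' hsm').1.1
  refine ⟨tendsto_of_bchart (hin s' hsm').1 hsrc' hzlim, ?_⟩
  have hdY : ∀ t ∈ Icc s s', HasDerivWithinAt (fun τ => velCoord c (Y τ))
      (parallelCoeff c (bchart c (z t)) (velCoord c (Y t))) (Icc s s') t := fun t ht =>
    (hY.hasDerivWithinAt (hsub ht) (hin t ht).1).mono hsub
  obtain ⟨N, hN⟩ := isCompact_Icc.exists_bound_of_continuousOn
    (fun t ht => (hdY t ht).continuousWithinAt)
  set y := fun τ => velCoord c (Y τ) with hy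
  -- The inhomogeneity for `linear_ode_norm_sub_le`: the Lipschitz constant of the coefficients,
  -- times the distance of the geodesics, times a bound for the limit field.
  set ε : ι → ℝ := fun k => (L * (D k * Real.exp K)) * N with hε
  have hεlim : Tendsto ε l (𝓝 0) := by
    simpa using (hDlim'.const_mul (L : ℝ)).mul_const N
  have hYp : ∀ t ∈ Icc (0 : ℝ) 1, (Y t).proj = (z t).proj := fun t ht => (hY t ht).1
  have hYkp : ∀ k, ∀ t ∈ Icc (0 : ℝ) 1, (Yk k t).proj = (zk k t).proj :=
    fun k t ht => (hYk k t ht).1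
  have hYvel : Tendsto (fun k => velCoord c (Yk k s)) l (𝓝 (y s)) :=
    (velCoord_continuousAt (by rw [hYp s hs]; exact (hin s hsm).1)).tendsto.comp hYs
  set δ' : ι → ℝ := fun k => ‖velCoord c (Yk k s) - y s‖ with hδ'def
  have hδlim : Tendsto δ' l (𝓝 0) := by
    have := tendsto_iff_norm_sub_tendsto_zero.1 hYvel
    exact this
  have hbound : ∀ᶠ k in l, ‖velCoord c (Yk k s') - y s'‖ ≤
      gronwallBound (δ' k) C (ε k) (s' - s) := by
    filter_upwards [hmain] with k hk
    refine linear_ode_norm_sub_le (f := fun τ => velCoord c (Yk k τ)) (g := y)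
      (A := fun t => parallelCoeff c (bchart c (zk k t)))
      (fun t ht => ((hYk k).hasDerivWithinAt (hsub ht) (hk t ht).1.1).mono hsub) hdY
      (fun t ht => le_of_lt (hrS (hk t ht).1.2).2.1) (fun t ht => ?_) le_rfl s' hsm'
    have hzr : bchart c (z t) ∈ Metric.closedBall y₀ r :=
      Metric.closedBall_subset_closedBall (by linarith) (hin t ht).2
    have h1 := hLS.dist_le_mul _ (hrS (hk t ht).1.2).1.2 _ (hrS hzr).1.2
    rw [dist_eq_norm] at h1
    have h2 : ‖parallelCoeff c (bchart c (zk k t)) - parallelCoeff c (bchart c (z t))‖ ≤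
        L * (D k * Real.exp K) := h1.trans (by gcongr; exact (hk t ht).2)
    exact mul_le_mul h2 (hN t ht) (norm_nonneg _) ((norm_nonneg _).trans h2)
  have hglim : Tendsto (fun k => gronwallBound (δ' k) C (ε k) (s' - s)) l (𝓝 0) := by
    simp only [gronwallBound_of_K_ne_0 hC0.ne']
    have := (hδlim.mul_const (Real.exp (C * (s' - s)))).add
      ((hεlim.div_const C).mul_const (Real.exp (C * (s' - s)) - 1))
    simpa using this
  have hylim : Tendsto (fun k => velCoord c (Yk k s')) l (𝓝 (y s')) := by
    rw [tendsto_iff_norm_sub_tendsto_zero]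
    exact squeeze_zero' (Eventually.of_forall fun _ => norm_nonneg _) hbound hglim
  refine tendsto_of_bchart (c := c) (by rw [hYp s' hs']; exact (hin s' hsm').1) ?_ ?_
  · filter_upwards [hsrc'] with k hk
    rwa [hYkp k s' hs']
  · simp only [bchart_apply]
    refine Tendsto.prodMk_nhds ?_ hylim
    have := (continuous_fst.tendsto _).comp hzlim
    simp only [Function.comp_def, bchart_apply] at this
    rw [hYp s' hs']
    simpa only [hYkp _ s' hs'] using this

end ContinuousDependence

/-! ### Continuity of distance and of parallel transport -/

section Transport

variable [RiemannianBundle (fun x : M => TangentSpace (𝓡 n) x)]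

lemma IsMinGeodesic.riemannianEDist_ne_top {p q : M} {z : ℝ → TangentBundle (𝓡 n) M}
    (hz : IsMinGeodesic p q z) : riemannianEDist (𝓡 n) p q ≠ ⊤ := by
  rw [← hz.2.2.2 0 (by simp)]
  exact enorm_ne_top

lemma IsClose.riemannianEDist_ne_top {p q : M} (h : IsClose n p q) :
    riemannianEDist (𝓡 n) p q ≠ ⊤ := by
  obtain ⟨⟨z, hz, -⟩, -⟩ := h
  exact hz.riemannianEDist_ne_top

variable [IsContMDiffRiemannianBundle (𝓡 n) ∞ (Euc n) (fun x : M => TangentSpace (𝓡 n) x)]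

instance : IsContinuousRiemannianBundle (Euc n) (fun x : M => TangentSpace (𝓡 n) x) := by
  obtain ⟨g, hg, hg'⟩ := IsContMDiffRiemannianBundle.exists_contMDiff (IB := 𝓡 n) (n := ∞)
    (F := Euc n) (E := fun x : M => TangentSpace (𝓡 n) x)
  exact ⟨⟨g, hg.continuous, hg'⟩⟩

/-- The vectors live in different fibres. In the chart at the limit point the inner products become
values of one continuously varying bilinear form on Euclidean space. -/
lemma tendsto_inner {ι : Type*} {l : Filter ι} {q : ι → M} {v w : ∀ k, TangentSpace (𝓡 n) (q k)}
    {p : M} {v₀ w₀ : TangentSpace (𝓡 n) p}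
    (hv : Tendsto (fun k => (⟨q k, v k⟩ : TangentBundle (𝓡 n) M)) l (𝓝 ⟨p, v₀⟩))
    (hw : Tendsto (fun k => (⟨q k, w k⟩ : TangentBundle (𝓡 n) M)) l (𝓝 ⟨p, w₀⟩)) :
    Tendsto (fun k => inner ℝ (v k) (w k)) l (𝓝 (inner ℝ v₀ w₀)) := by
  have hp : p ∈ (chartAt (Euc n) p).source := mem_chart_source _ _
  have hq : Tendsto q l (𝓝 p) := (continuous_bundleProj.tendsto _).comp hv
  have hsrc := hq.eventually ((chartAt (Euc n) p).open_source.mem_nhds hp)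
  have h1 : Tendsto (fun k => metricForm p (posCoord p (q k))) l
      (𝓝 (metricForm p (posCoord p p))) :=
    (((metricForm_contDiffOn p).continuousOn.continuousAt ((isOpen_extChartAt_target p).mem_nhds
      ((extChartAt (𝓡 n) p).map_source (by rw [extChartAt_source]; exact hp)))).tendsto.comp
      ((posCoord_continuousAt hp).tendsto.comp hq))
  have h2 := (velCoord_continuousAt (c := p) (p := ⟨p, v₀⟩) hp).tendsto.comp hv
  have h3 := (velCoord_continuousAt (c := p) (p := ⟨p, w₀⟩) hp).tendsto.comp hw
  have happ : ∀ {F : Type} [NormedAddCommGroup F] [NormedSpace ℝ F] {A : ι → Euc n →L[ℝ] F}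
      {A₀ : Euc n →L[ℝ] F} {x : ι → Euc n} {x₀ : Euc n}, Tendsto A l (𝓝 A₀) → Tendsto x l (𝓝 x₀) →
      Tendsto (fun k => A k (x k)) l (𝓝 (A₀ x₀)) := fun hA hx =>
    (isBoundedBilinearMap_apply.continuous.tendsto _).comp (hA.prodMk_nhds hx)
  have h4 := happ (happ h1 h2) h3
  rw [metricForm_velCoord hp] at h4
  refine h4.congr' ?_
  filter_upwards [hsrc] with k hk
  exact metricForm_velCoord hk _ _

lemma tendsto_norm_snd {ι : Type*} {l : Filter ι} {q : ι → TangentBundle (𝓡 n) M}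
    {p : TangentBundle (𝓡 n) M} (h : Tendsto q l (𝓝 p)) :
    Tendsto (fun k => ‖(q k).snd‖) l (𝓝 ‖p.snd‖) := by
  have := (tendsto_inner (v := fun k => (q k).snd) (w := fun k => (q k).snd) (v₀ := p.snd)
    (w₀ := p.snd) h h).sqrt
  simpa only [real_inner_self_eq_norm_sq, Real.sqrt_sq (norm_nonneg _)] using this

lemma tendsto_enorm_snd {ι : Type*} {l : Filter ι} {q : ι → TangentBundle (𝓡 n) M}
    {p : TangentBundle (𝓡 n) M} (h : Tendsto q l (𝓝 p)) :
    Tendsto (fun k => ‖(q k).snd‖ₑ) l (𝓝 ‖p.snd‖ₑ) := by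
  simp only [← ofReal_norm]
  exact ENNReal.tendsto_ofReal (tendsto_norm_snd h)

/-- The triangle inequality bounds the change by d(p, p_k) + d(q, q_k). Finiteness of the limit is
what makes subtraction of extended distances continuous there. -/
lemma tendsto_riemannianEDist {ι : Type*} {l : Filter ι} {pk qk : ι → M} {p q : M}
    (hp : Tendsto pk l (𝓝 p)) (hq : Tendsto qk l (𝓝 q)) (hfin : riemannianEDist (𝓡 n) p q ≠ ⊤) :
    Tendsto (fun k => riemannianEDist (𝓡 n) (pk k) (qk k)) l (𝓝 (riemannianEDist (𝓡 n) p q)) := by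
  have h0 : ∀ {x : M} {xk : ι → M}, Tendsto xk l (𝓝 x) →
      Tendsto (fun k => riemannianEDist (𝓡 n) x (xk k)) l (𝓝 0) := by
    intro x xk hx
    rw [ENNReal.tendsto_nhds_zero]
    intro ε hε
    filter_upwards [hx.eventually (eventually_riemannianEDist_lt (𝓡 n) x hε)] with k hk using hk.le
  set e := fun k => riemannianEDist (𝓡 n) p (pk k) + riemannianEDist (𝓡 n) q (qk k) with he
  have helim : Tendsto e l (𝓝 0) := by simpa using (h0 hp).add (h0 hq)
  refine tendsto_of_tendsto_of_tendsto_of_le_of_le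
    (g := fun k => riemannianEDist (𝓡 n) p q - e k) (h := fun k => riemannianEDist (𝓡 n) p q + e k)
    ?_ ?_ (fun k => ?_) (fun k => ?_)
  · simpa using ENNReal.Tendsto.sub (tendsto_const_nhds (x := riemannianEDist (𝓡 n) p q)) helim
      (Or.inl hfin)
  · simpa using (tendsto_const_nhds (x := riemannianEDist (𝓡 n) p q)).add helim
  · rw [tsub_le_iff_right]
    calc riemannianEDist (𝓡 n) p q
        ≤ riemannianEDist (𝓡 n) p (pk k) + riemannianEDist (𝓡 n) (pk k) q :=
          riemannianEDist_triangle
      _ ≤ riemannianEDist (𝓡 n) p (pk k) + (riemannianEDist (𝓡 n) (pk k) (qk k) +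
          riemannianEDist (𝓡 n) (qk k) q) := by gcongr; exact riemannianEDist_triangle
      _ = _ := by
          rw [he, riemannianEDist_comm (x := qk k)]
          ring
  · calc riemannianEDist (𝓡 n) (pk k) (qk k)
        ≤ riemannianEDist (𝓡 n) (pk k) p + riemannianEDist (𝓡 n) p (qk k) :=
          riemannianEDist_triangle
      _ ≤ riemannianEDist (𝓡 n) (pk k) p + (riemannianEDist (𝓡 n) p q +
          riemannianEDist (𝓡 n) q (qk k)) := by gcongr; exact riemannianEDist_triangle
      _ = _ := by
          rw [he, riemannianEDist_comm (x := pk k)]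
          ring

/-- Parallel fields exist along the minimizing geodesic, so for close points the default value 0 in
`transport` is not used. -/
lemma IsClose.isTransport {p q : M} (h : IsClose n p q) (w : TangentSpace (𝓡 n) p) :
    IsTransport p q w (transport q p w) := by
  have hex : ∃ w' : TangentSpace (𝓡 n) q, IsTransport p q w w' := by
    obtain ⟨⟨z, hz, -⟩, -⟩ := h
    obtain ⟨Y, hY0, hY⟩ := hz.1.exists_parallel ⟨p, w⟩ hz.2.1.symm
    have h1 : (Y 1).proj = q := by rw [(hY 1 (by simp)).1, hz.2.2.1]
    subst h1
    exact ⟨(Y 1).snd, z, Y, hz, hY, hY0, rfl⟩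
  rw [transport, dif_pos hex]
  exact hex.choose_spec

lemma tendsto_halfSqDist {ι : Type*} {l : Filter ι} {pk qk : ι → M} {p q : M}
    (hp : Tendsto pk l (𝓝 p)) (hq : Tendsto qk l (𝓝 q)) (h : IsClose n p q) :
    Tendsto (fun k => halfSqDist n (pk k) (qk k)) l (𝓝 (halfSqDist n p q)) :=
  (((ENNReal.tendsto_toReal h.riemannianEDist_ne_top).comp
    (tendsto_riemannianEDist hp hq h.riemannianEDist_ne_top)).pow 2).const_mul _

/-- Uniqueness of parallel transport is continuous dependence for a constant family: the constant
value converges to the other one, and `TM` is Hausdorff. -/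
lemma IsParallelOn.eq_of_eqOn [T2Space M] {z z' Y Y' : ℝ → TangentBundle (𝓡 n) M}
    (hz : IsGeodesic z) (hzz' : EqOn z' z (Icc 0 1)) (hY : IsParallelOn z Y (Icc 0 1))
    (hY' : IsParallelOn z' Y' (Icc 0 1)) (h0 : Y' 0 = Y 0) : Y' 1 = Y 1 := by
  have hY'' : IsParallelOn z Y' (Icc 0 1) := by
    intro t ht
    rw [← hzz' ht]
    exact hY' t ht
  have := (tendsto_geodesic_parallel (l := pure ()) (zk := fun _ : Unit => z) (Yk := fun _ => Y')
    hz hY (fun _ => hz) (fun _ => hY'') tendsto_const_nhds (by rw [h0]; exact tendsto_const_nhds)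
    1 (by simp)).2
  exact tendsto_nhds_unique tendsto_const_nhds this

/-- Bounded sequences of tangent vectors over convergent sequences of points have convergent
subsequences. -/
lemma exists_tendsto_subseq_of_enorm {ζ : ℕ → TangentBundle (𝓡 n) M} {p : M}
    (hp : Tendsto (fun k => (ζ k).proj) atTop (𝓝 p)) {d : ℝ≥0∞} (hd : d ≠ ⊤)
    (hζ : Tendsto (fun k => ‖(ζ k).snd‖ₑ) atTop (𝓝 d)) :
    ∃ w : TangentSpace (𝓡 n) p, ∃ φ : ℕ → ℕ, StrictMono φ ∧
      Tendsto (ζ ∘ φ) atTop (𝓝 (⟨p, w⟩ : TangentBundle (𝓡 n) M)) := by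
  have hps : p ∈ (chartAt (Euc n) p).source := mem_chart_source _ _
  obtain ⟨C, hC0, hC⟩ := eventually_norm_trivializationAt_lt (Euc n)
    (fun x : M => TangentSpace (𝓡 n) x) p
  have hsrc := hp.eventually ((chartAt (Euc n) p).open_source.mem_nhds hps)
  have hlt : ∀ᶠ k in atTop, ‖(ζ k).snd‖ₑ < d + 1 :=
    hζ.eventually_lt_const (ENNReal.lt_add_right hd one_ne_zero)
  have hbd : ∀ᶠ k in atTop, velCoord p (ζ k) ∈
      Metric.closedBall (0 : Euc n) (C * (d + 1).toReal) := by
    filter_upwards [hsrc, hlt, hp.eventually hC] with k h1 h2 h3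
    rw [mem_closedBall_zero_iff]
    have e1 : velCoord p (ζ k) =
        (trivializationAt (Euc n) (TangentSpace (𝓡 n)) p).continuousLinearMapAt ℝ
        (ζ k).proj (ζ k).snd := velCoord_eq p (ζ k).proj h1 (ζ k).snd
    rw [e1]
    refine (ContinuousLinearMap.le_opNorm _ _).trans ?_
    have h4 : ‖(ζ k).snd‖ ≤ (d + 1).toReal := by
      rw [← toReal_enorm]
      exact ENNReal.toReal_mono (by simp [hd]) h2.le
    exact mul_le_mul h3.le h4 (norm_nonneg _) hC0.le
  obtain ⟨a, -, φ, hφ, hlim⟩ := tendsto_subseq_of_frequently_bounded Metric.isBounded_closedBall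
    hbd.frequently
  refine ⟨(trivializationAt (Euc n) (TangentSpace (𝓡 n)) p).symmL ℝ p a, φ, hφ, ?_⟩
  have hpφ := hp.comp hφ.tendsto_atTop
  refine tendsto_of_bchart (c := p) hps (hφ.tendsto_atTop.eventually hsrc) ?_
  simp only [bchart_apply]
  rw [velCoord_symmL p p hps]
  exact ((posCoord_continuousAt hps).tendsto.comp hpφ).prodMk_nhds hlim

/-- Parallel transport along minimizing geodesics is continuous on pairs of close points. -/
theorem tendsto_transport [T2Space M] {pk qk : ℕ → M} {p q : M}
    {wk : ∀ k, TangentSpace (𝓡 n) (pk k)} {w : TangentSpace (𝓡 n) p}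
    (hw : Tendsto (fun k => (⟨pk k, wk k⟩ : TangentBundle (𝓡 n) M)) atTop (𝓝 ⟨p, w⟩))
    (hq : Tendsto qk atTop (𝓝 q)) (hk : ∀ k, IsClose n (pk k) (qk k)) (h : IsClose n p q) :
    Tendsto (fun k => (⟨qk k, transport (qk k) (pk k) (wk k)⟩ : TangentBundle (𝓡 n) M)) atTop
      (𝓝 ⟨q, transport q p w⟩) := by
  choose zk Yk hzk hYk hY0 hY1 using fun k => (hk k).isTransport (wk k)
  obtain ⟨z', Y', hz', hY', hY'0, hY'1⟩ := h.isTransport w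
  have hnorm : ∀ k, ∀ t ∈ Icc (0 : ℝ) 1,
      ‖(zk k t).snd‖ₑ = riemannianEDist (𝓡 n) (pk k) (qk k) := fun k => (hzk k).2.2.2
  -- It suffices that every subsequence has a further subsequence with the right limit.
  refine tendsto_of_subseq_tendsto fun ns hns => ?_
  have hp : Tendsto pk atTop (𝓝 p) := (continuous_bundleProj.tendsto _).comp hw
  have hd := (tendsto_riemannianEDist hp hq h.riemannianEDist_ne_top).comp hns
  have h01 : (0 : ℝ) ∈ Icc (0 : ℝ) 1 := by simp
  have h11 : (1 : ℝ) ∈ Icc (0 : ℝ) 1 := by simp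
  obtain ⟨v, φ, hφ, hlim⟩ := exists_tendsto_subseq_of_enorm (ζ := fun k => zk (ns k) 0) (p := p)
    (by simpa only [(hzk _).2.1, Function.comp_def] using hp.comp hns) h.riemannianEDist_ne_top
    (hd.congr fun k => (hnorm (ns k) 0 h01).symm)
  replace hlim : Tendsto (fun k => zk (ns (φ k)) 0) atTop
    (𝓝 (⟨p, v⟩ : TangentBundle (𝓡 n) M)) := hlim
  refine ⟨φ, ?_⟩
  have hψ : Tendsto (fun k => ns (φ k)) atTop atTop := hns.comp hφ.tendsto_atTop
  have hdψ : Tendsto (fun k => riemannianEDist (𝓡 n) (pk (ns (φ k))) (qk (ns (φ k)))) atTop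
    (𝓝 (riemannianEDist (𝓡 n) p q)) := hd.comp hφ.tendsto_atTop
  have hv : ‖v‖ₑ = riemannianEDist (𝓡 n) p q := by
    have h1 : Tendsto (fun k => ‖(zk (ns (φ k)) 0).snd‖ₑ) atTop (𝓝 ‖v‖ₑ) :=
      tendsto_enorm_snd (q := fun k => zk (ns (φ k)) 0) (p := ⟨p, v⟩) hlim
    exact tendsto_nhds_unique h1 (hdψ.congr fun k => (hnorm (ns (φ k)) 0 h01).symm)
  -- Here exp_p must be defined on the closed ball: the limit velocity has length exactly d(p, q),
  -- and a geodesic on all of [0, 1] is needed to compare with.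
  obtain ⟨z, hz, hz0⟩ := h.2 v hv.le
  obtain ⟨Y, hYz0, hY⟩ := hz.exists_parallel ⟨p, w⟩ (by rw [hz0])
  have hmain := tendsto_geodesic_parallel (l := atTop) (zk := fun k => zk (ns (φ k)))
    (Yk := fun k => Yk (ns (φ k))) hz hY (fun k => (hzk _).1) (fun k => hYk _)
    (by rw [hz0]; exact hlim) (by rw [hYz0]; simpa only [hY0, Function.comp_def] using hw.comp hψ)
  -- Endpoint and speed of the limit geodesic are limits of those of the approximating ones, so it
  -- is minimizing and uniqueness applies.
  have hmin : IsMinGeodesic p q z := by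
    refine ⟨hz, by rw [hz0], ?_, fun t ht => ?_⟩
    · refine tendsto_nhds_unique ((continuous_bundleProj.tendsto _).comp (hmain 1 h11).1) ?_
      simpa only [Function.comp_def, (hzk _).2.2.1] using hq.comp hψ
    · exact tendsto_nhds_unique (tendsto_enorm_snd (q := fun k => zk (ns (φ k)) t) (hmain t ht).1)
        (hdψ.congr fun k => (hnorm (ns (φ k)) t ht).symm)
  have heq : EqOn z' z (Icc 0 1) := by
    obtain ⟨⟨z'', -, hu⟩, -⟩ := h
    exact fun t ht => (hu z' hz' ht).trans (hu z hmin ht).symm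
  have h1 : Y' 1 = Y 1 := IsParallelOn.eq_of_eqOn hz heq hY hY' (by rw [hYz0, hY'0])
  rw [← hY'1, h1]
  simpa only [hY1] using (hmain 1 h11).2

end Transport

/-! ### The acceleration as an affine function of the control -/

section Forces

/-- The effect of the controls on the acceleration, in the chart around `c`. -/
def controlMap (f : Fin m → ∀ q : M, TangentSpace (𝓡 n) q) (c q : M) : Euc m →L[ℝ] Euc n :=
  ∑ j, (EuclideanSpace.proj j : Euc m →L[ℝ] ℝ).smulRight
    (velCoord c (⟨q, f j q⟩ : TangentBundle (𝓡 n) M))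

lemma controlMap_continuousAt {f : Fin m → ∀ q : M, TangentSpace (𝓡 n) q}
    (hf : ∀ j, ContMDiff (𝓡 n) (𝓡 n).tangent ∞
      (fun q => (⟨q, f j q⟩ : TangentBundle (𝓡 n) M))) {c q : M}
    (hq : q ∈ (chartAt (Euc n) c).source) : ContinuousAt (controlMap f c) q := by
  unfold controlMap
  refine tendsto_finsetSum _ fun j _ => ?_
  have h1 : ContinuousAt (fun q => velCoord c (⟨q, f j q⟩ : TangentBundle (𝓡 n) M)) q :=
    ContinuousAt.comp (g := velCoord c) (f := fun q => (⟨q, f j q⟩ : TangentBundle (𝓡 n) M))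
      (velCoord_continuousAt (p := ⟨q, f j q⟩) hq) (hf j).continuous.continuousAt
  exact ((ContinuousLinearMap.smulRightL ℝ (Euc m) (Euc n)
    (EuclideanSpace.proj j : Euc m →L[ℝ] ℝ)).continuous.continuousAt.comp h1)

variable [RiemannianBundle (fun x : M => TangentSpace (𝓡 n) x)]

lemma inner_grad (W : M → ℝ) (q : M) (v : TangentSpace (𝓡 n) q) :
    inner ℝ (grad W q) v = (mfderiv (𝓡 n) 𝓘(ℝ, ℝ) W q v : ℝ) := by
  have : FiniteDimensional ℝ (TangentSpace (𝓡 n) q) :=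
    inferInstanceAs (FiniteDimensional ℝ (Euc n))
  have : CompleteSpace (TangentSpace (𝓡 n) q) := FiniteDimensional.complete ℝ _
  rw [grad]
  exact InnerProductSpace.toDual_symm_apply

lemma mfderiv_apply_symmL {W : M → ℝ} (hW : ContMDiff (𝓡 n) 𝓘(ℝ, ℝ) ∞ W) {c q : M}
    (hq : q ∈ (chartAt (Euc n) c).source) (a : Euc n) :
    (mfderiv (𝓡 n) 𝓘(ℝ, ℝ) W q
      ((trivializationAt (Euc n) (TangentSpace (𝓡 n)) c).symmL ℝ q a) : ℝ) =
      fderiv ℝ (W ∘ (extChartAt (𝓡 n) c).symm) (posCoord c q) a := by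
  have hqt : posCoord c q ∈ (extChartAt (𝓡 n) c).target :=
    (extChartAt (𝓡 n) c).map_source (by rw [extChartAt_source]; exact hq)
  have hinv : (extChartAt (𝓡 n) c).symm (posCoord c q) = q :=
    (extChartAt (𝓡 n) c).left_inv (by rw [extChartAt_source]; exact hq)
  have h1 : HasMFDerivAt 𝓘(ℝ, Euc n) (𝓡 n) (extChartAt (𝓡 n) c).symm (posCoord c q)
      ((trivializationAt (Euc n) (TangentSpace (𝓡 n)) c).symmL ℝ q) := by
    rw [TangentBundle.symmL_trivializationAt hq, ModelWithCorners.range_eq_univ,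
      mfderivWithin_univ]
    have h := (mdifferentiableWithinAt_extChartAt_symm hqt)
    rw [ModelWithCorners.range_eq_univ, mdifferentiableWithinAt_univ] at h
    exact h.hasMFDerivAt
  have h2 : HasMFDerivAt (𝓡 n) 𝓘(ℝ, ℝ) W ((extChartAt (𝓡 n) c).symm (posCoord c q))
      (mfderiv (𝓡 n) 𝓘(ℝ, ℝ) W q) := by
    rw [hinv]
    exact ((hW q).mdifferentiableAt (by simp)).hasMFDerivAt
  have h3 := (h2.comp (posCoord c q) h1).hasFDerivAt
  exact (congrArg (fun A : Euc n →L[ℝ] ℝ => A a)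
    (HasFDerivAt.fderiv (E := Euc n) (F := ℝ) h3)).symm

/-- Pairing the gradient with the coordinate frame gives ∂W, and inverting the Gram matrix isolates
its components. This formula yields continuity of the gradient. -/
lemma velCoord_grad_apply {W : M → ℝ} (hW : ContMDiff (𝓡 n) 𝓘(ℝ, ℝ) ∞ W) {c q : M}
    (hq : q ∈ (chartAt (Euc n) c).source) (k : Fin n) :
    velCoord c (⟨q, grad W q⟩ : TangentBundle (𝓡 n) M) k =
      ∑ l, (gram c (posCoord c q))⁻¹ k l *
        fderiv ℝ (W ∘ (extChartAt (𝓡 n) c).symm) (posCoord c q) (EuclideanSpace.single l 1) := by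
  set X := velCoord c (⟨q, grad W q⟩ : TangentBundle (𝓡 n) M) with hX
  have hqt : posCoord c q ∈ (extChartAt (𝓡 n) c).target :=
    (extChartAt (𝓡 n) c).map_source (by rw [extChartAt_source]; exact hq)
  have h1 : (gram c (posCoord c q)).mulVec X.ofLp = fun l =>
      fderiv ℝ (W ∘ (extChartAt (𝓡 n) c).symm) (posCoord c q) (EuclideanSpace.single l 1) := by
    funext l
    rw [← mfderiv_apply_symmL hW hq, ← inner_grad, ← metricForm_velCoord hq, velCoord_symmL c q hq,
      metricForm_apply, Matrix.mulVec, dotProduct]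
    refine Finset.sum_congr rfl fun i _ => ?_
    rw [gram_symm]
    simp [hX]
  have h2 : (gram c (posCoord c q))⁻¹.mulVec ((gram c (posCoord c q)).mulVec X.ofLp) = X.ofLp := by
    rw [Matrix.mulVec_mulVec, Matrix.nonsing_inv_mul _
      (isUnit_iff_ne_zero.2 (gram_det_ne_zero c hqt)), Matrix.one_mulVec]
  rw [h1] at h2
  exact (congrFun h2 k).symm

/-- The uncontrolled part of the acceleration, in the chart around `c`. -/
def drift (W : M → ℝ) (c : M) (p : TangentBundle (𝓡 n) M) : Euc n :=
  -velCoord c (⟨p.proj, grad W p.proj⟩ : TangentBundle (𝓡 n) M) -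
    christoffelVec c (posCoord c p.proj) (velCoord c p) (velCoord c p)

/-- Affine dependence on the control is what allows weak limits of controls in the equation of
motion. -/
lemma acceleration_eq (W : M → ℝ) (f : Fin m → ∀ q : M, TangentSpace (𝓡 n) q) (c : M)
    (p : TangentBundle (𝓡 n) M) (hp : p.proj ∈ (chartAt (Euc n) c).source) (a : Euc m) :
    velCoord c (force W f a p.proj) -
      christoffelVec c (posCoord c p.proj) (velCoord c p) (velCoord c p) =
      drift W c p + controlMap f c p.proj a := by
  have h : velCoord c (force W f a p.proj) =
      -velCoord c (⟨p.proj, grad W p.proj⟩ : TangentBundle (𝓡 n) M) + controlMap f c p.proj a := by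
    rw [force, velCoord_eq c _ hp, map_add, map_neg, map_sum, velCoord_eq c _ hp, controlMap]
    congr 1
    simp only [map_smul, sum_apply, ContinuousLinearMap.smulRight_apply, velCoord_eq c _ hp]
    rfl
  rw [h, drift]
  abel

variable [IsContMDiffRiemannianBundle (𝓡 n) ∞ (Euc n) (fun x : M => TangentSpace (𝓡 n) x)]

lemma velCoord_grad_continuousAt {W : M → ℝ} (hW : ContMDiff (𝓡 n) 𝓘(ℝ, ℝ) ∞ W) {c q : M}
    (hq : q ∈ (chartAt (Euc n) c).source) :
    ContinuousAt (fun q => velCoord c (⟨q, grad W q⟩ : TangentBundle (𝓡 n) M)) q := by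
  have hqt : posCoord c q ∈ (extChartAt (𝓡 n) c).target :=
    (extChartAt (𝓡 n) c).map_source (by rw [extChartAt_source]; exact hq)
  have hnh := (isOpen_extChartAt_target c).mem_nhds hqt
  have hWc : ContDiffOn ℝ ∞ (W ∘ (extChartAt (𝓡 n) c).symm) (extChartAt (𝓡 n) c).target :=
    (hW.comp_contMDiffOn (contMDiffOn_extChartAt_symm c)).contDiffOn
  have hdW : ContinuousAt (fderiv ℝ (W ∘ (extChartAt (𝓡 n) c).symm)) (posCoord c q) :=
    ((hWc.fderiv_of_isOpen (isOpen_extChartAt_target c) (m := ∞)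
      (by simp)).continuousOn).continuousAt
      hnh
  have hpos := posCoord_continuousAt (n := n) hq
  have hcomp : ContinuousAt (fun q => (WithLp.toLp 2 fun k => ∑ l, (gram c (posCoord c q))⁻¹ k l *
      fderiv ℝ (W ∘ (extChartAt (𝓡 n) c).symm) (posCoord c q) (EuclideanSpace.single l 1) :
        Euc n)) q := by
    refine (PiLp.continuous_toLp 2 _).continuousAt.comp (continuousAt_pi.2 fun k => ?_)
    refine tendsto_finsetSum _ fun l _ => ?_
    refine ContinuousAt.mul (ContinuousAt.comp (g := fun y => (gram c y)⁻¹ k l)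
      ((gram_inv_contDiffOn c k l).continuousOn.continuousAt hnh) hpos) ?_
    exact (ContinuousAt.comp (g := fderiv ℝ (W ∘ (extChartAt (𝓡 n) c).symm)) hdW hpos).clm_apply
      continuousAt_const
  refine hcomp.congr ?_
  filter_upwards [(chartAt (Euc n) c).open_source.mem_nhds hq] with q' hq'
  ext k
  exact (velCoord_grad_apply hW hq' k).symm

lemma drift_continuousAt {W : M → ℝ} (hW : ContMDiff (𝓡 n) 𝓘(ℝ, ℝ) ∞ W) {c : M}
    {p : TangentBundle (𝓡 n) M} (hp : p.proj ∈ (chartAt (Euc n) c).source) :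
    ContinuousAt (drift W c) p := by
  have hproj : ContinuousAt (fun p : TangentBundle (𝓡 n) M => p.proj) p :=
    continuous_bundleProj.continuousAt
  have hv := velCoord_continuousAt hp
  have h1 : ContinuousAt (fun p : TangentBundle (𝓡 n) M => christoffelMap c (posCoord c p.proj))
      p :=
    ContinuousAt.comp (g := christoffelMap c) (christoffelMap_continuousAt hp)
      (ContinuousAt.comp (g := posCoord c) (posCoord_continuousAt hp) hproj)
  have h2 := (h1.clm_apply hv).clm_apply hv
  simp only [christoffelMap_apply] at h2
  exact (ContinuousAt.comp (g := fun q => velCoord c (⟨q, grad W q⟩ : TangentBundle (𝓡 n) M))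
    (velCoord_grad_continuousAt hW hp) hproj).neg.sub h2

end Forces

/-! ### Continuity and equicontinuity of trajectories -/

section Trajectories

variable [RiemannianBundle (fun x : M => TangentSpace (𝓡 n) x)]

lemma IsTrajectory.intervalIntegrable_and_eq {W : M → ℝ} {f : Fin m → ∀ q : M, TangentSpace (𝓡 n) q}
    {T : ℝ} {u : ℝ → Euc m} {z : ℝ → TangentBundle (𝓡 n) M} (h : IsTrajectory W f T u z) {c : M}
    {a b : ℝ} (ha : 0 ≤ a) (hab : a ≤ b) (hb : b ≤ T)
    (hc : ∀ t ∈ Icc a b, (z t).proj ∈ (chartAt (Euc n) c).source) :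
    IntervalIntegrable (fun t => drift W c (z t) + controlMap f c (z t).proj (u t)) volume a b ∧
      velCoord c (z b) = velCoord c (z a) +
        ∫ t in a..b, (drift W c (z t) + controlMap f c (z t).proj (u t)) := by
  obtain ⟨h1, h2⟩ := h.2 c a b ha hab hb hc
  have e : EqOn (fun t => velCoord c (force W f (u t) (z t).proj) -
        christoffelVec c (posCoord c (z t).proj) (velCoord c (z t)) (velCoord c (z t)))
      (fun t => drift W c (z t) + controlMap f c (z t).proj (u t)) (uIcc a b) := by
    intro t ht
    rw [uIcc_of_le hab] at ht
    exact acceleration_eq W f c (z t) (hc t ht) (u t)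
  rw [intervalIntegral.integral_congr e] at h2
  exact ⟨h1.congr (e.mono uIoc_subset_uIcc), h2⟩

lemma HasVelocityOn.continuousOn_proj {z : ℝ → TangentBundle (𝓡 n) M} {s : Set ℝ}
    (h : HasVelocityOn z s) : ContinuousOn (fun t => (z t).proj) s :=
  fun t ht => (h t ht).continuousWithinAt

/-- The equation of motion is imposed on compact time intervals spent in a chart; this turns a
neighbourhood of a time into such an interval, endpoints of [0, T] included. -/
lemma exists_Icc_mem_nhdsWithin {T t : ℝ} (ht : t ∈ Icc 0 T) {S : Set ℝ} (hS : S ∈ 𝓝[Icc 0 T] t) :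
    ∃ a b, 0 ≤ a ∧ a ≤ b ∧ b ≤ T ∧ t ∈ Icc a b ∧ Icc a b ∈ 𝓝[Icc 0 T] t ∧ Icc a b ⊆ S := by
  obtain ⟨δ, hδ, hδS⟩ := Metric.mem_nhdsWithin_iff.1 hS
  have h1 : max 0 (t - δ / 2) ≤ t := max_le ht.1 (by linarith)
  have h2 : t ≤ min T (t + δ / 2) := le_min ht.2 (by linarith)
  refine ⟨max 0 (t - δ / 2), min T (t + δ / 2), le_max_left _ _, h1.trans h2, min_le_left _ _,
    ⟨h1, h2⟩, ?_, fun s hs => hδS ⟨?_, (le_max_left _ _).trans hs.1, hs.2.trans (min_le_left _ _)⟩⟩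
  · refine mem_nhdsWithin.2 ⟨Ioo (t - δ / 2) (t + δ / 2), isOpen_Ioo,
      by constructor <;> linarith, ?_⟩
    rintro s ⟨hs, hs'⟩
    exact ⟨max_le hs'.1 hs.1.le, le_min hs'.2 hs.2.le⟩
  · have h3 := (le_max_right 0 (t - δ / 2)).trans hs.1
    have h4 := hs.2.trans (min_le_right T (t + δ / 2))
    rw [Metric.mem_ball, Real.dist_eq, abs_lt]
    constructor <;> linarith

/-- The base curve is differentiable, and the velocity components are locally primitives of
integrable functions. -/
lemma IsTrajectory.continuousOn {W : M → ℝ} {f : Fin m → ∀ q : M, TangentSpace (𝓡 n) q}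
    {T : ℝ} {u : ℝ → Euc m} {z : ℝ → TangentBundle (𝓡 n) M} (h : IsTrajectory W f T u z) :
    ContinuousOn z (Icc 0 T) := by
  intro t ht
  set c := (z t).proj with hc
  have hct : (z t).proj ∈ (chartAt (Euc n) c).source := mem_chart_source _ _
  obtain ⟨a, b, ha, hab, hb, htab, hnh, hsub⟩ := exists_Icc_mem_nhdsWithin ht
    ((h.1.continuousOn_proj t ht).preimage_mem_nhdsWithin
      ((chartAt (Euc n) c).open_source.mem_nhds hct))
  refine continuousWithinAt_of_velCoord hct (h.1.continuousOn_proj t ht) ?_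
  have hint := (h.intervalIntegrable_and_eq ha hab hb hsub).1
  have hprim : ContinuousOn (fun s => velCoord c (z a) +
      ∫ t in a..s, (drift W c (z t) + controlMap f c (z t).proj (u t))) (Icc a b) := by
    refine continuousOn_const.add ?_
    have := intervalIntegral.continuousOn_primitive_interval' hint (left_mem_uIcc)
    rwa [uIcc_of_le hab] at this
  have heq : ∀ s ∈ Icc a b, velCoord c (z s) = velCoord c (z a) +
      ∫ t in a..s, (drift W c (z t) + controlMap f c (z t).proj (u t)) := fun s hs =>
    (h.intervalIntegrable_and_eq ha hs.1 (hs.2.trans hb)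
      (fun τ hτ => hsub ⟨hτ.1, hτ.2.trans hs.2⟩)).2
  exact ((hprim.congr heq) t htab).mono_of_mem_nhdsWithin hnh

variable [IsContMDiffRiemannianBundle (𝓡 n) ∞ (Euc n) (fun x : M => TangentSpace (𝓡 n) x)]

/-- Trajectories with bounded control energy are equicontinuous near each point of `TM`. -/
lemma exists_local_equicontinuity [T2Space M] {W : M → ℝ} (hW : ContMDiff (𝓡 n) 𝓘(ℝ, ℝ) ∞ W)
    {f : Fin m → ∀ q : M, TangentSpace (𝓡 n) q}
    (hf : ∀ j, ContMDiff (𝓡 n) (𝓡 n).tangent ∞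
      (fun q => (⟨q, f j q⟩ : TangentBundle (𝓡 n) M))) {R : ℝ} (hR : 0 ≤ R)
    (ζ : TangentBundle (𝓡 n) M) {N : Set (TangentBundle (𝓡 n) M)} (hN : N ∈ 𝓝 ζ) :
    ∃ V ∈ 𝓝 ζ, ∃ δ > 0, ∀ (T : ℝ) (u : ℝ → Euc m) (z : ℝ → TangentBundle (𝓡 n) M),
      IsTrajectory W f T u z → MemLp u 2 (volume.restrict (Icc 0 T)) →
      ∫ t in Icc 0 T, ‖u t‖ ^ 2 ≤ R → ∀ s ∈ Icc 0 T, ∀ t ∈ Icc 0 T, s ≤ t → t - s < δ →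
      z s ∈ V → z t ∈ N := by
  set c := ζ.proj with hc
  have hζ : ζ.proj ∈ (chartAt (Euc n) c).source := mem_chart_source _ _
  have hζ' : ζ ∈ (bchart (n := n) c).source := by rw [bchart_source]; exact hζ
  set Ψ := bchart (n := n) c with hΨ
  set y₀ := Ψ ζ with hy₀
  set B := max (max (‖drift W c ζ‖ + 1) (‖controlMap f c ζ.proj‖ + 1)) (‖velCoord c ζ‖ + 1) with hB
  have hB0 : 0 < B := lt_max_of_lt_right (by positivity)
  have hbd : ∀ᶠ p in 𝓝 ζ, ‖drift W c p‖ ≤ B ∧ ‖controlMap f c p.proj‖ ≤ B ∧ ‖velCoord c p‖ ≤ B := by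
    have h1 := (drift_continuousAt hW hζ).norm.eventually_lt_const (lt_add_one _)
    have h2 := (ContinuousAt.comp (g := controlMap f c) (controlMap_continuousAt hf hζ)
      continuous_bundleProj.continuousAt).norm.eventually_lt_const (lt_add_one _)
    have h3 := (velCoord_continuousAt hζ).norm.eventually_lt_const (lt_add_one _)
    filter_upwards [h1, h2, h3] with p h1 h2 h3
    exact ⟨h1.le.trans ((le_max_left _ _).trans (le_max_left _ _)),
      h2.le.trans ((le_max_right _ _).trans (le_max_left _ _)), h3.le.trans (le_max_right _ _)⟩
  have hymem : y₀ ∈ Ψ.target := Ψ.map_source hζ'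
  have hpre : Ψ.symm ⁻¹' (N ∩ {p | ‖drift W c p‖ ≤ B ∧ ‖controlMap f c p.proj‖ ≤ B ∧
      ‖velCoord c p‖ ≤ B}) ∈ 𝓝 y₀ := by
    refine (Ψ.continuousAt_symm hymem).preimage_mem_nhds ?_
    rw [hy₀, Ψ.left_inv hζ']
    exact inter_mem hN hbd
  obtain ⟨r, hr, hrS⟩ := Metric.nhds_basis_closedBall.mem_iff.1
    (inter_mem hpre (Ψ.open_target.mem_nhds hymem))
  set C := Ψ.source ∩ Ψ ⁻¹' Metric.closedBall y₀ r with hCdef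
  set U := Ψ.source ∩ Ψ ⁻¹' Metric.ball y₀ r with hUdef
  have hUC : U ⊆ C := inter_subset_inter_right _ (preimage_mono Metric.ball_subset_closedBall)
  have hCN : ∀ p ∈ C, p ∈ N ∧ ‖drift W c p‖ ≤ B ∧ ‖controlMap f c p.proj‖ ≤ B ∧
      ‖velCoord c p‖ ≤ B := by
    rintro p ⟨hp1, hp2⟩
    have := (hrS hp2).1
    rwa [mem_preimage, Ψ.left_inv hp1] at this
  have hsrc : ∀ p ∈ C, p.proj ∈ (chartAt (Euc n) c).source := by
    rintro p ⟨hp, -⟩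
    rw [hΨ, bchart_source (n := n)] at hp
    exact hp
  -- Young's inequality |u| ≤ η|u|² + 1/(4η) bounds the change of velocity by A(t - s) + BηR. This η
  -- gives BηR ≤ r/8 (R + 1 avoids division by zero), and δ = r/(8A) gives A(t - s) ≤ r/8. The
  -- displacement is at most r/4, which keeps a start in the ball of radius r/2 inside the one of
  -- radius r.
  set η := r / (8 * B * (R + 1)) with hη
  have hη0 : 0 < η := by positivity
  set A := B + B * (1 / (4 * η)) with hA
  have hA0 : 0 < A := by positivity
  refine ⟨Ψ.source ∩ Ψ ⁻¹' Metric.ball y₀ (r / 2),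
    (Ψ.isOpen_inter_preimage Metric.isOpen_ball).mem_nhds
    ⟨hζ', Metric.mem_ball_self (by positivity)⟩, r / (8 * A), by positivity, ?_⟩
  intro T u z hz hu huR s hs t ht hst hδ hzs
  have hsub : Icc s t ⊆ Icc 0 T := Icc_subset_Icc hs.1 ht.2
  have hsqint : Integrable (fun t => ‖u t‖ ^ 2) (volume.restrict (Icc 0 T)) :=
    hu.integrable_norm_pow (by norm_num)
  have hstep : ∀ τ ∈ Icc s t, (∀ σ ∈ Icc s τ, z σ ∈ C) → z τ ∈ U := by
    intro τ hτ hσ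
    have hτsub : Icc s τ ⊆ Icc 0 T := (Icc_subset_Icc_right hτ.2).trans hsub
    have hτδ : τ - s < r / (8 * A) := by linarith [hτ.2]
    have hpos : ‖posCoord (n := n) c (z τ).proj - posCoord c (z s).proj‖ ≤ B * (τ - s) := by
      refine norm_image_sub_le_of_norm_deriv_le_segment' (f := fun t => posCoord c (z t).proj)
        (fun σ h => (posCoord_hasDerivWithinAt (hz.1 σ (hτsub h)) c
          (hsrc _ (hσ σ h))).mono hτsub) (fun σ h => ?_) τ ⟨hτ.1, le_rfl⟩
      exact (hCN _ (hσ σ (Ico_subset_Icc_self h))).2.2.2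
    obtain ⟨-, hv⟩ := hz.intervalIntegrable_and_eq (c := c) hs.1 hτ.1 (hτ.2.trans ht.2)
      (fun σ h => hsrc _ (hσ σ h))
    have hgint : IntervalIntegrable (fun σ => A + B * η * ‖u σ‖ ^ 2) volume s τ := by
      refine intervalIntegrable_const.add (IntervalIntegrable.const_mul ?_ _)
      rw [intervalIntegrable_iff_integrableOn_Icc_of_le hτ.1]
      exact IntegrableOn.mono_set hsqint hτsub
    have hvel : ‖velCoord c (z τ) - velCoord c (z s)‖ ≤ A * (τ - s) + B * η * R := by
      rw [hv, add_sub_cancel_left]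
      refine (intervalIntegral.norm_integral_le_of_norm_le hτ.1
        (Eventually.of_forall fun σ h => ?_) hgint).trans ?_
      · have h' := hCN _ (hσ σ (Ioc_subset_Icc_self h))
        have h2 : ‖u σ‖ ≤ η * ‖u σ‖ ^ 2 + 1 / (4 * η) := by
          have h3 : η * ‖u σ‖ ^ 2 + 1 / (4 * η) - ‖u σ‖ = η * (‖u σ‖ - 1 / (2 * η)) ^ 2 := by
            field_simp
            ring
          have : 0 ≤ η * (‖u σ‖ - 1 / (2 * η)) ^ 2 := by positivity
          linarith
        calc ‖drift W c (z σ) + controlMap f c (z σ).proj (u σ)‖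
            ≤ ‖drift W c (z σ)‖ + ‖controlMap f c (z σ).proj‖ * ‖u σ‖ :=
              (norm_add_le _ _).trans (by gcongr; exact ContinuousLinearMap.le_opNorm _ _)
          _ ≤ B + B * (η * ‖u σ‖ ^ 2 + 1 / (4 * η)) := by
              gcongr
              · exact h'.2.1
              · exact h'.2.2.1
          _ = _ := by rw [hA]; ring
      · rw [intervalIntegral.integral_add intervalIntegrable_const (by
          refine IntervalIntegrable.const_mul ?_ _
          rw [intervalIntegrable_iff_integrableOn_Icc_of_le hτ.1]
          exact IntegrableOn.mono_set hsqint hτsub), intervalIntegral.integral_const,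
          intervalIntegral.integral_const_mul, smul_eq_mul]
        have h3 : ∫ x in s..τ, ‖u x‖ ^ 2 ≤ R := by
          rw [intervalIntegral.integral_of_le hτ.1]
          refine le_trans (setIntegral_mono_set hsqint (Eventually.of_forall fun _ => by positivity)
            (LE.le.eventuallyLE (Ioc_subset_Icc_self.trans hτsub))) huR
        have : B * η * ∫ x in s..τ, ‖u x‖ ^ 2 ≤ B * η * R := by gcongr
        linarith
    have hA1 : A * (τ - s) ≤ r / 8 := by
      calc A * (τ - s) ≤ A * (r / (8 * A)) := by gcongr
        _ = r / 8 := by field_simp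
    have hBA : B * (τ - s) ≤ A * (τ - s) := by
      have : 0 ≤ τ - s := by linarith [hτ.1]
      have : B ≤ A := by rw [hA]; linarith [show 0 < B * (1 / (4 * η)) by positivity]
      gcongr
    have hηR : B * η * R ≤ r / 8 := by
      rw [hη]
      have : B * (r / (8 * B * (R + 1))) * R = (r / 8) * (R / (R + 1)) := by field_simp
      rw [this]
      have h4 : R / (R + 1) ≤ 1 := by rw [div_le_one (by positivity)]; linarith
      nlinarith
    have hsC : Ψ (z s) ∈ Metric.ball y₀ (r / 2) := hzs.2
    refine ⟨(hσ τ ⟨hτ.1, le_rfl⟩).1, ?_⟩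
    have hd : dist (Ψ (z τ)) (Ψ (z s)) ≤ r / 4 := by
      rw [hΨ, bchart_apply, bchart_apply, Prod.dist_eq, dist_eq_norm, dist_eq_norm]
      exact max_le (by linarith) (by linarith)
    rw [Metric.mem_ball] at hsC
    exact lt_of_le_of_lt (dist_triangle _ (Ψ (z s)) _) (by linarith)
  have hU := mapsTo_of_continuation (Ψ.isOpen_inter_preimage Metric.isOpen_ball)
    (isClosed_source_inter_preimage_closedBall Ψ (fun p hp => (hrS hp).2)) hUC
    (hz.continuousOn.mono hsub)
    ⟨hzs.1, Metric.ball_subset_ball (by linarith) hzs.2⟩ hstep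
  exact (hCN _ (hUC (hU t ⟨hst, le_rfl⟩))).1

end Trajectories

/-! ### Compactness of the set of trajectories -/

section Compactness

variable [RiemannianBundle (fun x : M => TangentSpace (𝓡 n) x)]
variable [IsContMDiffRiemannianBundle (𝓡 n) ∞ (Euc n) (fun x : M => TangentSpace (𝓡 n) x)]

/-- Locally uniform convergence on `[0, T]`, expressed through the topology of the target. -/
def ConvergesOn {X : Type*} [TopologicalSpace X] (T : ℝ) (z : ℕ → ℝ → X) (zlim : ℝ → X) : Prop :=
  ∀ a b, 0 ≤ a → b ≤ T → ∀ O : Set X, IsOpen O → MapsTo zlim (Icc a b) O →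
    ∀ᶠ k in atTop, MapsTo (z k) (Icc a b) O

lemma ConvergesOn.tendsto {X : Type*} [TopologicalSpace X] {T : ℝ} {z : ℕ → ℝ → X} {zlim : ℝ → X}
    (h : ConvergesOn T z zlim) {t : ℝ} (ht : t ∈ Icc 0 T) :
    Tendsto (fun k => z k t) atTop (𝓝 (zlim t)) := by
  refine tendsto_nhds.2 fun O hO hz => ?_
  filter_upwards [h t t ht.1 ht.2 O hO (by rintro s ⟨h1, h2⟩; rwa [le_antisymm h2 h1])] with k hk
  exact hk ⟨le_rfl, le_rfl⟩

lemma ConvergesOn.comp_tendsto {X : Type*} [TopologicalSpace X] {T : ℝ} {z : ℕ → ℝ → X}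
    {zlim : ℝ → X} (h : ConvergesOn T z zlim) {φ : ℕ → ℕ} (hφ : Tendsto φ atTop atTop) :
    ConvergesOn T (fun k => z (φ k)) zlim :=
  fun a b ha hb O hO hz => hφ.eventually (h a b ha hb O hO hz)

/-- Compactness of the set of trajectories with bounded control energy that stay in a compact
set. -/
lemma exists_subseq_convergesOn [T2Space M] [SecondCountableTopology M] {W : M → ℝ}
    (hW : ContMDiff (𝓡 n) 𝓘(ℝ, ℝ) ∞ W) {f : Fin m → ∀ q : M, TangentSpace (𝓡 n) q}
    (hf : ∀ j, ContMDiff (𝓡 n) (𝓡 n).tangent ∞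
      (fun q => (⟨q, f j q⟩ : TangentBundle (𝓡 n) M))) {R : ℝ} (hR : 0 ≤ R)
    {K : Set (TangentBundle (𝓡 n) M)} (hK : IsCompact K) {T : ℝ} (hT : 0 ≤ T)
    {u : ℕ → ℝ → Euc m} {z : ℕ → ℝ → TangentBundle (𝓡 n) M}
    (hz : ∀ k, IsTrajectory W f T (u k) (z k))
    (hu : ∀ k, MemLp (u k) 2 (volume.restrict (Icc 0 T)))
    (huR : ∀ k, ∫ t in Icc 0 T, ‖u k t‖ ^ 2 ≤ R) (hzK : ∀ k, ∀ t ∈ Icc 0 T, z k t ∈ K) :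
    ∃ φ : ℕ → ℕ, StrictMono φ ∧ ∃ zlim : ℝ → TangentBundle (𝓡 n) M,
      ContinuousOn zlim (Icc 0 T) ∧ (∀ t ∈ Icc 0 T, zlim t ∈ K) ∧
      ConvergesOn T (fun k => z (φ k)) zlim := by
  -- Any metric inducing the topology will do; it is unrelated to the Riemannian distance.
  let _ : MetricSpace (TangentBundle (𝓡 n) M) := TopologicalSpace.metrizableSpaceMetric _
  let F : ℕ → BoundedContinuousFunction (Icc 0 T) (TangentBundle (𝓡 n) M) := fun k =>
    BoundedContinuousFunction.mkOfCompact
      ⟨(Icc 0 T).domRestrict (z k), (hz k).continuousOn.domRestrict⟩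
  have hunif : ∀ ε > 0, ∃ δ > 0, ∀ k, ∀ s ∈ Icc 0 T, ∀ t ∈ Icc 0 T, s ≤ t → t - s < δ →
      z k s ∈ K → dist (z k s) (z k t) < ε := by
    intro ε hε
    -- The local moduli of continuity are merged into one over a finite cover of `K`.
    refine hK.induction_on (p := fun S => ∃ δ > 0, ∀ k, ∀ s ∈ Icc 0 T, ∀ t ∈ Icc 0 T, s ≤ t →
      t - s < δ → z k s ∈ S → dist (z k s) (z k t) < ε) ⟨1, one_pos, by simp⟩ ?_ ?_ ?_
    · rintro S S' hSS ⟨δ, hδ, h⟩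
      exact ⟨δ, hδ, fun k s hs t ht hst hd hS => h k s hs t ht hst hd (hSS hS)⟩
    · rintro S S' ⟨δ, hδ, h⟩ ⟨δ', hδ', h'⟩
      refine ⟨min δ δ', lt_min hδ hδ', fun k s hs t ht hst hd hS => hS.elim
        (h k s hs t ht hst (hd.trans_le (min_le_left _ _)))
        (h' k s hs t ht hst (hd.trans_le (min_le_right _ _)))⟩
    · intro ζ _
      obtain ⟨V, hV, δ, hδ, h⟩ := exists_local_equicontinuity hW hf hR ζ
        (Metric.ball_mem_nhds ζ (half_pos hε))
      refine ⟨V ∩ Metric.ball ζ (ε / 2), mem_nhdsWithin_of_mem_nhds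
        (inter_mem hV (Metric.ball_mem_nhds ζ (half_pos hε))), δ, hδ, ?_⟩
      intro k s hs t ht hst hd hS
      have h1 := Metric.mem_ball.1 (h T (u k) (z k) (hz k) (hu k) (huR k) s hs t ht hst hd hS.1)
      have h2 := Metric.mem_ball.1 hS.2
      calc dist (z k s) (z k t) ≤ dist (z k s) ζ + dist (z k t) ζ := dist_triangle_right _ _ _
        _ < ε := by linarith
  have hcomp : IsCompact (closure (range F)) := by
    refine BoundedContinuousFunction.arzela_ascoli K hK (range F) ?_ ?_
    · rintro _ x ⟨k, rfl⟩
      exact hzK k x x.2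
    · intro x
      rw [Metric.equicontinuousAt_iff]
      intro ε hε
      obtain ⟨δ, hδ, h⟩ := hunif ε hε
      refine ⟨δ, hδ, ?_⟩
      rintro y hy ⟨_, k, rfl⟩
      change dist (z k x) (z k y) < ε
      rw [Subtype.dist_eq, Real.dist_eq, abs_lt] at hy
      rcases le_total (x : ℝ) y with hxy | hxy
      · exact h k x x.2 y y.2 hxy (by linarith) (hzK k x x.2)
      · rw [dist_comm]
        exact h k y y.2 x x.2 hxy (by linarith) (hzK k y y.2)
  obtain ⟨G, -, φ, hφ, hG⟩ := hcomp.tendsto_subseq (x := F) fun k => subset_closure ⟨k, rfl⟩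
  have hGt : ∀ x : Icc 0 T, Tendsto (fun k => z (φ k) x) atTop (𝓝 (G x)) := fun x =>
    ((BoundedContinuousFunction.tendsto_iff_tendstoUniformly.1 hG).tendsto_at x)
  -- The limit is extended from [0, T] to the line by its constant end values.
  refine ⟨φ, hφ, fun t => G (projIcc 0 T hT t),
    (G.continuous.comp continuous_projIcc).continuousOn, ?_, ?_⟩
  · intro t ht
    simp only [projIcc_of_mem hT ht]
    exact hK.isClosed.mem_of_tendsto (hGt ⟨t, ht⟩) (Eventually.of_forall fun k => hzK _ t ht)
  · intro a b ha hb O hO hzO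
    have hsub : Icc a b ⊆ Icc 0 T := Icc_subset_Icc ha hb
    have hcpt : IsCompact ((fun t => G (projIcc 0 T hT t)) '' Icc a b) :=
      isCompact_Icc.image (G.continuous.comp continuous_projIcc)
    -- An open set around the compact image of the limit contains an ε-thickening of it, so uniform
    -- convergence gives the metric-free notion `ConvergesOn`.
    obtain ⟨ε, hε, hεO⟩ := hcpt.exists_thickening_subset_open hO hzO.image_subset
    have := Metric.tendstoUniformly_iff.1
      (BoundedContinuousFunction.tendsto_iff_tendstoUniformly.1 hG) ε hε
    filter_upwards [this] with k hk t ht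
    have h1 := hk ⟨t, hsub ht⟩
    refine hεO (Metric.mem_thickening_iff.2 ⟨_, mem_image_of_mem _ ht, ?_⟩)
    rw [dist_comm]
    simp only [projIcc_of_mem hT (hsub ht)]
    exact h1

end Compactness

/-! ### Weak convergence in L² -/

section WeakConvergence

/-- Weak convergence in `L²(μ)`. -/
def WeaklyTendsto (μ : Measure ℝ) (u : ℕ → ℝ → Euc m) (ulim : ℝ → Euc m) : Prop :=
  ∀ g : ℝ → Euc m, MemLp g 2 μ →
    Tendsto (fun k => ∫ t, inner ℝ (g t) (u k t) ∂μ) atTop (𝓝 (∫ t, inner ℝ (g t) (ulim t) ∂μ))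

lemma WeaklyTendsto.comp_tendsto {μ : Measure ℝ} {u : ℕ → ℝ → Euc m} {ulim : ℝ → Euc m}
    (h : WeaklyTendsto μ u ulim) {φ : ℕ → ℕ} (hφ : Tendsto φ atTop atTop) :
    WeaklyTendsto μ (fun k => u (φ k)) ulim :=
  fun g hg => (h g hg).comp hφ

lemma inner_toLp {μ : Measure ℝ} {g u : ℝ → Euc m} (hg : MemLp g 2 μ) (hu : MemLp u 2 μ) :
    inner ℝ (hg.toLp g) (hu.toLp u) = ∫ t, inner ℝ (g t) (u t) ∂μ := by
  rw [L2.inner_def]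
  refine integral_congr_ae ?_
  filter_upwards [hg.coeFn_toLp, hu.coeFn_toLp] with t h1 h2
  rw [h1, h2]

lemma norm_toLp_sq {μ : Measure ℝ} {u : ℝ → Euc m} (hu : MemLp u 2 μ) :
    ‖hu.toLp u‖ ^ 2 = ∫ t, ‖u t‖ ^ 2 ∂μ := by
  rw [← real_inner_self_eq_norm_sq, inner_toLp hu hu]
  simp only [real_inner_self_eq_norm_sq]

/-- Bounded sequences in `L²(μ)` have weakly convergent subsequences. -/
lemma exists_subseq_weaklyTendsto {μ : Measure ℝ} [SFinite μ] {u : ℕ → ℝ → Euc m}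
    (hu : ∀ k, MemLp (u k) 2 μ) {R : ℝ} (hR : ∀ k, ∫ t, ‖u k t‖ ^ 2 ∂μ ≤ R) :
    ∃ φ : ℕ → ℕ, StrictMono φ ∧ ∃ ulim : ℝ → Euc m, MemLp ulim 2 μ ∧
      WeaklyTendsto μ (fun k => u (φ k)) ulim := by
  have : Fact ((2 : ℝ≥0∞) ≠ ⊤) := ⟨by simp⟩
  let H := Lp (Euc m) 2 μ
  -- Via the Riesz isomorphism, weak compactness in L² becomes weak-* sequential compactness of a
  -- ball in the dual of a separable space.
  let x : ℕ → WeakDual ℝ H := fun k =>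
    StrongDual.toWeakDual (InnerProductSpace.toDual ℝ H ((hu k).toLp (u k)))
  have hx : ∀ k, x k ∈ WeakDual.toStrongDual ⁻¹' Metric.closedBall (0 : StrongDual ℝ H) (√R) := by
    intro k
    rw [mem_preimage, mem_closedBall_zero_iff]
    change ‖InnerProductSpace.toDual ℝ H ((hu k).toLp (u k))‖ ≤ √R
    rw [LinearIsometryEquiv.norm_map]
    refine Real.le_sqrt_of_sq_le ?_
    rw [norm_toLp_sq]
    exact hR k
  obtain ⟨a, -, φ, hφ, ha⟩ := WeakDual.isSeqCompact_closedBall ℝ _ (0 : StrongDual ℝ H) (√R) hx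
  let U : H := (InnerProductSpace.toDual ℝ H).symm (WeakDual.toStrongDual a)
  refine ⟨φ, hφ, U, Lp.memLp U, fun g hg => ?_⟩
  have h1 := ((WeakDual.eval_continuous (hg.toLp g)).tendsto a).comp ha
  have h2 : ∀ k, x (φ k) (hg.toLp g) = ∫ t, inner ℝ (g t) (u (φ k) t) ∂μ := fun k => by
    rw [← inner_toLp hg (hu (φ k)), real_inner_comm]
    exact InnerProductSpace.toDual_apply_apply
  have h3 : a (hg.toLp g) = ∫ t, inner ℝ (g t) (U t) ∂μ := by
    have h4 : a (hg.toLp g) = inner ℝ U (hg.toLp g) :=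
      InnerProductSpace.toDual_symm_apply.symm
    rw [h4, real_inner_comm, ← inner_toLp hg (Lp.memLp U), Lp.toLp_coeFn]
  rw [← h3]
  exact h1.congr h2

/-- Expand 0 ≤ ‖u_k - u‖²; the cross term converges to -2‖u‖² by testing against the limit. -/
lemma WeaklyTendsto.integral_norm_sq_le {μ : Measure ℝ} {u : ℕ → ℝ → Euc m} {ulim : ℝ → Euc m}
    (h : WeaklyTendsto μ u ulim) (hu : ∀ k, MemLp (u k) 2 μ) (hlim : MemLp ulim 2 μ) {E : ℝ}
    (hE : Tendsto (fun k => ∫ t, ‖u k t‖ ^ 2 ∂μ) atTop (𝓝 E)) :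
    ∫ t, ‖ulim t‖ ^ 2 ∂μ ≤ E := by
  have h1 := h ulim hlim
  simp only [real_inner_self_eq_norm_sq] at h1
  have h2 : ∀ k, 0 ≤ (∫ t, ‖u k t‖ ^ 2 ∂μ) - 2 * (∫ t, inner ℝ (ulim t) (u k t) ∂μ) +
      ∫ t, ‖ulim t‖ ^ 2 ∂μ := by
    intro k
    rw [← norm_toLp_sq (hu k), ← norm_toLp_sq hlim, ← inner_toLp hlim (hu k), real_inner_comm,
      ← norm_sub_sq_real]
    positivity
  have h3 := ge_of_tendsto' ((hE.sub (h1.const_mul 2)).add_const _) h2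
  linarith

/-- Pointwise closed convex constraints are preserved by weak convergence in `L²(μ)`. -/
lemma WeaklyTendsto.ae_mem {μ : Measure ℝ} {u : ℕ → ℝ → Euc m} {ulim : ℝ → Euc m}
    (h : WeaklyTendsto μ u ulim) (hu : ∀ k, MemLp (u k) 2 μ) (hlim : MemLp ulim 2 μ)
    {Ω : Set (Euc m)} (hΩ : IsClosed Ω) (hΩc : Convex ℝ Ω) (huΩ : ∀ k, ∀ᵐ t ∂μ, u k t ∈ Ω) :
    ∀ᵐ t ∂μ, ulim t ∈ Ω := by
  let C : Set (Lp (Euc m) 2 μ) := {V | ∀ᵐ t ∂μ, V t ∈ Ω}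
  have hCc : Convex ℝ C := by
    intro V hV V' hV' a b ha hb hab
    change ∀ᵐ t ∂μ, (a • V + b • V') t ∈ Ω
    filter_upwards [hV, hV', Lp.coeFn_add (a • V) (b • V'), Lp.coeFn_smul a V,
      Lp.coeFn_smul b V'] with t h1 h2 h3 h4 h5
    rw [h3, Pi.add_apply, h4, h5]
    exact hΩc h1 h2 ha hb hab
  have hCl : IsClosed C := by
    refine IsSeqClosed.isClosed fun V V' hV hVV' => ?_
    obtain ⟨ns, -, hns⟩ := (tendstoInMeasure_of_tendsto_Lp hVV').exists_seq_tendsto_ae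
    -- Convergence in L² implies almost everywhere convergence of a subsequence, and Ω is closed.
    change ∀ᵐ t ∂μ, V' t ∈ Ω
    filter_upwards [hns, ae_all_iff.2 hV] with t h1 h2
    exact hΩ.mem_of_tendsto h1 (Eventually.of_forall fun k => h2 (ns k))
  have hmem : ∀ k, (hu k).toLp (u k) ∈ C := fun k => by
    change ∀ᵐ t ∂μ, (hu k).toLp (u k) t ∈ Ω
    filter_upwards [huΩ k, (hu k).coeFn_toLp] with t h1 h2
    rwa [h2]
  -- `V` is the projection of the weak limit onto the closed convex set. With D the limit minus `V`,
  -- the variational inequality ⟨D, u_k - V⟩ ≤ 0 passes to the limit and gives ‖D‖² ≤ 0.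
  obtain ⟨V, hV, hVmin⟩ := exists_norm_eq_iInf_of_complete_convex ⟨_, hmem 0⟩ hCl.isComplete hCc
    (hlim.toLp ulim)
  have hinner := (norm_eq_iInf_iff_real_inner_le_zero hCc hV).1 hVmin
  set D := hlim.toLp ulim - V with hD
  have h1 : Tendsto (fun k => inner ℝ D ((hu k).toLp (u k) - V)) atTop (𝓝 (inner ℝ D D)) := by
    have h2 := h D (Lp.memLp D)
    simp only [inner_sub_right]
    rw [hD, inner_sub_right, ← hD]
    refine Tendsto.sub_const ?_ _
    have e : ∀ (v : ℝ → Euc m) (hv : MemLp v 2 μ),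
        inner ℝ D (hv.toLp v) = ∫ t, inner ℝ (D t) (v t) ∂μ := fun v hv => by
      rw [← inner_toLp (Lp.memLp D) hv, Lp.toLp_coeFn]
    rw [e]
    simp only [e]
    exact h2
  have h2 : inner ℝ D D ≤ 0 := le_of_tendsto' h1 fun k => hinner _ (hmem k)
  have h3 : hlim.toLp ulim = V := sub_eq_zero.1 (real_inner_self_nonpos.1 h2)
  filter_upwards [hV, hlim.coeFn_toLp] with t h4 h5
  rw [← h5, h3]
  exact h4

/-- The product of a strongly and a weakly convergent sequence converges in the mean. -/
lemma WeaklyTendsto.tendsto_integral_clm {μ : Measure ℝ} [IsFiniteMeasure μ] {u : ℕ → ℝ → Euc m}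
    {ulim : ℝ → Euc m} (h : WeaklyTendsto μ u ulim) (hu : ∀ k, MemLp (u k) 2 μ)
    (hlim : MemLp ulim 2 μ) {R : ℝ} (hR : ∀ k, ∫ t, ‖u k t‖ ^ 2 ∂μ ≤ R)
    {A : ℕ → ℝ → Euc m →L[ℝ] Euc n} {Alim : ℝ → Euc m →L[ℝ] Euc n} {B : ℝ}
    (hA : ∀ᶠ k in atTop, AEStronglyMeasurable (A k) μ ∧ ∀ᵐ t ∂μ, ‖A k t‖ ≤ B)
    (hAm : AEStronglyMeasurable Alim μ) (hAB : ∀ᵐ t ∂μ, ‖Alim t‖ ≤ B)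
    (hconv : ∀ᵐ t ∂μ, Tendsto (fun k => A k t) atTop (𝓝 (Alim t))) :
    Tendsto (fun k => ∫ t, A k t (u k t) ∂μ) atTop (𝓝 (∫ t, Alim t (ulim t) ∂μ)) := by
  have hmul : ∀ (G : ℝ → Euc m →L[ℝ] Euc n) (C : ℝ) (v : ℝ → Euc m), AEStronglyMeasurable G μ →
      (∀ᵐ t ∂μ, ‖G t‖ ≤ C) → MemLp v 2 μ → Integrable (fun t => G t (v t)) μ := by
    intro G C v hG hGC hv
    refine Integrable.mono' ((hv.integrable (by norm_num)).norm.const_mul C)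
      (isBoundedBilinearMap_apply.continuous.comp_aestronglyMeasurable (hG.prodMk hv.1)) ?_
    filter_upwards [hGC] with t ht
    exact (ContinuousLinearMap.le_opNorm _ _).trans (by gcongr)
  -- For the fixed limit coefficient, the adjoint turns each component of the integral into a
  -- pairing with a bounded test function.
  have hfix : Tendsto (fun k => ∫ t, Alim t (u k t) ∂μ) atTop (𝓝 (∫ t, Alim t (ulim t) ∂μ)) := by
    have hcoord : ∀ (v : ℝ → Euc m), MemLp v 2 μ → ∀ i, (∫ t, Alim t (v t) ∂μ) i =
        ∫ t, inner ℝ (ContinuousLinearMap.adjoint (Alim t) (EuclideanSpace.single i 1))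
          (v t) ∂μ := by
      intro v hv i
      have := ContinuousLinearMap.integral_comp_comm (EuclideanSpace.proj i : Euc n →L[ℝ] ℝ)
        (hmul Alim B v hAm hAB hv)
      refine this.symm.trans ?_
      refine integral_congr_ae (Eventually.of_forall fun t => ?_)
      simp [ContinuousLinearMap.adjoint_inner_left, EuclideanSpace.inner_single_left]
    have hpi : Tendsto (fun k => (∫ t, Alim t (u k t) ∂μ).ofLp) atTop
        (𝓝 (∫ t, Alim t (ulim t) ∂μ).ofLp) := by
      refine tendsto_pi_nhds.2 fun i => ?_
      rw [hcoord ulim hlim]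
      simp only [fun k => hcoord (u k) (hu k) i]
      refine h _ (MemLp.of_bound (C := B) ?_ ?_)
      · exact (ContinuousLinearMap.adjoint (𝕜 := ℝ) (E := Euc m)
          (F := Euc n)).continuous.comp_aestronglyMeasurable hAm |>.apply_continuousLinearMap _
      · filter_upwards [hAB] with t ht
        refine (ContinuousLinearMap.le_opNorm _ _).trans ?_
        rw [LinearIsometryEquiv.norm_map]
        simpa using ht
    exact ((PiLp.continuous_toLp 2 _).tendsto _).comp hpi
  -- Cauchy–Schwarz: the coefficients converge in L² by dominated convergence, while the controls
  -- are merely bounded in L².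
  have hdiff : Tendsto (fun k => ∫ t, (A k t - Alim t) (u k t) ∂μ) atTop (𝓝 0) := by
    have hsq : Tendsto (fun k => ∫ t, ‖A k t - Alim t‖ ^ 2 ∂μ) atTop (𝓝 0) := by
      have : Tendsto (fun k => ∫ t, ‖A k t - Alim t‖ ^ 2 ∂μ) atTop (𝓝 (∫ t, (0 : ℝ) ∂μ)) := by
        refine tendsto_integral_filter_of_dominated_convergence (fun _ => (B + B) ^ 2) ?_ ?_
          (integrable_const _) ?_
        · filter_upwards [hA] with k hk
          exact (hk.1.sub hAm).norm.pow 2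
        · filter_upwards [hA] with k hk
          filter_upwards [hk.2, hAB] with t h1 h2
          rw [Real.norm_of_nonneg (by positivity)]
          gcongr
          exact (norm_sub_le _ _).trans (add_le_add h1 h2)
        · filter_upwards [hconv] with t ht
          simpa using ((ht.sub_const (Alim t)).norm.pow 2)
      simpa using this
    refine squeeze_zero_norm' (a := fun k => √(∫ t, ‖A k t - Alim t‖ ^ 2 ∂μ) * √R) ?_ ?_
    · filter_upwards [hA] with k hk
      have hm : MemLp (fun t => ‖A k t - Alim t‖) 2 μ := by
        refine MemLp.of_bound (C := B + B) (hk.1.sub hAm).norm ?_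
        filter_upwards [hk.2, hAB] with t h1 h2
        rw [norm_norm]
        exact (norm_sub_le _ _).trans (add_le_add h1 h2)
      have hH := integral_mul_le_Lp_mul_Lq_of_nonneg (μ := μ) Real.HolderConjugate.two_two
        (f := fun t => ‖A k t - Alim t‖) (g := fun t => ‖u k t‖)
        (Eventually.of_forall fun _ => norm_nonneg _) (Eventually.of_forall fun _ => norm_nonneg _)
        (by simpa using hm) (by simpa using (hu k).norm)
      simp only [Real.rpow_two, ← Real.sqrt_eq_rpow] at hH
      have hint : Integrable (fun t => ‖A k t - Alim t‖ * ‖u k t‖) μ :=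
        hm.integrable_mul (hu k).norm
      calc ‖∫ t, (A k t - Alim t) (u k t) ∂μ‖ ≤ ∫ t, ‖A k t - Alim t‖ * ‖u k t‖ ∂μ :=
            norm_integral_le_of_norm_le hint
              (Eventually.of_forall fun t => ContinuousLinearMap.le_opNorm _ _)
        _ ≤ _ := hH
        _ ≤ _ := by
          gcongr
          exact hR k
    · simpa using hsq.sqrt.mul_const (√R)
  have hsum := hdiff.add hfix
  rw [zero_add] at hsum
  refine hsum.congr' ?_
  filter_upwards [hA] with k hk
  rw [← integral_add (hmul (fun t => A k t - Alim t) (B + B) _ (hk.1.sub hAm) (by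
    filter_upwards [hk.2, hAB] with t h1 h2
    exact (norm_sub_le _ _).trans (add_le_add h1 h2)) (hu k)) (hmul _ B _ hAm hAB (hu k))]
  simp

end WeakConvergence

/-! ### Limits of trajectories are trajectories -/

section LimitTrajectory

/-- The limit curve lies in the open set where Φ is defined and bounded by `B + 1`, so the
approximating curves eventually do too. This supplies the dominating constants below. -/
lemma ConvergesOn.exists_bound {X E : Type*} [TopologicalSpace X] [NormedAddCommGroup E] {T : ℝ}
    {z : ℕ → ℝ → X} {zlim : ℝ → X} (h : ConvergesOn T z zlim) {S : Set X} (hS : IsOpen S)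
    {Φ : X → E} (hΦ : ContinuousOn Φ S) {a b : ℝ} (ha : 0 ≤ a) (hb : b ≤ T)
    (hz : ContinuousOn zlim (Icc a b)) (hmap : MapsTo zlim (Icc a b) S) :
    ∃ B, (∀ t ∈ Icc a b, ‖Φ (zlim t)‖ ≤ B) ∧
      ∀ᶠ k in atTop, ∀ t ∈ Icc a b, z k t ∈ S ∧ ‖Φ (z k t)‖ ≤ B := by
  obtain ⟨B, hB⟩ := isCompact_Icc.exists_bound_of_continuousOn (hΦ.comp hz hmap)
  refine ⟨B + 1, fun t ht => (hB t ht).trans (by linarith), ?_⟩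
  have hO : IsOpen (S ∩ (fun x => ‖Φ x‖) ⁻¹' Iio (B + 1)) :=
    hΦ.norm.isOpen_inter_preimage hS isOpen_Iio
  filter_upwards [h a b ha hb _ hO fun t ht => ⟨hmap ht, lt_of_le_of_lt (hB t ht) (lt_add_one B)⟩]
    with k hk t ht
  exact ⟨(hk ht).1, (le_of_lt (hk ht).2)⟩

lemma ConvergesOn.tendsto_integral {X E : Type*} [TopologicalSpace X] [NormedAddCommGroup E]
    [NormedSpace ℝ E] {T : ℝ} {z : ℕ → ℝ → X} {zlim : ℝ → X} (h : ConvergesOn T z zlim)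
    (hzk : ∀ k, ContinuousOn (z k) (Icc 0 T)) {S : Set X} (hS : IsOpen S)
    {Φ : X → E} (hΦ : ContinuousOn Φ S) {a b : ℝ} (ha : 0 ≤ a) (hab : a ≤ b) (hb : b ≤ T)
    (hz : ContinuousOn zlim (Icc a b)) (hmap : MapsTo zlim (Icc a b) S) :
    Tendsto (fun k => ∫ t in a..b, Φ (z k t)) atTop (𝓝 (∫ t in a..b, Φ (zlim t))) := by
  obtain ⟨B, -, hB⟩ := h.exists_bound hS hΦ ha hb hz hmap
  have hsub : Icc a b ⊆ Icc 0 T := Icc_subset_Icc ha hb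
  refine intervalIntegral.tendsto_integral_filter_of_dominated_convergence (fun _ => B) ?_ ?_
    intervalIntegrable_const ?_
  · filter_upwards [hB] with k hk
    rw [uIoc_of_le hab]
    exact ((hΦ.comp ((hzk k).mono hsub) fun t ht => (hk t ht).1).mono
      Ioc_subset_Icc_self).aestronglyMeasurable measurableSet_Ioc
  · filter_upwards [hB] with k hk
    refine Eventually.of_forall fun t ht => ?_
    rw [uIoc_of_le hab] at ht
    exact (hk t (Ioc_subset_Icc_self ht)).2
  · refine Eventually.of_forall fun t ht => ?_
    rw [uIoc_of_le hab] at ht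
    have ht' := Ioc_subset_Icc_self ht
    exact (hΦ.continuousAt (hS.mem_nhds (hmap ht'))).tendsto.comp (h.tendsto (hsub ht'))

lemma isOpen_proj_source (c : M) :
    IsOpen {p : TangentBundle (𝓡 n) M | p.proj ∈ (chartAt (Euc n) c).source} :=
  (chartAt (Euc n) c).open_source.preimage continuous_bundleProj

lemma hasDerivWithinAt_integral_Icc {E : Type*} [NormedAddCommGroup E] [NormedSpace ℝ E]
    [CompleteSpace E] {g : ℝ → E} {a b t : ℝ} (hg : ContinuousOn g (Icc a b)) (ht : t ∈ Icc a b) :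
    HasDerivWithinAt (fun τ => ∫ s in a..τ, g s) (g t) (Icc a b) t := by
  have : Fact (t ∈ Icc a b) := ⟨ht⟩
  refine intervalIntegral.integral_hasDerivWithinAt_right ?_ ?_ (hg t ht)
  · exact (hg.mono (by rw [uIcc_of_le ht.1]; exact Icc_subset_Icc_right ht.2)).intervalIntegrable
  · exact hg.stronglyMeasurableAtFilter_nhdsWithin measurableSet_Icc t

variable [RiemannianBundle (fun x : M => TangentSpace (𝓡 n) x)]

lemma HasVelocityOn.posCoord_sub_eq {z : ℝ → TangentBundle (𝓡 n) M} {T : ℝ}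
    (h : HasVelocityOn z (Icc 0 T)) (hz : ContinuousOn z (Icc 0 T)) {c : M} {a b : ℝ} (ha : 0 ≤ a)
    (hab : a ≤ b) (hb : b ≤ T) (hc : ∀ t ∈ Icc a b, (z t).proj ∈ (chartAt (Euc n) c).source) :
    ∫ t in a..b, velCoord c (z t) = posCoord (n := n) c (z b).proj - posCoord c (z a).proj := by
  have hsub : Icc a b ⊆ Icc 0 T := Icc_subset_Icc ha hb
  have hd : ∀ t ∈ Icc a b, HasDerivWithinAt (fun τ => posCoord (n := n) c (z τ).proj)
      (velCoord c (z t)) (Icc a b) t := fun t ht =>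
    (posCoord_hasDerivWithinAt (h t (hsub ht)) c (hc t ht)).mono hsub
  have hv : ContinuousOn (fun t => velCoord c (z t)) (Icc a b) := fun t ht =>
    ContinuousAt.comp_continuousWithinAt (g := velCoord c) (velCoord_continuousAt (hc t ht))
      ((hz.mono hsub) t ht)
  refine intervalIntegral.integral_eq_sub_of_hasDerivAt_of_le hab
    (fun t ht => (hd t ht).continuousWithinAt)
    (fun t ht => (hd t (Ioo_subset_Icc_self ht)).hasDerivAt (Icc_mem_nhds ht.1 ht.2)) ?_
  rw [← uIcc_of_le hab] at hv
  exact hv.intervalIntegrable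

variable [IsContMDiffRiemannianBundle (𝓡 n) ∞ (Euc n) (fun x : M => TangentSpace (𝓡 n) x)]

/-- A limit of trajectories is a trajectory of the weak limit of the controls. -/
lemma isTrajectory_of_convergesOn {W : M → ℝ}
    (hW : ContMDiff (𝓡 n) 𝓘(ℝ, ℝ) ∞ W) {f : Fin m → ∀ q : M, TangentSpace (𝓡 n) q}
    (hf : ∀ j, ContMDiff (𝓡 n) (𝓡 n).tangent ∞
      (fun q => (⟨q, f j q⟩ : TangentBundle (𝓡 n) M))) {R T : ℝ}
    {u : ℕ → ℝ → Euc m} {z : ℕ → ℝ → TangentBundle (𝓡 n) M} {ulim : ℝ → Euc m}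
    {zlim : ℝ → TangentBundle (𝓡 n) M} (hz : ∀ k, IsTrajectory W f T (u k) (z k))
    (hu : ∀ k, MemLp (u k) 2 (volume.restrict (Icc 0 T)))
    (huR : ∀ k, ∫ t in Icc 0 T, ‖u k t‖ ^ 2 ≤ R) (hlim : MemLp ulim 2 (volume.restrict (Icc 0 T)))
    (hweak : WeaklyTendsto (volume.restrict (Icc 0 T)) u ulim)
    (hzlim : ContinuousOn zlim (Icc 0 T)) (hconv : ConvergesOn T z zlim) :
    IsTrajectory W f T ulim zlim := by
  have hproj : ContinuousOn (fun t => (zlim t).proj) (Icc 0 T) :=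
    continuous_bundleProj.comp_continuousOn hzlim
  have hvel : ∀ c : M, ContinuousOn (velCoord (n := n) c)
      {p : TangentBundle (𝓡 n) M | p.proj ∈ (chartAt (Euc n) c).source} := fun c p hp =>
    (velCoord_continuousAt hp).continuousWithinAt
  refine ⟨fun t ht => ?_, fun c a b ha hab hb hc => ?_⟩
  · set c := (zlim t).proj with hcdef
    obtain ⟨a, b, ha, hab, hb, htab, hnh, hsub⟩ := exists_Icc_mem_nhdsWithin ht
      ((hproj t ht).preimage_mem_nhdsWithin
        ((chartAt (Euc n) c).open_source.mem_nhds (mem_chart_source _ _)))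
    have hab' : Icc a b ⊆ Icc 0 T := Icc_subset_Icc ha hb
    -- Convergence of curves says nothing about derivatives, so q̇ = v is passed to the limit in
    -- integrated form and differentiated afterwards, the limit velocity being continuous.
    have heq : ∀ τ ∈ Icc a b, posCoord (n := n) c (zlim τ).proj =
        posCoord c (zlim a).proj + ∫ s in a..τ, velCoord c (zlim s) := by
      intro τ hτ
      have hsubτ : Icc a τ ⊆ Icc a b := Icc_subset_Icc_right hτ.2
      have h1 := hconv.tendsto_integral (fun k => (hz k).continuousOn) (isOpen_proj_source c)
        (hvel c) ha hτ.1 (hτ.2.trans hb) (hzlim.mono (hsubτ.trans hab'))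
        (fun s hs => hsub (hsubτ hs))
      have hpos : ∀ σ ∈ Icc a b, Tendsto (fun k => posCoord (n := n) c (z k σ).proj) atTop
          (𝓝 (posCoord c (zlim σ).proj)) := fun σ hσ =>
        (posCoord_continuousAt (n := n) (hsub hσ)).tendsto.comp
          ((continuous_bundleProj.tendsto _).comp (hconv.tendsto (hab' hσ)))
      have h2 := (hpos τ hτ).sub (hpos a ⟨le_rfl, hab⟩)
      have h3 := hconv a τ ha (hτ.2.trans hb) _ (isOpen_proj_source c) (fun s hs => hsub (hsubτ hs))
      have h4 : Tendsto (fun k => ∫ s in a..τ, velCoord c (z k s)) atTop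
          (𝓝 (posCoord (n := n) c (zlim τ).proj - posCoord c (zlim a).proj)) := by
        refine h2.congr' ?_
        filter_upwards [h3] with k hk
        exact ((hz k).1.posCoord_sub_eq (hz k).continuousOn ha hτ.1 (hτ.2.trans hb)
          (fun s hs => hk hs)).symm
      rw [tendsto_nhds_unique h1 h4]
      abel
    refine hasMFDerivWithinAt_of_posCoord (hproj t ht) ?_
    have hv : ContinuousOn (fun s => velCoord c (zlim s)) (Icc a b) :=
      (hvel c).comp (hzlim.mono hab') (fun s hs => hsub hs)
    exact (((hasDerivWithinAt_integral_Icc hv htab).const_add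
      (posCoord (n := n) c (zlim a).proj)).congr heq (heq t htab)).mono_of_mem_nhdsWithin hnh
  · have hsub : Icc a b ⊆ Icc 0 T := Icc_subset_Icc ha hb
    have hz' := hzlim.mono hsub
    have hdrift : ContinuousOn (drift W c)
        {p : TangentBundle (𝓡 n) M | p.proj ∈ (chartAt (Euc n) c).source} := fun p hp =>
      (drift_continuousAt hW hp).continuousWithinAt
    have hctrl : ContinuousOn (fun p : TangentBundle (𝓡 n) M => controlMap f c p.proj)
        {p : TangentBundle (𝓡 n) M | p.proj ∈ (chartAt (Euc n) c).source} := fun p hp =>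
      (ContinuousAt.comp (g := controlMap f c) (controlMap_continuousAt hf hp)
        continuous_bundleProj.continuousAt).continuousWithinAt
    obtain ⟨B, hBlim, hB⟩ := hconv.exists_bound (isOpen_proj_source c) hctrl ha hb hz' hc
    -- Coefficients are cut off by the indicator of [a, b], so weak convergence on [0, T] applies
    -- directly to integrals over subintervals.
    have hI : ∀ (w : ℝ → TangentBundle (𝓡 n) M) (v : ℝ → Euc m),
        ∫ t in Icc 0 T, (Icc a b).indicator (fun t => controlMap (n := n) f c (w t).proj) t (v t) =
          ∫ t in a..b, controlMap f c (w t).proj (v t) := by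
      intro w v
      have e : ∀ t, (Icc a b).indicator (fun t => controlMap (n := n) f c (w t).proj) t (v t) =
          (Icc a b).indicator (fun t => controlMap f c (w t).proj (v t)) t := fun t => by
        by_cases ht : t ∈ Icc a b
        · rw [indicator_of_mem ht, indicator_of_mem ht]
        · rw [indicator_of_notMem ht, indicator_of_notMem ht]
          rfl
      simp only [e]
      rw [integral_indicator measurableSet_Icc, Measure.restrict_restrict_of_subset hsub,
        intervalIntegral.integral_of_le hab, integral_Icc_eq_integral_Ioc]
    have hbd : ∀ (w : ℝ → TangentBundle (𝓡 n) M), ContinuousOn w (Icc 0 T) →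
        (∀ t ∈ Icc a b, w t ∈ {p : TangentBundle (𝓡 n) M | p.proj ∈ (chartAt (Euc n) c).source} ∧
          ‖controlMap f c (w t).proj‖ ≤ B) →
        AEStronglyMeasurable ((Icc a b).indicator fun t => controlMap f c (w t).proj)
          (volume.restrict (Icc 0 T)) ∧ ∀ᵐ t ∂(volume.restrict (Icc 0 T)),
            ‖(Icc a b).indicator (fun t => controlMap f c (w t).proj) t‖ ≤ max B 0 := by
      intro w hw h
      constructor
      · rw [aestronglyMeasurable_indicator_iff measurableSet_Icc,
          Measure.restrict_restrict_of_subset hsub]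
        exact (hctrl.comp (hw.mono hsub) fun t ht => (h t ht).1).aestronglyMeasurable
          measurableSet_Icc
      · refine Eventually.of_forall fun t => ?_
        by_cases ht : t ∈ Icc a b
        · rw [indicator_of_mem ht]
          exact (h t ht).2.trans (le_max_left _ _)
        · simp [ht]
    have hbdlim := hbd zlim hzlim fun t ht => ⟨hc t ht, hBlim t ht⟩
    have h1 := hweak.tendsto_integral_clm hu hlim huR (B := max B 0)
      (A := fun k => (Icc a b).indicator fun t => controlMap f c (z k t).proj)
      (Alim := (Icc a b).indicator fun t => controlMap f c (zlim t).proj)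
      (by filter_upwards [hB] with k hk using hbd (z k) (hz k).continuousOn hk)
      hbdlim.1 hbdlim.2 (Eventually.of_forall fun t => by
        by_cases ht : t ∈ Icc a b
        · simp only [indicator_of_mem ht]
          exact (hctrl.continuousAt ((isOpen_proj_source c).mem_nhds (hc t ht))).tendsto.comp
            (hconv.tendsto (hsub ht))
        · simp only [indicator_of_notMem ht]
          exact tendsto_const_nhds)
    simp only [hI] at h1
    have h2 := hconv.tendsto_integral (fun k => (hz k).continuousOn) (isOpen_proj_source c) hdrift
      ha hab hb hz' hc
    have hcint : ∀ (w : ℝ → TangentBundle (𝓡 n) M) (v : ℝ → Euc m), ContinuousOn w (Icc 0 T) →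
        (∀ t ∈ Icc a b, w t ∈ {p : TangentBundle (𝓡 n) M | p.proj ∈ (chartAt (Euc n) c).source}) →
        MemLp v 2 (volume.restrict (Icc 0 T)) →
        IntervalIntegrable (fun t => controlMap f c (w t).proj (v t)) volume a b := by
      intro w v hw h hv
      have hcw : ContinuousOn (fun t => controlMap f c (w t).proj) (Icc a b) :=
        hctrl.comp (hw.mono hsub) h
      obtain ⟨C, hC⟩ := isCompact_Icc.exists_bound_of_continuousOn hcw
      have hv1 : IntegrableOn v (Icc a b) := (hv.integrable (by norm_num)).mono_measure
        (Measure.restrict_mono_set _ hsub)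
      rw [intervalIntegrable_iff_integrableOn_Icc_of_le hab]
      refine Integrable.mono' (hv1.norm.const_mul C)
        (isBoundedBilinearMap_apply.continuous.comp_aestronglyMeasurable
          ((hcw.aestronglyMeasurable measurableSet_Icc).prodMk hv1.1)) ?_
      refine (ae_restrict_iff' measurableSet_Icc).2 (Eventually.of_forall fun t ht => ?_)
      exact (ContinuousLinearMap.le_opNorm _ _).trans (by gcongr; exact hC t ht)
    have hdint : ∀ (w : ℝ → TangentBundle (𝓡 n) M), ContinuousOn w (Icc 0 T) →
        (∀ t ∈ Icc a b, w t ∈ {p : TangentBundle (𝓡 n) M | p.proj ∈ (chartAt (Euc n) c).source}) →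
        IntervalIntegrable (fun t => drift W c (w t)) volume a b := by
      intro w hw h
      refine ContinuousOn.intervalIntegrable ?_
      rw [uIcc_of_le hab]
      exact hdrift.comp (hw.mono hsub) h
    have hvelt : ∀ t ∈ Icc a b, Tendsto (fun k => velCoord c (z k t)) atTop
        (𝓝 (velCoord c (zlim t))) := fun t ht =>
      (velCoord_continuousAt (hc t ht)).tendsto.comp (hconv.tendsto (hsub ht))
    have hmain : velCoord c (zlim b) = velCoord c (zlim a) +
        ((∫ t in a..b, drift W c (zlim t)) +
          ∫ t in a..b, controlMap f c (zlim t).proj (ulim t)) := by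
      refine tendsto_nhds_unique (hvelt b ⟨hab, le_rfl⟩)
        (((hvelt a ⟨le_rfl, hab⟩).add (h2.add h1)).congr' ?_)
      filter_upwards [hB] with k hk
      have hk' := fun t ht => (hk t ht).1
      rw [((hz k).intervalIntegrable_and_eq ha hab hb hk').2, intervalIntegral.integral_add
        (hdint _ (hz k).continuousOn hk') (hcint _ _ (hz k).continuousOn hk' (hu k))]
    have e : EqOn (fun t => drift W c (zlim t) + controlMap f c (zlim t).proj (ulim t))
        (fun t => velCoord c (force W f (ulim t) (zlim t).proj) -
          christoffelVec c (posCoord c (zlim t).proj) (velCoord c (zlim t)) (velCoord c (zlim t)))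
        (uIcc a b) := by
      intro t ht
      rw [uIcc_of_le hab] at ht
      exact (acceleration_eq W f c (zlim t) (hc t ht) (ulim t)).symm
    refine ⟨((hdint _ hzlim hc).add (hcint _ _ hzlim hc hlim)).congr (e.mono uIoc_subset_uIcc), ?_⟩
    rw [← intervalIntegral.integral_congr e, hmain,
      intervalIntegral.integral_add (hdint _ hzlim hc) (hcint _ _ hzlim hc hlim)]

end LimitTrajectory

/-! ### Fatou's lemma and continuity of the tracking error -/

section OptimalControl

/-- Fatou's lemma for the Bochner integral. -/
lemma integral_le_of_tendsto {α : Type*} [MeasurableSpace α] {μ : Measure α} {F : ℕ → α → ℝ}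
    {G : α → ℝ} {c : ℝ} (hF : ∀ k, Integrable (F k) μ) (hF0 : ∀ k, 0 ≤ᵐ[μ] F k)
    (hG : Integrable G μ) (hFG : ∀ᵐ t ∂μ, Tendsto (fun k => F k t) atTop (𝓝 (G t)))
    (hc : Tendsto (fun k => ∫ t, F k t ∂μ) atTop (𝓝 c)) : ∫ t, G t ∂μ ≤ c := by
  have hG0 : 0 ≤ᵐ[μ] G := by
    filter_upwards [hFG, ae_all_iff.2 hF0] with t h1 h2
    exact ge_of_tendsto' h1 h2
  have hc0 : 0 ≤ c := ge_of_tendsto' hc fun k => integral_nonneg_of_ae (hF0 k)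
  rw [← ENNReal.ofReal_le_ofReal_iff hc0, ofReal_integral_eq_lintegral_ofReal hG hG0]
  have h1 : ∫⁻ t, ENNReal.ofReal (G t) ∂μ =
      ∫⁻ t, liminf (fun k => ENNReal.ofReal (F k t)) atTop ∂μ := by
    refine lintegral_congr_ae ?_
    filter_upwards [hFG] with t ht
    exact ((ENNReal.tendsto_ofReal ht).liminf_eq).symm
  rw [h1]
  refine (lintegral_liminf_le' fun k => (hF k).1.aemeasurable.ennreal_ofReal).trans_eq ?_
  simp only [← ofReal_integral_eq_lintegral_ofReal (hF _) (hF0 _)]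
  exact (ENNReal.tendsto_ofReal hc).liminf_eq

variable [RiemannianBundle (fun x : M => TangentSpace (𝓡 n) x)]

/-- The part of the running cost that does not depend on the control. -/
def trackingError (T : ℝ) (qref : ℝ → M) (z : ℝ → TangentBundle (𝓡 n) M) (t : ℝ) : ℝ :=
  (1 / 2) * ‖(z t).snd - transport (z t).proj (qref t)
      (mfderivWithin 𝓘(ℝ, ℝ) (𝓡 n) qref (Icc 0 T) t (1 : ℝ))‖ ^ 2 +
    halfSqDist n (qref t) (z t).proj

lemma trackingLagrangian_eq (T : ℝ) (qref : ℝ → M) (u : ℝ → Euc m)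
    (z : ℝ → TangentBundle (𝓡 n) M) (t : ℝ) :
    trackingLagrangian T qref u z t = ‖u t‖ ^ 2 + trackingError T qref z t :=
  add_assoc _ _ _

lemma trackingError_nonneg (T : ℝ) (qref : ℝ → M) (z : ℝ → TangentBundle (𝓡 n) M) (t : ℝ) :
    0 ≤ trackingError T qref z t := by
  unfold trackingError halfSqDist
  positivity

lemma continuousOn_velocity {T : ℝ} (hT : 0 < T) {qref : ℝ → M}
    (hqref : ContMDiffOn 𝓘(ℝ, ℝ) (𝓡 n) 1 qref (Icc 0 T)) :
    ContinuousOn (fun t => (⟨qref t, mfderivWithin 𝓘(ℝ, ℝ) (𝓡 n) qref (Icc 0 T) t (1 : ℝ)⟩ :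
      TangentBundle (𝓡 n) M)) (Icc 0 T) := by
  have h1 := hqref.continuousOn_tangentMapWithin le_rfl
    (uniqueDiffOn_Icc hT).uniqueMDiffOn
  have h2 : Continuous (fun t : ℝ => (⟨t, (1 : ℝ)⟩ : TangentBundle 𝓘(ℝ, ℝ) ℝ)) :=
    (tangentBundleModelSpaceHomeomorph 𝓘(ℝ, ℝ)).symm.continuous.comp
      (continuous_id.prodMk continuous_const)
  exact h1.comp h2.continuousOn fun t ht => ht

variable [IsContMDiffRiemannianBundle (𝓡 n) ∞ (Euc n) (fun x : M => TangentSpace (𝓡 n) x)]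

lemma tendsto_norm_sub_sq {ι : Type*} {l : Filter ι} {q : ι → M}
    {v w : ∀ k, TangentSpace (𝓡 n) (q k)} {p : M} {v₀ w₀ : TangentSpace (𝓡 n) p}
    (hv : Tendsto (fun k => (⟨q k, v k⟩ : TangentBundle (𝓡 n) M)) l (𝓝 ⟨p, v₀⟩))
    (hw : Tendsto (fun k => (⟨q k, w k⟩ : TangentBundle (𝓡 n) M)) l (𝓝 ⟨p, w₀⟩)) :
    Tendsto (fun k => ‖v k - w k‖ ^ 2) l (𝓝 (‖v₀ - w₀‖ ^ 2)) := by
  simp only [← real_inner_self_eq_norm_sq, real_inner_sub_sub_self]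
  exact ((tendsto_inner hv hv).sub ((tendsto_inner hv hw).const_mul 2)).add (tendsto_inner hw hw)

/-- Times and curves vary together so that one statement serves twice: a constant curve gives
continuity in time, a constant time gives pointwise convergence along a sequence of trajectories. -/
lemma tendsto_trackingError [T2Space M] {T : ℝ} (hT : 0 < T) {qref : ℝ → M}
    (hqref : ContMDiffOn 𝓘(ℝ, ℝ) (𝓡 n) 1 qref (Icc 0 T)) {tk : ℕ → ℝ} {t : ℝ}
    (htk : ∀ k, tk k ∈ Icc 0 T) (ht : t ∈ Icc 0 T) (htt : Tendsto tk atTop (𝓝 t))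
    {zk : ℕ → ℝ → TangentBundle (𝓡 n) M} {z : ℝ → TangentBundle (𝓡 n) M}
    (hz : Tendsto (fun k => zk k (tk k)) atTop (𝓝 (z t)))
    (hk : ∀ k, IsClose n (qref (tk k)) (zk k (tk k)).proj) (h : IsClose n (qref t) (z t).proj) :
    Tendsto (fun k => trackingError T qref (zk k) (tk k)) atTop (𝓝 (trackingError T qref z t)) := by
  have hq : Tendsto (fun k => (zk k (tk k)).proj) atTop (𝓝 (z t).proj) :=
    (continuous_bundleProj.tendsto _).comp hz
  have hv := (continuousOn_velocity hT hqref t ht).tendsto.comp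
    (tendsto_nhdsWithin_iff.2 ⟨htt, Eventually.of_forall htk⟩)
  have htr := tendsto_transport (pk := fun k => qref (tk k)) hv hq hk h
  have hp : Tendsto (fun k => qref (tk k)) atTop (𝓝 (qref t)) :=
    (continuous_bundleProj.tendsto _).comp hv
  exact ((tendsto_norm_sub_sq hz htr).const_mul _).add (tendsto_halfSqDist hp hq h)

lemma continuousOn_trackingError [T2Space M] {T : ℝ} (hT : 0 < T) {qref : ℝ → M}
    (hqref : ContMDiffOn 𝓘(ℝ, ℝ) (𝓡 n) 1 qref (Icc 0 T)) {z : ℝ → TangentBundle (𝓡 n) M}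
    (hz : ContinuousOn z (Icc 0 T)) (h : ∀ t ∈ Icc 0 T, IsClose n (qref t) (z t).proj) :
    ContinuousOn (trackingError T qref z) (Icc 0 T) := by
  rw [continuousOn_iff_continuous_domRestrict, continuous_iff_seqContinuous]
  intro tk t htk
  have htk' : Tendsto (fun k => (tk k : ℝ)) atTop (𝓝 t) :=
    (continuous_subtype_val.tendsto t).comp htk
  exact tendsto_trackingError hT hqref (fun k => (tk k).2) t.2 htk' (zk := fun _ => z)
    ((hz t t.2).tendsto.comp (tendsto_nhdsWithin_iff.2
      ⟨htk', Eventually.of_forall fun k => (tk k).2⟩)) (fun k => h _ (tk k).2) (h t t.2)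

end OptimalControl

/-! ### Compactness of admissible pairs with bounded energy -/

section Existence

variable [RiemannianBundle (fun x : M => TangentSpace (𝓡 n) x)]
variable [IsContMDiffRiemannianBundle (𝓡 n) ∞ (Euc n) (fun x : M => TangentSpace (𝓡 n) x)]

lemma IsAdmissible.integrable_trackingError [T2Space M] {W : M → ℝ}
    {f : Fin m → ∀ q : M, TangentSpace (𝓡 n) q} {Ω : Set (Euc m)}
    {K : Set (TangentBundle (𝓡 n) M)} {z₀ : TangentBundle (𝓡 n) M} {T : ℝ} (hT : 0 < T)
    {qref : ℝ → M} (hqref : ContMDiffOn 𝓘(ℝ, ℝ) (𝓡 n) 1 qref (Icc 0 T)) {u : ℝ → Euc m}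
    {z : ℝ → TangentBundle (𝓡 n) M} (h : IsAdmissible W f Ω K z₀ T u z)
    (hclose : ∀ t ∈ Icc 0 T, IsClose n (qref t) (z t).proj) :
    Integrable (trackingError T qref z) (volume.restrict (Icc 0 T)) :=
  (continuousOn_trackingError hT hqref h.2.2.1.continuousOn hclose).integrableOn_Icc

lemma IsAdmissible.integrable_norm_sq {W : M → ℝ}
    {f : Fin m → ∀ q : M, TangentSpace (𝓡 n) q} {Ω : Set (Euc m)}
    {K : Set (TangentBundle (𝓡 n) M)} {z₀ : TangentBundle (𝓡 n) M} {T : ℝ} {u : ℝ → Euc m}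
    {z : ℝ → TangentBundle (𝓡 n) M} (h : IsAdmissible W f Ω K z₀ T u z) :
    Integrable (fun t => ‖u t‖ ^ 2) (volume.restrict (Icc 0 T)) :=
  h.1.integrable_norm_pow (by norm_num)

lemma IsAdmissible.trackingCost_eq [T2Space M] {W : M → ℝ}
    {f : Fin m → ∀ q : M, TangentSpace (𝓡 n) q} {Ω : Set (Euc m)}
    {K : Set (TangentBundle (𝓡 n) M)} {z₀ : TangentBundle (𝓡 n) M} {T : ℝ} (hT : 0 < T)
    {qref : ℝ → M} (hqref : ContMDiffOn 𝓘(ℝ, ℝ) (𝓡 n) 1 qref (Icc 0 T)) {u : ℝ → Euc m}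
    {z : ℝ → TangentBundle (𝓡 n) M} (h : IsAdmissible W f Ω K z₀ T u z)
    (hclose : ∀ t ∈ Icc 0 T, IsClose n (qref t) (z t).proj) :
    trackingCost T qref u z =
      (∫ t in Icc 0 T, ‖u t‖ ^ 2) + ∫ t in Icc 0 T, trackingError T qref z t := by
  rw [trackingCost, intervalIntegral.integral_of_le hT.le, ← integral_Icc_eq_integral_Ioc,
    ← integral_add h.integrable_norm_sq (h.integrable_trackingError hT hqref hclose)]
  simp only [trackingLagrangian_eq]

/-- Sequential compactness of the set of admissible controls with bounded energy. -/
lemma IsAdmissible.exists_subseq [T2Space M] [SecondCountableTopology M] {W : M → ℝ}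
    (hW : ContMDiff (𝓡 n) 𝓘(ℝ, ℝ) ∞ W) {f : Fin m → ∀ q : M, TangentSpace (𝓡 n) q}
    (hf : ∀ j, ContMDiff (𝓡 n) (𝓡 n).tangent ∞
      (fun q => (⟨q, f j q⟩ : TangentBundle (𝓡 n) M))) {Ω : Set (Euc m)} (hΩ : IsClosed Ω)
    (hΩc : Convex ℝ Ω) {K : Set (TangentBundle (𝓡 n) M)} (hK : IsCompact K)
    {z₀ : TangentBundle (𝓡 n) M} {T : ℝ} (hT : 0 < T) {u : ℕ → ℝ → Euc m}
    {z : ℕ → ℝ → TangentBundle (𝓡 n) M} (h : ∀ k, IsAdmissible W f Ω K z₀ T (u k) (z k)) {R : ℝ}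
    (hR : ∀ k, ∫ t in Icc 0 T, ‖u k t‖ ^ 2 ≤ R) :
    ∃ φ : ℕ → ℕ, StrictMono φ ∧ ∃ (ulim : ℝ → Euc m) (zlim : ℝ → TangentBundle (𝓡 n) M) (E : ℝ),
      IsAdmissible W f Ω K z₀ T ulim zlim ∧
      Tendsto (fun k => ∫ t in Icc 0 T, ‖u (φ k) t‖ ^ 2) atTop (𝓝 E) ∧
      ∫ t in Icc 0 T, ‖ulim t‖ ^ 2 ≤ E ∧
      ∀ t ∈ Icc 0 T, Tendsto (fun k => z (φ k) t) atTop (𝓝 (zlim t)) := by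
  have hR0 : 0 ≤ R := (integral_nonneg fun _ => by positivity).trans (hR 0)
  obtain ⟨φ₁, hφ₁, ulim, hulim, hweak⟩ := exists_subseq_weaklyTendsto (fun k => (h k).1) hR
  obtain ⟨φ₂, hφ₂, zlim, hzc, hzK, hconv⟩ := exists_subseq_convergesOn hW hf hR0 hK hT.le
    (fun k => (h (φ₁ k)).2.2.1) (fun k => (h (φ₁ k)).1) (fun k => hR (φ₁ k))
    (fun k => (h (φ₁ k)).2.2.2.2)
  -- A third extraction makes the energies converge, so that the cost can later be split into two
  -- convergent parts.
  obtain ⟨E, -, φ₃, hφ₃, hE⟩ := isCompact_Icc.tendsto_subseq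
    (x := fun k => ∫ t in Icc 0 T, ‖u (φ₁ (φ₂ k)) t‖ ^ 2) (s := Icc 0 R)
    (fun k => ⟨integral_nonneg fun _ => by positivity, hR _⟩)
  have hweak' := hweak.comp_tendsto (hφ₂.comp hφ₃).tendsto_atTop
  have hconv' := hconv.comp_tendsto hφ₃.tendsto_atTop
  have hadm := fun k => h (φ₁ (φ₂ (φ₃ k)))
  have htraj := isTrajectory_of_convergesOn hW hf (fun k => (hadm k).2.2.1) (fun k => (hadm k).1)
    (fun k => hR _) hulim hweak' hzc hconv'
  have h0 : (0 : ℝ) ∈ Icc 0 T := ⟨le_rfl, hT.le⟩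
  have hz0 : zlim 0 = z₀ := tendsto_nhds_unique (hconv'.tendsto h0)
    (tendsto_const_nhds.congr fun k => (hadm k).2.2.2.1.symm)
  exact ⟨fun k => φ₁ (φ₂ (φ₃ k)), hφ₁.comp (hφ₂.comp hφ₃), ulim, zlim, E,
    ⟨hulim, hweak'.ae_mem (fun k => (hadm k).1) hulim hΩ hΩc fun k => (hadm k).2.1, htraj, hz0,
      hzK⟩,
    hE, hweak'.integral_norm_sq_le (fun k => (hadm k).1) hulim hE, fun t ht => hconv'.tendsto ht⟩

end Existence

end Robot

end

/-! ### Existence of an optimal control -/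

theorem mainTheorem10 {n m : ℕ} {M : Type*} [TopologicalSpace M] [T2Space M]
    [SecondCountableTopology M] [ChartedSpace (Robot.Euc n) M] [IsManifold (𝓡 n) ∞ M]
    [RiemannianBundle (fun x : M => TangentSpace (𝓡 n) x)]
    [IsContMDiffRiemannianBundle (𝓡 n) ∞ (Robot.Euc n) (fun x : M => TangentSpace (𝓡 n) x)]
    (W : M → ℝ) (hW : ContMDiff (𝓡 n) 𝓘(ℝ, ℝ) ∞ W)
    (f : Fin m → ∀ q : M, TangentSpace (𝓡 n) q)
    (hf : ∀ j, ContMDiff (𝓡 n) (𝓡 n).tangent ∞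
      (fun q => (⟨q, f j q⟩ : TangentBundle (𝓡 n) M)))
    (Ω : Set (Robot.Euc m)) (hΩ : IsClosed Ω) (hΩc : Convex ℝ Ω)
    (K : Set (TangentBundle (𝓡 n) M)) (hK : IsCompact K)
    (z₀ : TangentBundle (𝓡 n) M) (T : ℝ) (hT : 0 < T)
    (qref : ℝ → M) (hqref : ContMDiffOn 𝓘(ℝ, ℝ) (𝓡 n) 1 qref (Icc 0 T))
    (hne : ∃ u z, Robot.IsAdmissible W f Ω K z₀ T u z)
    (hclose : ∀ u z, Robot.IsAdmissible W f Ω K z₀ T u z →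
      ∀ t ∈ Icc 0 T, Robot.IsClose n (qref t) (z t).proj) :
    (∀ u z, Robot.IsAdmissible W f Ω K z₀ T u z →
      IntervalIntegrable (Robot.trackingLagrangian T qref u z) volume 0 T) ∧
    ∃ u z, Robot.IsAdmissible W f Ω K z₀ T u z ∧
      ∀ u' z', Robot.IsAdmissible W f Ω K z₀ T u' z' →
        Robot.trackingCost T qref u z ≤ Robot.trackingCost T qref u' z' := by
  refine ⟨fun u z h => ?_, ?_⟩
  · rw [intervalIntegrable_iff_integrableOn_Icc_of_le hT.le]
    exact (h.integrable_norm_sq.add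
      (h.integrable_trackingError hT hqref (hclose u z h))).congr
      (Filter.Eventually.of_forall fun t => (Robot.trackingLagrangian_eq T qref u z t).symm)
  let S : Set ℝ := {J | ∃ u z, Robot.IsAdmissible W f Ω K z₀ T u z ∧
    Robot.trackingCost T qref u z = J}
  have hE0 : ∀ u : ℝ → Robot.Euc m, 0 ≤ ∫ t in Icc 0 T, ‖u t‖ ^ 2 := fun u =>
    integral_nonneg fun _ => by positivity
  have hr0 : ∀ z : ℝ → TangentBundle (𝓡 n) M,
      0 ≤ ∫ t in Icc 0 T, Robot.trackingError T qref z t := fun z =>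
    integral_nonneg fun t => Robot.trackingError_nonneg T qref z t
  have hbdd : BddBelow S := by
    refine ⟨0, ?_⟩
    rintro _ ⟨u, z, h, rfl⟩
    rw [h.trackingCost_eq hT hqref (hclose u z h)]
    exact add_nonneg (hE0 u) (hr0 z)
  obtain ⟨J, hJanti, hJ, hJS⟩ := exists_seq_tendsto_sInf (S := S)
    (by obtain ⟨u, z, h⟩ := hne; exact ⟨_, u, z, h, rfl⟩) hbdd
  choose u z h hcost using hJS
  have hdec : ∀ k, J k = (∫ t in Icc 0 T, ‖u k t‖ ^ 2) +
      ∫ t in Icc 0 T, Robot.trackingError T qref (z k) t := fun k => by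
    rw [← hcost k, (h k).trackingCost_eq hT hqref (hclose _ _ (h k))]
  -- The cost `J 0` bounds all energies, because the minimizing sequence is antitone and the
  -- tracking errors are nonnegative.
  obtain ⟨φ, hφ, ulim, zlim, E, hlim, hE, hEle, hz⟩ := Robot.IsAdmissible.exists_subseq hW hf hΩ hΩc
    hK hT h (R := J 0) fun k => by
      have h1 := hdec k
      have h2 := hr0 (z k)
      have h3 := hJanti (Nat.zero_le k)
      linarith
  -- The integrated tracking errors are the costs minus the energies, so they converge to inf J - E.
  -- Adding the energy of the limit, which is at most E, gives at most inf J.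
  have hrest : ∫ t in Icc 0 T, Robot.trackingError T qref zlim t ≤ sInf S - E := by
    refine Robot.integral_le_of_tendsto (F := fun k => Robot.trackingError T qref (z (φ k)))
      (fun k => (h (φ k)).integrable_trackingError hT hqref (hclose _ _ (h (φ k))))
      (fun k => Filter.Eventually.of_forall fun t => Robot.trackingError_nonneg T qref _ t)
      (hlim.integrable_trackingError hT hqref (hclose _ _ hlim)) ?_ ?_
    · refine (ae_restrict_iff' measurableSet_Icc).2 (Filter.Eventually.of_forall fun t ht => ?_)
      exact Robot.tendsto_trackingError hT hqref (fun _ => ht) ht tendsto_const_nhds (hz t ht)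
        (fun k => hclose _ _ (h (φ k)) t ht) (hclose _ _ hlim t ht)
    · refine ((hJ.comp hφ.tendsto_atTop).sub hE).congr fun k => ?_
      rw [Function.comp_apply, hdec]
      ring
  refine ⟨ulim, zlim, hlim, fun u' z' h' => ?_⟩
  calc Robot.trackingCost T qref ulim zlim
      = (∫ t in Icc 0 T, ‖ulim t‖ ^ 2) + ∫ t in Icc 0 T, Robot.trackingError T qref zlim t :=
        hlim.trackingCost_eq hT hqref (hclose _ _ hlim)
    _ ≤ sInf S := by linarith
    _ ≤ Robot.trackingCost T qref u' z' := csInf_le hbdd ⟨u', z', h', rfl⟩
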